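/- Let $k\ge 1$. For $i=1,\dots,k$ let $(X_i,\mu_i)$ be a non-atomic Lebesgue probability space (a standard Borel space with a non-atomic probability measure) and let $\{T_i^z\}_{z\in\mathbb Z^2}$ be a $\mathbb Z^2$-action by automorphisms (invertible measure-preserving transformations) of $(X_i,\mu_i)$, i.e. $T_i^{z}T_i^{z'}=T_i^{z+z'}$. To an automorphism $S$ of a probability space $(Y,\nu)$ corresponds the operator $(\hat Sf)(y)=f(Sy)$ on the complex space $L_2(Y,\nu)$. Let $I$ be the identity operator, $\Theta$ the orthogonal projection onto the constants, and $L_2^0(Y,\nu)=L_2(Y,\nu)\ominus\{\mathrm{const}\}$. A $\mathbb Z^2$-action $\{S^z\}$ is totally ergodic if $S^z$ is ergodic for every $z\ne 0$. A closed subspace $C$ is cyclic if it is the closed linear span of $\{\hat S^zh: z\in\mathbb Z^2\}$ for some vector $h$. The symmetric square $\hat T_i\odot\hat T_i$ is the restriction of $\{\hat T_i^z\otimes\hat T_i^z\}$ to the functions $F\in L_2(X_i\times X_i,\mu_i\times\mu_i)$ with $F(x,y)=F(y,x)$; it has simple spectrum if the space of such functions orthogonal to the constants is cyclic. The restriction of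 an action to an invariant closed subspace $K$ has homogeneous spectrum of multiplicity $n\in\{1,2,\dots,\infty\}$ if $K$ is an orthogonal sum of $n$ cyclic subspaces on which the restrictions of the action are unitarily isomorphic to each other. The set of spectral multiplicities of $\{S^z\}$ is the set of essential values of the multiplicity function of $\{\hat S^z\}$ on $L_2^0(Y,\nu)$; that is, $n$ belongs to it if and only if there is a nonzero closed invariant subspace $K\subseteq L_2^0(Y,\nu)$ on which the action has homogeneous spectrum of multiplicity $n$ and such that there is no nonzero bounded operator $K\to L_2^0(Y,\nu)\ominus K$ intertwining the two restrictions of the action. **Theorem.** Suppose that the action $$\{(\hat T_1^z\otimes\hat T_1^z)\otimes\dots\otimes(\hat T_k^z\otimes\hat T_k^z)\}_{z\in\mathbb Z^2},$$ that is, the diagonal action $(T_1^z\times T_1^z)\times\dots\times(T_k^z\times T_k^z)$ on $\prod_{i=1}^k(X_i\times X_i)$ with the product measure, is totally ergodic, and that 1. each of the symmetric squares $\hat T_1\odot\hat T_1,\dots,\hat T_k\odot\hat T_k$ has simple spectrum; 2. for each $i\in\{1,\dots,k\}$ there are sequences $w_n^i,u_n^i\in\mathbb Z^2$ and real numbers $a_j^i,b_j^i>0$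 ($1\le j\le k$) such that, in the weak operator topology as $n\to\infty$, $$\hat T_i^{w_n^i}\to a_i^i\hat T_i^{(1,0)}+(1-a_i^i)\Theta,\qquad \hat T_j^{w_n^i}\to a_j^iI+(1-a_j^i)\Theta\quad(j\ne i),$$ $$\hat T_i^{u_n^i}\to b_i^i\hat T_i^{(0,1)}+(1-b_i^i)\Theta,\qquad \hat T_j^{u_n^i}\to b_j^iI+(1-b_j^i)\Theta\quad(j\ne i).$$ Then the set of spectral multiplicities of this action is exactly $\{2,4,8,\dots,2^k\}$. -/

import Mathlib

open MeasureTheory Filter Topology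

/-- A `ℤ²`-action by automorphisms (invertible bi-measurable measure preserving maps) of the
measure space `(X, μ)`. -/
structure Z2Action (X : Type*) [MeasurableSpace X] (μ : Measure X) where
  /-- the automorphism `T^z` -/
  map : ℤ × ℤ → X ≃ᵐ X
  measurePreserving : ∀ z, MeasurePreserving (map z) μ μ
  map_add : ∀ z₁ z₂ x, map (z₁ + z₂) x = map z₁ (map z₂ x)

namespace Z2Action

noncomputable section

section basic

variable {X : Type*} [MeasurableSpace X] {μ : Measure X}

/-- The Koopman operator `(T̂^z f)(x) = f(T^z x)` on the complex space `L²(X, μ)`. -/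
def koopman (T : Z2Action X μ) (z : ℤ × ℤ) : Lp ℂ 2 μ →L[ℂ] Lp ℂ 2 μ :=
  (Lp.compMeasurePreservingₗᵢ ℂ (T.map z) (T.measurePreserving z)).toContinuousLinearMap

/-- Totally ergodic: every `T^z` with `z ≠ 0` is ergodic. -/
def TotallyErgodic (T : Z2Action X μ) : Prop :=
  ∀ z : ℤ × ℤ, z ≠ 0 → Ergodic (T.map z) μ

/-- The diagonal action `T^z × T^z` on `(X × X, μ × μ)`; its Koopman operators are
`T̂^z ⊗ T̂^z`. -/
def square [SFinite μ] (T : Z2Action X μ) : Z2Action (X × X) (μ.prod μ) where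
  map z := (T.map z).prodCongr (T.map z)
  measurePreserving z := (T.measurePreserving z).prod (T.measurePreserving z)
  map_add z₁ z₂ x := Prod.ext (T.map_add z₁ z₂ x.1) (T.map_add z₁ z₂ x.2)

end basic

/-- The diagonal action `S₁^z × ⋯ × S_k^z` on the product space; its Koopman operators are
`Ŝ₁^z ⊗ ⋯ ⊗ Ŝ_k^z`. -/
def pi {ι : Type*} [Fintype ι] {Y : ι → Type*} [∀ i, MeasurableSpace (Y i)]
    {ν : ∀ i, Measure (Y i)} [∀ i, SigmaFinite (ν i)] (S : ∀ i, Z2Action (Y i) (ν i)) :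
    Z2Action (∀ i, Y i) (Measure.pi ν) where
  map z := MeasurableEquiv.piCongrRight fun i => (S i).map z
  measurePreserving z := measurePreserving_pi ν ν fun i => (S i).measurePreserving z
  map_add z₁ z₂ x := funext fun i => (S i).map_add z₁ z₂ (x i)

end

end Z2Action

namespace L2

noncomputable section

variable {X : Type*} [MeasurableSpace X]

/-- The subspace of constants in `L²(X, μ)`. -/
def constants (μ : Measure X) [IsFiniteMeasure μ] : Submodule ℂ (Lp ℂ 2 μ) :=
  Submodule.span ℂ {Lp.const 2 μ (1 : ℂ)}

/-- The subspace `L²₀(X, μ) = L²(X, μ) ⊖ {const}`. -/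
def zeroMean (μ : Measure X) [IsFiniteMeasure μ] : Submodule ℂ (Lp ℂ 2 μ) :=
  (constants μ)ᗮ

instance (μ : Measure X) [IsFiniteMeasure μ] : (constants μ).HasOrthogonalProjection := by
  unfold constants; infer_instance

/-- The orthogonal projection `Θ` onto the constants. -/
def Theta (μ : Measure X) [IsFiniteMeasure μ] : Lp ℂ 2 μ →L[ℂ] Lp ℂ 2 μ :=
  (constants μ).starProjection

/-- The symmetric functions `F(x, y) = F(y, x)` in `L²(X × X, μ × μ)`,
i.e. `L²(X, μ) ⊙ L²(X, μ)`. -/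
def symmetric (μ : Measure X) [SFinite μ] : Submodule ℂ (Lp ℂ 2 (μ.prod μ)) :=
  LinearMap.eqLocus
    (Lp.compMeasurePreservingₗ ℂ Prod.swap (Measure.measurePreserving_swap (μ := μ) (ν := μ)))
    LinearMap.id

end

end L2

namespace Z2Spectral

noncomputable section

variable {H : Type*} [NormedAddCommGroup H] [InnerProductSpace ℂ H]

/-- Convergence of a sequence of operators in the weak operator topology. -/
def WeakLimit (A : ℕ → H →L[ℂ] H) (B : H →L[ℂ] H) : Prop :=
  ∀ f g : H, Tendsto (fun n => inner ℂ g (A n f)) atTop (𝓝 (inner ℂ g (B f)))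

/-- `C` is a cyclic subspace: the closed linear span of the orbit of some vector `h`. -/
def IsCyclicSubspace (U : ℤ × ℤ → H →L[ℂ] H) (C : Submodule ℂ H) : Prop :=
  ∃ h : H, (Submodule.span ℂ (Set.range fun z => U z h)).topologicalClosure = C

/-- A map `J` between (invariant) subspaces intertwines the restrictions of `U` to them. -/
def Intertwines (U : ℤ × ℤ → H →L[ℂ] H) {K L : Submodule ℂ H} (J : K → L) : Prop :=
  ∀ (z : ℤ × ℤ) (x : K) (hx : U z x ∈ K), (J ⟨U z x, hx⟩ : H) = U z (J x)

/-- The restrictions of `U` to `K` and `L` are unitarily isomorphic. -/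
def IsomorphicOn (U : ℤ × ℤ → H →L[ℂ] H) (K L : Submodule ℂ H) : Prop :=
  ∃ Φ : K ≃ₗᵢ[ℂ] L, Intertwines U Φ

/-- The restrictions of `U` to `K` and `L` are disjoint: there is no nonzero bounded
intertwining operator. -/
def DisjointOn (U : ℤ × ℤ → H →L[ℂ] H) (K L : Submodule ℂ H) : Prop :=
  ∀ J : K →L[ℂ] L, Intertwines U J → J = 0

/-- The restriction of `U` to `K` has homogeneous spectrum of multiplicity `n`
(`n = ⊤` means countably infinite): `K` is the orthogonal (Hilbert) sum of `n` cyclic subspaces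
on which the restrictions of `U` are isomorphic to each other. -/
def HomogeneousOn (U : ℤ × ℤ → H →L[ℂ] H) (K : Submodule ℂ H) (n : ℕ∞) : Prop :=
  ∃ C : {i : ℕ // (i : ℕ∞) < n} → Submodule ℂ H,
    (∀ i, IsCyclicSubspace U (C i)) ∧
    (∀ i j, i ≠ j → C i ⟂ C j) ∧
    (∀ i j, IsomorphicOn U (C i) (C j)) ∧
    (⨆ i, C i).topologicalClosure = K

/-- The set of spectral multiplicities (essential values of the multiplicity function) of the
unitary representation `U` on the closed invariant subspace `M`. A part `K` of `M` is disjoint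
from its complement in `M` exactly when it is the range of a spectral projection `E(B)`, and it
is nonzero and homogeneous of multiplicity `n` exactly when `B` has positive measure for the
maximal spectral type and the multiplicity function equals `n` almost everywhere on `B`. -/
def multiplicities (U : ℤ × ℤ → H →L[ℂ] H) (M : Submodule ℂ H) : Set ℕ∞ :=
  {n | ∃ K : Submodule ℂ H, K ≤ M ∧ K ≠ ⊥ ∧ DisjointOn U K (M ⊓ Kᗮ) ∧ HomogeneousOn U K n}

end

end Z2Spectral

namespace Z2Action

variable {X : Type*} [MeasurableSpace X] {μ : Measure X}

/-- The symmetric square `T̂ ⊙ T̂` has simple spectrum: the symmetric functions of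
`L²(X × X, μ × μ)` orthogonal to the constants form a cyclic subspace. -/
def SymmetricSquareSimple [IsFiniteMeasure μ] (T : Z2Action X μ) : Prop :=
  Z2Spectral.IsCyclicSubspace T.square.koopman (L2.symmetric μ ⊓ L2.zeroMean (μ.prod μ))

/-- The set of spectral multiplicities of the action, on `L²₀(X, μ)`. -/
def spectralMultiplicities [IsFiniteMeasure μ] (T : Z2Action X μ) : Set ℕ∞ :=
  Z2Spectral.multiplicities T.koopman (L2.zeroMean μ)

end Z2Action

/-! Let `U` be the diagonal action on the tensor product of the spaces `L²(X_i × X_i)`. The heart of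
the matter is that the action `R i` of `T_i × T_i` on the single factor `i` commutes with everything
that commutes with `U`. The weak limit `aT + (1 - a)Θ` equals `(Θ + a(1 - Θ))T`. Hence the limit of
`U` along the sequences `w` or `u` has the form `S²R`, where `S` is positive and invertible, `R` is
a generator of the action of one factor, and the two commute. The limit `G = S²R` lies in the
bicommutant, hence so do `G*G = S⁴`, its root `S²`, and finally `R` (`commute_of_weakLimit`).

Consequently the projection onto functions constant along factor `i`, which is the projection onto
the fixed vectors of `R i (1, 0)`, is in the bicommutant as well. The space therefore splits into
hyperinvariant sectors indexed by `A ⊆ ι`: functions of mean zero in the factors of `A` and constant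
in the others. The flips of the pairs of coordinates in `A` cut the sector `A` into `2 ^ |A|` cells
according to parity.

The all-symmetric cell is cyclic, generated by the tensor of the generators of the symmetric
squares, because each factor can be moved separately by `R i` (`closure_span_eq_cell`). The operator
`D i`, coming from `T × id - id × T`, anticommutes with the flip of factor `i` and is injective with
dense range off the constants, because `T × T⁻¹` is ergodic when `T × T` is. Its polar part
identifies cells that differ in the parity at `i` (`isomorphicOn_insert`). So the sector `A` is
homogeneous of multiplicity `2 ^ |A|`, and the sector `∅` consists of the constants.

The spectral theorem is avoided. A subspace is disjoint from its complement exactly when it is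
hyperinvariant, and hyperinvariant homogeneous subspaces of different multiplicities are orthogonal
(`orthogonal_of_lt`): on `m` copies of a cyclic representation commuting nilpotents satisfy `y ^ m =
0`, whereas `m + 1` copies carry a shift with nonzero `m`-th power. A subspace realizing a
multiplicity `n` meets some sector `A ≠ ∅` nontrivially, so `n = 2 ^ |A|`. -/

namespace Z2Spectral

/-! ### Unitary representations of `ℤ²` and their commutants. -/

variable {H : Type*} [NormedAddCommGroup H] [InnerProductSpace ℂ H] [CompleteSpace H]

/-- `U` is a unitary representation of `ℤ²`. -/
structure IsUnitaryRep (U : ℤ × ℤ → H →L[ℂ] H) : Prop where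
  map_zero : U 0 = 1
  map_add : ∀ z w, U (z + w) = U z * U w
  star_eq : ∀ z, star (U z) = U (-z)

/-- The algebra of bounded operators commuting with all `U z`. -/
def commutant (U : ℤ × ℤ → H →L[ℂ] H) : Subalgebra ℂ (H →L[ℂ] H) :=
  Subalgebra.centralizer ℂ (Set.range U)

omit [CompleteSpace H] in
theorem mem_commutant {U : ℤ × ℤ → H →L[ℂ] H} {B : H →L[ℂ] H} :
    B ∈ commutant U ↔ ∀ z, U z * B = B * U z := by
  rw [commutant, Subalgebra.mem_centralizer_iff, Set.forall_mem_range]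

omit [CompleteSpace H] in
theorem commutant_apply {U : ℤ × ℤ → H →L[ℂ] H} {B : H →L[ℂ] H} (hB : B ∈ commutant U)
    (z : ℤ × ℤ) (x : H) : B (U z x) = U z (B x) :=
  (congrArg (fun A : H →L[ℂ] H => A x) (mem_commutant.1 hB z)).symm

namespace IsUnitaryRep

variable {U : ℤ × ℤ → H →L[ℂ] H} (hU : IsUnitaryRep U)
include hU

theorem star_mem {B : H →L[ℂ] H} (hB : B ∈ commutant U) : star B ∈ commutant U := by
  rw [mem_commutant] at hB ⊢
  intro z
  have h := congrArg star (hB (-z))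
  rw [star_mul, star_mul, hU.star_eq, neg_neg] at h
  exact h.symm

theorem map_mem (w : ℤ × ℤ) : U w ∈ commutant U := by
  rw [mem_commutant]
  intro z
  rw [← hU.map_add, ← hU.map_add, add_comm]

theorem inner_apply (z : ℤ × ℤ) (x y : H) : inner ℂ (U z x) y = inner ℂ x (U (-z) y) := by
  rw [← hU.star_eq, ContinuousLinearMap.star_eq_adjoint, ContinuousLinearMap.adjoint_inner_right]

theorem span_le_commutant : Submodule.span ℂ (Set.range U) ≤ (commutant U).toSubmodule := by
  rw [Submodule.span_le]
  rintro _ ⟨w, rfl⟩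
  exact hU.map_mem w

theorem star_mem_span {a : H →L[ℂ] H} (ha : a ∈ Submodule.span ℂ (Set.range U)) :
    star a ∈ Submodule.span ℂ (Set.range U) := by
  induction ha using Submodule.span_induction with
  | mem x hx =>
    obtain ⟨z, rfl⟩ := hx
    rw [hU.star_eq]
    exact Submodule.subset_span ⟨-z, rfl⟩
  | zero => simp
  | add x y _ _ hx hy => rw [star_add]; exact add_mem hx hy
  | smul c x _ hx => rw [star_smul]; exact Submodule.smul_mem _ _ hx

omit hU [CompleteSpace H] in
theorem commute_of_mem_span {a B : H →L[ℂ] H} (ha : a ∈ Submodule.span ℂ (Set.range U))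
    (hB : B ∈ commutant U) : a * B = B * a := by
  induction ha using Submodule.span_induction with
  | mem x hx =>
    obtain ⟨z, rfl⟩ := hx
    exact mem_commutant.1 hB z
  | zero => simp
  | add x y _ _ hx hy => rw [add_mul, mul_add, hx, hy]
  | smul c x _ hx => rw [smul_mul_assoc, mul_smul_comm, hx]

/-- Cyclicity gives `a n` in the span of the action with `a n h → S h`. No bound on the norms of `a
n` is available, so the commutation is tested only on `h`, and the adjoints `star (a n)` have to be
controlled there too. -/
theorem commute_of_isSelfAdjoint {h : H}
    (hh : (Submodule.span ℂ (Set.range fun z => U z h)).topologicalClosure = ⊤)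
    {S T : H →L[ℂ] H} (hS : S ∈ commutant U) (hsa : IsSelfAdjoint S) (hT : T ∈ commutant U) :
    S * T = T * S := by
  have hdense : Dense ((Submodule.span ℂ (Set.range fun z => U z h) : Submodule ℂ H) : Set H) :=
    (Submodule.dense_iff_topologicalClosure_eq_top).2 hh
  have hspan : Submodule.span ℂ (Set.range fun z => U z h) =
      (Submodule.span ℂ (Set.range U)).map
        (ContinuousLinearMap.apply ℂ H h).toLinearMap := by
    rw [Submodule.map_span, ← Set.range_comp]
    rfl
  obtain ⟨v, hv, hlim⟩ := mem_closure_iff_seq_limit.1 (hdense (S h))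
  have hv' : ∀ n, ∃ a ∈ Submodule.span ℂ (Set.range U), a h = v n := by
    intro n
    have := hv n
    rw [hspan] at this
    obtain ⟨a, ha, hav⟩ := this
    exact ⟨a, ha, hav⟩
  choose a ha hav using hv'
  have hlim1 : Tendsto (fun n => a n h) atTop (𝓝 (S h)) := by simpa only [hav] using hlim
  -- `a n - S` is normal, so it and its adjoint `star (a n) - S` have the same norm at `h`.
  have hlim2 : Tendsto (fun n => star (a n) h) atTop (𝓝 (S h)) := by
    rw [tendsto_iff_norm_sub_tendsto_zero] at hlim1 ⊢
    refine hlim1.congr fun n => ?_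
    have hn : IsStarNormal (a n - S) := by
      constructor
      have h1 := commute_of_mem_span (ha n) hS
      have h2 := commute_of_mem_span (hU.star_mem_span (ha n)) hS
      have h3 := commute_of_mem_span (ha n) (hU.span_le_commutant (hU.star_mem_span (ha n)))
      rw [commute_iff_eq, star_sub, hsa.star_eq]
      simp only [sub_mul, mul_sub, h1, h2, h3]
      abel
    have h4 := ContinuousLinearMap.isStarNormal_iff_norm_eq_adjoint.1 hn h
    rw [← ContinuousLinearMap.star_eq_adjoint, star_sub, hsa.star_eq] at h4
    simpa using h4
  have key : S (T h) = T (S h) := by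
    rw [← sub_eq_zero, ← Submodule.mem_bot ℂ, ← Submodule.top_orthogonal_eq_bot, ← hh,
      Submodule.orthogonal_closure, Submodule.mem_orthogonal]
    intro u hu
    induction hu using Submodule.span_induction with
    | zero => simp
    | add x y _ _ hx hy => rw [inner_add_left, hx, hy, add_zero]
    | smul c x _ hx => rw [inner_smul_left, hx, mul_zero]
    | mem x hx =>
      obtain ⟨z, rfl⟩ := hx
      simp only
      rw [inner_sub_right, sub_eq_zero]
      have e1 : Tendsto (fun n => inner ℂ (U z (star (a n) h)) (T h)) atTop
          (𝓝 (inner ℂ (U z h) (S (T h)))) := by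
        have : inner ℂ (U z h) (S (T h)) = inner ℂ (U z (S h)) (T h) := by
          rw [← commutant_apply hS, ← ContinuousLinearMap.adjoint_inner_left,
            ← ContinuousLinearMap.star_eq_adjoint, hsa.star_eq]
        rw [this]
        exact (((U z).continuous.tendsto _).comp hlim2).inner tendsto_const_nhds
      have e2 : Tendsto (fun n => inner ℂ (U z h) (T (a n h))) atTop
          (𝓝 (inner ℂ (U z h) (T (S h)))) :=
        tendsto_const_nhds.inner ((T.continuous.tendsto _).comp hlim1)
      refine tendsto_nhds_unique e1 (e2.congr fun n => ?_)
      have h1 : T (a n h) = a n (T h) :=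
        (congrArg (fun A : H →L[ℂ] H => A h) (commute_of_mem_span (ha n) hT)).symm
      rw [h1, ← commutant_apply (hU.span_le_commutant (hU.star_mem_span (ha n))),
        ContinuousLinearMap.star_eq_adjoint, ContinuousLinearMap.adjoint_inner_left]
  refine ContinuousLinearMap.ext_on hdense ?_
  rintro _ ⟨z, rfl⟩
  simp only [mul_apply_eq_comp, commutant_apply hS, commutant_apply hT, key]

/-- The commutant is closed under adjoints, so the self-adjoint case applies to the real and
imaginary parts of `S`. -/
theorem commutant_commute {h : H}
    (hh : (Submodule.span ℂ (Set.range fun z => U z h)).topologicalClosure = ⊤)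
    {S T : H →L[ℂ] H} (hS : S ∈ commutant U) (hT : T ∈ commutant U) :
    S * T = T * S := by
  have hre : ((realPart S : selfAdjoint (H →L[ℂ] H)) : H →L[ℂ] H) ∈ commutant U := by
    rw [realPart_apply_coe, ← algebraMap_smul ℂ (2⁻¹ : ℝ)]
    exact Subalgebra.smul_mem _ (add_mem hS (hU.star_mem hS)) _
  have him : ((imaginaryPart S : selfAdjoint (H →L[ℂ] H)) : H →L[ℂ] H) ∈ commutant U := by
    rw [imaginaryPart_apply_coe, ← algebraMap_smul ℂ (2⁻¹ : ℝ)]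
    exact Subalgebra.smul_mem _
      (Subalgebra.smul_mem _ (sub_mem hS (hU.star_mem hS)) _) _
  rw [← realPart_add_I_smul_imaginaryPart S, add_mul, mul_add, smul_mul_assoc, mul_smul_comm,
    hU.commute_of_isSelfAdjoint hh hre (realPart S).2 hT,
    hU.commute_of_isSelfAdjoint hh him (imaginaryPart S).2 hT]

/-- A square-zero `b` is normal by commutativity, so `(b*b)² = b*² b² = 0`, and the C*-identity used
twice gives `b = 0`. -/
theorem commutant_isReduced {h : H}
    (hh : (Submodule.span ℂ (Set.range fun z => U z h)).topologicalClosure = ⊤) :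
    IsReduced (commutant U) := by
  rw [isReduced_iff_pow_one_lt 2 one_lt_two]
  rintro ⟨b, hb⟩ h0
  have hb2 : b * b = 0 := by
    have := congrArg Subtype.val h0
    simpa [pow_two] using this
  have hcomm := hU.commutant_commute hh (hU.star_mem hb) hb
  have h1 : star (star b * b) * (star b * b) = 0 := by
    rw [star_mul, star_star]
    calc star b * b * (star b * b) = star b * (b * star b) * b := by noncomm_ring
      _ = star b * (star b * b) * b := by rw [hcomm]
      _ = star b * star b * (b * b) := by noncomm_ring
      _ = 0 := by rw [hb2, mul_zero]
  rw [CStarRing.star_mul_self_eq_zero_iff, CStarRing.star_mul_self_eq_zero_iff] at h1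
  exact Subtype.ext h1

end IsUnitaryRep

/-! ### Nilpotent intertwiners on sums of copies of one representation. -/

variable {H : Type*} [NormedAddCommGroup H] [InnerProductSpace ℂ H] [CompleteSpace H]
variable {E : Type*} [NormedAddCommGroup E] [InnerProductSpace ℂ E] [CompleteSpace E]

/-- Isometric intertwining embeddings `f i` of `(E, V)` into `(H, U)` with pairwise orthogonal
ranges. -/
structure IsFrame {κ : Type*} [DecidableEq κ] (U : ℤ × ℤ → H →L[ℂ] H) (V : ℤ × ℤ → E →L[ℂ] E)
    (f : κ → E →L[ℂ] H) : Prop where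
  ortho : ∀ i j, (f i).adjoint ∘L f j = if i = j then 1 else 0
  inter : ∀ z i, U z ∘L f i = f i ∘L V z

namespace IsFrame

variable {κ : Type*} [DecidableEq κ] {U : ℤ × ℤ → H →L[ℂ] H} {V : ℤ × ℤ → E →L[ℂ] E}
  {f : κ → E →L[ℂ] H}

theorem adjoint_apply (hf : IsFrame U V f) (i j : κ) (x : E) :
    (f i).adjoint (f j x) = if i = j then x else 0 := by
  have := congrArg (fun A : E →L[ℂ] E => A x) (hf.ortho i j)
  simp only [ContinuousLinearMap.comp_apply] at this
  rw [this]
  split_ifs <;> rfl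

theorem apply_rep (hf : IsFrame U V f) (z : ℤ × ℤ) (i : κ) (x : E) :
    U z (f i x) = f i (V z x) :=
  congrArg (fun A : E →L[ℂ] H => A x) (hf.inter z i)

theorem adjoint_rep (hf : IsFrame U V f) (hU : IsUnitaryRep U) (hV : IsUnitaryRep V)
    (z : ℤ × ℤ) (i : κ) (x : H) : (f i).adjoint (U z x) = V z ((f i).adjoint x) := by
  refine ext_inner_left ℂ fun y => ?_
  have h1 := hU.inner_apply (-z) (f i y) x
  have h2 := hV.inner_apply (-z) y ((f i).adjoint x)
  rw [neg_neg] at h1 h2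
  rw [ContinuousLinearMap.adjoint_inner_right, ← h1, hf.apply_rep, ← h2,
    ContinuousLinearMap.adjoint_inner_right]

theorem comp_mem_commutant (hf : IsFrame U V f) (hU : IsUnitaryRep U) (hV : IsUnitaryRep V)
    (i j : κ) : f i ∘L (f j).adjoint ∈ commutant U := by
  rw [mem_commutant]
  intro z
  ext x
  simp only [mul_apply_eq_comp, ContinuousLinearMap.comp_apply, hf.apply_rep,
    hf.adjoint_rep hU hV]

theorem corner_mem_commutant (hf : IsFrame U V f) (hU : IsUnitaryRep U) (hV : IsUnitaryRep V)
    {y : H →L[ℂ] H} (hy : y ∈ commutant U) (i j : κ) :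
    (f i).adjoint ∘L y ∘L f j ∈ commutant V := by
  rw [mem_commutant]
  intro z
  ext x
  simp only [mul_apply_eq_comp, ContinuousLinearMap.comp_apply, ← hf.apply_rep,
    commutant_apply hy, hf.adjoint_rep hU hV]

/-- A nilpotent operator on a sum of `n` copies of a cyclic representation has order at most
`n`. -/
theorem pow_card_eq_zero [Fintype κ] (hf : IsFrame U V f) (hU : IsUnitaryRep U)
    (hV : IsUnitaryRep V) {h : E}
    (hh : (Submodule.span ℂ (Set.range fun z => V z h)).topologicalClosure = ⊤)
    {y : H →L[ℂ] H} (hy : y ∈ commutant U) (hnil : IsNilpotent y)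
    (hmap : ∀ j x, ∑ i, f i ((f i).adjoint (y (f j x))) = y (f j x)) (j : κ) (x : E) :
    (y ^ Fintype.card κ) (f j x) = 0 := by
  -- The commutant of a cyclic representation is a reduced commutative ring, so `y` becomes a matrix
  -- `Y` over such a ring and Cayley–Hamilton is available.
  let _ : CommRing (commutant V) :=
    { (inferInstance : Ring (commutant V)) with
      mul_comm := fun a b => Subtype.ext (hV.commutant_commute hh a.2 b.2) }
  have : IsReduced (commutant V) := hV.commutant_isReduced hh
  have hpow : ∀ (k : ℕ) (j : κ) (x : E),
      ∑ i, f i ((f i).adjoint ((y ^ k) (f j x))) = (y ^ k) (f j x) := by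
    intro k
    induction k with
    | zero =>
      intro j x
      simp only [pow_zero, one_apply_eq_self, hf.adjoint_apply]
      rw [Finset.sum_eq_single j (fun i _ hi => by rw [if_neg hi, map_zero]) (by simp), if_pos rfl]
    | succ k ih =>
      intro j x
      rw [pow_succ']
      simp only [mul_apply_eq_comp]
      conv_rhs => rw [← ih]
      conv_lhs => rw [← ih]
      simp only [map_sum]
      rw [Finset.sum_comm]
      exact Finset.sum_congr rfl fun l _ => by rw [hmap]
  let Y : Matrix κ κ (commutant V) := fun i j =>
    ⟨(f i).adjoint ∘L y ∘L f j, hf.corner_mem_commutant hU hV hy i j⟩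
  have hY : ∀ (k : ℕ) (i j : κ) (x : E),
      ((Y ^ k) i j : E →L[ℂ] E) x = (f i).adjoint ((y ^ k) (f j x)) := by
    intro k
    induction k with
    | zero =>
      intro i j x
      simp only [pow_zero, Matrix.one_apply, one_apply_eq_self, hf.adjoint_apply]
      split_ifs <;> rfl
    | succ k ih =>
      intro i j x
      rw [pow_succ', Matrix.mul_apply, AddSubmonoidClass.coe_finsetSum,
        sum_apply, pow_succ', mul_apply_eq_comp]
      conv_rhs => rw [← hpow k j x]
      simp only [map_sum]
      refine Finset.sum_congr rfl fun l _ => ?_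
      rw [Subalgebra.coe_mul, mul_apply_eq_comp, ih]
      rfl
  obtain ⟨N, hN⟩ := hnil
  have hYnil : IsNilpotent Y := by
    refine ⟨N, ?_⟩
    ext i j
    rw [hY, hN]
    simp
  -- For a nilpotent matrix the polynomial `charpoly - X ^ n` is nilpotent; over a reduced ring its
  -- coefficients vanish.
  have hchar : Y.charpoly = Polynomial.X ^ Fintype.card κ := by
    have h0 := Polynomial.isNilpotent_iff.1
      (Matrix.isNilpotent_charpoly_sub_pow_of_isNilpotent hYnil)
    exact sub_eq_zero.1 (Polynomial.ext fun i => (h0 i).eq_zero)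
  have hY0 : Y ^ Fintype.card κ = 0 := by
    have := Matrix.aeval_self_charpoly Y
    rwa [hchar, map_pow, Polynomial.aeval_X] at this
  rw [← hpow]
  refine Finset.sum_eq_zero fun i _ => ?_
  rw [← hY, hY0]
  simp

/-- A sum of more than `n` copies carries a nilpotent intertwiner of order exceeding `n`. -/
theorem exists_shift (hU : IsUnitaryRep U) (hV : IsUnitaryRep V) (n : ℕ)
    {f : Fin (n + 1) → E →L[ℂ] H} (hf : IsFrame U V f) :
    ∃ x ∈ commutant U, IsNilpotent x ∧ ∀ v, (x ^ n) (f 0 v) = f (Fin.last n) v := by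
  -- Extending the frame by zero makes the shift `g i ↦ g (i + 1)` uniform: it kills the last copy.
  let g : ℕ → E →L[ℂ] H := fun i => if hi : i < n + 1 then f ⟨i, hi⟩ else 0
  have hgf : ∀ i : Fin (n + 1), g i = f i := fun i => dif_pos i.2
  have hg0 : ∀ i, n < i → g i = 0 := fun i hi => dif_neg (by omega)
  let x : H →L[ℂ] H := ∑ i : Fin (n + 1), g (i + 1) ∘L (f i).adjoint
  have hxg : ∀ j v, x (g j v) = g (j + 1) v := by
    intro j v
    simp only [x, sum_apply, ContinuousLinearMap.comp_apply]
    by_cases hj : j < n + 1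
    · rw [Finset.sum_eq_single ⟨j, hj⟩]
      · rw [show g j = f ⟨j, hj⟩ from dif_pos hj, hf.adjoint_apply, if_pos rfl]
      · intro i _ hi
        rw [show g j = f ⟨j, hj⟩ from dif_pos hj, hf.adjoint_apply, if_neg hi, map_zero]
      · simp
    · rw [hg0 j (by omega), hg0 (j + 1) (by omega)]
      simp
  have hpow : ∀ k j v, (x ^ k) (g j v) = g (j + k) v := by
    intro k
    induction k with
    | zero => intro j v; simp
    | succ k ih =>
      intro j v
      rw [pow_succ', mul_apply_eq_comp, ih, hxg, add_assoc]
  -- One application lands in the span of the copies and `n + 1` more push it past the last one. The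
  -- exact nilpotency order is not needed.
  refine ⟨x, ?_, ⟨n + 2, ?_⟩, ?_⟩
  · refine sum_mem fun i _ => ?_
    by_cases hi : (i : ℕ) + 1 < n + 1
    · rw [show g (i + 1) = f ⟨i + 1, hi⟩ from dif_pos hi]
      exact hf.comp_mem_commutant hU hV _ _
    · rw [hg0 _ (by omega), ContinuousLinearMap.zero_comp]
      exact zero_mem _
  · ext v
    rw [pow_succ, mul_apply_eq_comp]
    conv_lhs => rw [show x v = ∑ i : Fin (n + 1), g (i + 1) ((f i).adjoint v) by
      simp [x, sum_apply]]
    rw [map_sum]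
    refine Finset.sum_eq_zero fun i _ => ?_
    rw [hpow, hg0 _ (by omega)]
    simp
  · intro v
    rw [← hgf 0, ← hgf (Fin.last n), hpow]
    simp

end IsFrame

/-! ### Hyperinvariant subspaces and homogeneous spectrum. -/

variable {H : Type*} [NormedAddCommGroup H] [InnerProductSpace ℂ H] [CompleteSpace H]

/-- `K` is invariant under all `U z`. -/
def Invariant (U : ℤ × ℤ → H →L[ℂ] H) (K : Submodule ℂ H) : Prop :=
  ∀ z, ∀ x ∈ K, U z x ∈ K

/-- `K` is invariant under all operators commuting with `U`. -/
def Hyperinvariant (U : ℤ × ℤ → H →L[ℂ] H) (K : Submodule ℂ H) : Prop :=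
  ∀ B ∈ commutant U, ∀ x ∈ K, B x ∈ K

/-- The restriction of `U` to an invariant subspace. -/
noncomputable def restrictRep (U : ℤ × ℤ → H →L[ℂ] H) {K : Submodule ℂ H} (hK : Invariant U K)
    (z : ℤ × ℤ) : K →L[ℂ] K :=
  (U z).restrict (hK z)

omit [CompleteSpace H] in
theorem coe_restrictRep {U : ℤ × ℤ → H →L[ℂ] H} {K : Submodule ℂ H} (hK : Invariant U K)
    (z : ℤ × ℤ) (x : K) : (restrictRep U hK z x : H) = U z x := rfl

variable {U : ℤ × ℤ → H →L[ℂ] H}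

theorem IsUnitaryRep.restrictRep (hU : IsUnitaryRep U) {K : Submodule ℂ H} [CompleteSpace K]
    (hK : Invariant U K) : IsUnitaryRep (restrictRep U hK) where
  map_zero := by
    ext x
    rw [coe_restrictRep, hU.map_zero]
    rfl
  map_add z w := by
    ext x
    rw [coe_restrictRep, hU.map_add]
    rfl
  star_eq z := by
    rw [ContinuousLinearMap.star_eq_adjoint, eq_comm, ContinuousLinearMap.eq_adjoint_iff]
    intro x y
    rw [Submodule.coe_inner, Submodule.coe_inner, coe_restrictRep, coe_restrictRep,
      hU.inner_apply, neg_neg]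

theorem IsUnitaryRep.invariant_of_hyperinvariant (hU : IsUnitaryRep U) {K : Submodule ℂ H}
    (hK : Hyperinvariant U K) : Invariant U K := fun z x hx => hK _ (hU.map_mem z) x hx

theorem IsUnitaryRep.orthogonal_invariant (hU : IsUnitaryRep U) {K : Submodule ℂ H}
    (hK : Invariant U K) : Invariant U Kᗮ := by
  intro z x hx
  rw [Submodule.mem_orthogonal] at hx ⊢
  intro u hu
  have := hU.inner_apply (-z) u x
  rw [neg_neg] at this
  rw [← this]
  exact hx _ (hK _ _ hu)

theorem IsUnitaryRep.orthogonal_hyperinvariant (hU : IsUnitaryRep U) {K : Submodule ℂ H}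
    (hK : Hyperinvariant U K) : Hyperinvariant U Kᗮ := by
  intro B hB x hx
  rw [Submodule.mem_orthogonal] at hx ⊢
  intro u hu
  rw [← ContinuousLinearMap.adjoint_inner_left, ← ContinuousLinearMap.star_eq_adjoint]
  exact hx _ (hK _ (hU.star_mem hB) _ hu)

omit [CompleteSpace H] in
/-- A projection commutes with operators leaving the subspace and its complement invariant. -/
theorem starProjection_comm {K : Submodule ℂ H} [K.HasOrthogonalProjection] {B : H →L[ℂ] H}
    (h1 : ∀ x ∈ K, B x ∈ K) (h2 : ∀ x ∈ Kᗮ, B x ∈ Kᗮ) (x : H) :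
    K.starProjection (B x) = B (K.starProjection x) := by
  refine Submodule.eq_starProjection_of_mem_orthogonal
    (h1 _ (K.starProjection_apply_mem x)) ?_
  rw [← map_sub]
  exact h2 _ (K.sub_starProjection_mem_orthogonal x)

theorem IsUnitaryRep.starProjection_mem (hU : IsUnitaryRep U) {K : Submodule ℂ H}
    [K.HasOrthogonalProjection] (hK : Invariant U K) : K.starProjection ∈ commutant U := by
  rw [mem_commutant]
  intro z
  ext x
  exact (starProjection_comm (hK z) (hU.orthogonal_invariant hK z) x).symm

theorem IsUnitaryRep.starProjection_commute (hU : IsUnitaryRep U) {K : Submodule ℂ H}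
    [K.HasOrthogonalProjection] (hK : Hyperinvariant U K) {B : H →L[ℂ] H}
    (hB : B ∈ commutant U) (x : H) : K.starProjection (B x) = B (K.starProjection x) :=
  starProjection_comm (hK B hB) (hU.orthogonal_hyperinvariant hK B hB) x

omit [CompleteSpace H] in
theorem IsCyclicSubspace.isClosed {C : Submodule ℂ H} (hC : IsCyclicSubspace U C) :
    IsClosed (C : Set H) := by
  obtain ⟨h, rfl⟩ := hC
  exact Submodule.isClosed_topologicalClosure _

omit [CompleteSpace H] in
theorem map_topologicalClosure_le {B : H →L[ℂ] H} {K L : Submodule ℂ H}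
    (hL : IsClosed (L : Set H)) (h : ∀ x ∈ K, B x ∈ L) : ∀ x ∈ K.topologicalClosure, B x ∈ L := by
  have : K.topologicalClosure ≤ L.comap B.toLinearMap :=
    Submodule.topologicalClosure_minimal _ h (hL.preimage B.continuous)
  exact this

omit [CompleteSpace H] in
theorem map_span_le {B : H →L[ℂ] H} {s : Set H} {L : Submodule ℂ H}
    (h : ∀ x ∈ s, B x ∈ L) : ∀ x ∈ Submodule.span ℂ s, B x ∈ L := by
  have : Submodule.span ℂ s ≤ L.comap B.toLinearMap := Submodule.span_le.2 h
  exact this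

theorem IsUnitaryRep.invariant_of_cyclic (hU : IsUnitaryRep U) {C : Submodule ℂ H}
    (hC : IsCyclicSubspace U C) : Invariant U C := by
  obtain ⟨h, rfl⟩ := hC
  intro z
  refine map_topologicalClosure_le (Submodule.isClosed_topologicalClosure _)
    (map_span_le ?_)
  rintro _ ⟨w, rfl⟩
  refine Submodule.le_topologicalClosure _ (Submodule.subset_span ⟨z + w, ?_⟩)
  simp [hU.map_add]

omit [CompleteSpace H] in
/-- A generator of a cyclic subspace, inside the subspace. -/
theorem IsCyclicSubspace.exists_generator {C : Submodule ℂ H} (hC : IsCyclicSubspace U C)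
    (hU0 : U 0 = 1) (hinv : Invariant U C) : ∃ h : C,
      (Submodule.span ℂ (Set.range fun z => restrictRep U hinv z h)).topologicalClosure = ⊤ := by
  obtain ⟨h, rfl⟩ := hC
  have hh : h ∈ (Submodule.span ℂ (Set.range fun z => U z h)).topologicalClosure :=
    Submodule.le_topologicalClosure _ (Submodule.subset_span ⟨0, by simp [hU0]⟩)
  refine ⟨⟨h, hh⟩, ?_⟩
  rw [eq_top_iff]
  rintro ⟨x, hx⟩ -
  set S := Submodule.span ℂ (Set.range fun z => restrictRep U hinv z ⟨h, hh⟩)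
  have hS : Submodule.span ℂ (Set.range fun z => U z h) =
      S.map (Submodule.subtype _) := by
    rw [Submodule.map_span, ← Set.range_comp]
    rfl
  change _ ∈ closure (SetLike.coe S)
  rw [closure_subtype]
  change x ∈ closure ((S.map (Submodule.subtype _) : Submodule ℂ H) : Set H)
  rw [← hS]
  exact hx

/-- The data carried by a homogeneous subspace. -/
theorem HomogeneousOn.exists_frame (hU : IsUnitaryRep U) {K : Submodule ℂ H} {n : ℕ∞}
    (hK : HomogeneousOn U K n) (hn : n ≠ 0) :
    ∃ (C : Submodule ℂ H) (_ : CompleteSpace C) (hinv : Invariant U C) (h : C)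
      (f : {i : ℕ // (i : ℕ∞) < n} → C →L[ℂ] H),
      (Submodule.span ℂ (Set.range fun z => restrictRep U hinv z h)).topologicalClosure = ⊤ ∧
      IsFrame U (restrictRep U hinv) f ∧
      (⨆ i, LinearMap.range (f i).toLinearMap).topologicalClosure = K := by
  obtain ⟨C, hcyc, horth, hiso, hsup⟩ := hK
  let i0 : {i : ℕ // (i : ℕ∞) < n} := ⟨0, by simpa using hn.bot_lt⟩
  have hinv := fun i => hU.invariant_of_cyclic (hcyc i)
  have hcomp : CompleteSpace (C i0) := (hcyc i0).isClosed.completeSpace_coe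
  obtain ⟨h, hh⟩ := (hcyc i0).exists_generator hU.map_zero (hinv i0)
  choose Φ hΦ using hiso
  let f : {i : ℕ // (i : ℕ∞) < n} → C i0 →L[ℂ] H := fun i =>
    (C i).subtypeL ∘L ((Φ i0 i).toContinuousLinearEquiv : C i0 →L[ℂ] C i)
  have hf : ∀ i x, f i x = (Φ i0 i x : H) := fun i x => rfl
  refine ⟨C i0, hcomp, hinv i0, h, f, hh, ⟨?_, ?_⟩, ?_⟩
  · intro i j
    ext x
    refine congrArg Subtype.val (ext_inner_left ℂ fun y => ?_)
    rw [ContinuousLinearMap.comp_apply, ContinuousLinearMap.adjoint_inner_right, hf, hf]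
    split_ifs with hij
    · subst hij
      rw [← Submodule.coe_inner, LinearIsometryEquiv.inner_map_map, one_apply_eq_self]
    · rw [_root_.zero_apply, inner_zero_right]
      exact (horth i j hij).inner_eq (Φ i0 i y).2 (Φ i0 j x).2
  · intro z i
    ext x
    exact (hΦ i0 i z x (hinv i0 z x x.2)).symm
  · rw [← hsup]
    congr 1
    refine iSup_congr fun i => ?_
    ext x
    constructor
    · rintro ⟨y, rfl⟩
      exact (Φ i0 i y).2
    · intro hx
      exact ⟨(Φ i0 i).symm ⟨x, hx⟩, by simp [hf]⟩

/-- Hyperinvariant homogeneous subspaces of different multiplicities are orthogonal. -/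
theorem HomogeneousOn.orthogonal_of_lt (hU : IsUnitaryRep U) {K K' : Submodule ℂ H} {n n' : ℕ∞}
    (hK : HomogeneousOn U K n) (hK' : HomogeneousOn U K' n') (hn : n ≠ 0) (hlt : n < n')
    (hyp : Hyperinvariant U K) : K ⟂ K' := by
  obtain ⟨m, rfl⟩ := ENat.ne_top_iff_exists.1 (hlt.ne_top)
  obtain ⟨C, _, hinv, h, f, hh, hf, hfK⟩ := hK.exists_frame hU hn
  obtain ⟨C', _, hinv', h', f', hh', hf', hfK'⟩ := hK'.exists_frame hU (ne_bot_of_gt hlt)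
  have hV := hU.restrictRep hinv
  have hV' := hU.restrictRep hinv'
  let e : Fin m ≃ {i : ℕ // (i : ℕ∞) < (m : ℕ∞)} :=
    Fin.equivSubtype.trans (Equiv.subtypeEquivRight fun i => by simp)
  have hle : ∀ i : Fin (m + 1), ((i : ℕ) : ℕ∞) < n' := fun i =>
    lt_of_le_of_lt (by exact_mod_cast Nat.lt_succ_iff.1 i.2) hlt
  have hg : IsFrame U (restrictRep U hinv) (fun i : Fin m => f (e i)) :=
    ⟨fun i j => by rw [hf.ortho]; simp, fun z i => hf.inter z _⟩
  have hg' : IsFrame U (restrictRep U hinv') (fun i : Fin (m + 1) => f' ⟨i, hle i⟩) :=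
    ⟨fun i j => by rw [hf'.ortho]; simp [Fin.ext_iff], fun z i => hf'.inter z _⟩
  have hclosed : IsClosed (K : Set H) := by
    rw [← hfK]; exact Submodule.isClosed_topologicalClosure _
  have : CompleteSpace K := hclosed.completeSpace_coe
  have hPmem := hU.starProjection_mem (hU.invariant_of_hyperinvariant hyp)
  have hPcomm := fun {B} (hB : B ∈ commutant U) => hU.starProjection_commute hyp hB
  -- The shift lives on `m + 1` copies inside `K'`. Its compression to `K` is nilpotent on `m`
  -- copies of a cyclic representation, so the `m`-th power of the compression vanishes on `K`.
  obtain ⟨x, hx, ⟨N, hN⟩, hxm⟩ := IsFrame.exists_shift hU hV' m hg'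
  have hPpow : ∀ k, (K.starProjection * x) ^ (k + 1) = K.starProjection * x ^ (k + 1) := by
    intro k
    have hc : Commute K.starProjection x := by
      rw [commute_iff_eq]
      ext v
      exact hPcomm hx v
    rw [hc.mul_pow]
    congr 1
    exact K.isIdempotentElem_starProjection.pow_succ_eq k
  have hfmem : ∀ i v, f i v ∈ K := fun i v => by
    rw [← hfK]
    exact Submodule.le_topologicalClosure _ (Submodule.mem_iSup_of_mem i ⟨v, rfl⟩)
  have hsum : ∀ v ∈ K, ∑ i, f (e i) ((f (e i)).adjoint v) = v := by
    have : K ≤ LinearMap.eqLocus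
        (∑ i, f (e i) ∘L (f (e i)).adjoint).toLinearMap LinearMap.id := by
      conv_lhs => rw [← hfK]
      refine Submodule.topologicalClosure_minimal _ (iSup_le ?_) ?_
      · rintro j _ ⟨v, rfl⟩
        obtain ⟨j, rfl⟩ := e.surjective j
        rw [LinearMap.mem_eqLocus]
        simp only [ContinuousLinearMap.coe_coe, LinearMap.id_apply, sum_apply,
          ContinuousLinearMap.comp_apply, hf.adjoint_apply]
        rw [Finset.sum_eq_single j (fun i _ hi => by
          rw [if_neg (fun h => hi (e.injective h)), map_zero]) (by simp), if_pos rfl]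
      · exact isClosed_eq (ContinuousLinearMap.continuous _) continuous_id
    intro v hv
    simpa [sum_apply] using this hv
  have hm : m ≠ 0 := by
    rintro rfl
    exact hn rfl
  -- A positive exponent is needed because `hPpow` fails for the zeroth power.
  obtain ⟨k, rfl⟩ : ∃ k, m = k + 1 := ⟨m - 1, by omega⟩
  have hnil : IsNilpotent (K.starProjection * x) := by
    refine ⟨N + 1, ?_⟩
    rw [hPpow, pow_succ, hN, zero_mul, mul_zero]
  have hzero := hg.pow_card_eq_zero hU hV hh (mul_mem hPmem hx) hnil (fun j v => by
    refine hsum _ ?_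
    rw [mul_apply_eq_comp]
    exact K.starProjection_apply_mem _)
  rw [Fintype.card_fin, hPpow] at hzero
  have hzeroK : ∀ v ∈ K, K.starProjection ((x ^ (k + 1)) v) = 0 := by
    intro v hv
    rw [← hsum v hv, map_sum, map_sum]
    refine Finset.sum_eq_zero fun i _ => ?_
    have := hzero i ((f (e i)).adjoint v)
    rwa [mul_apply_eq_comp] at this
  -- The last copy is `x ^ m` applied to the copy `0`, and the projection commutes with `x ^ m`.
  have hPlast : ∀ v, K.starProjection (f' ⟨k + 1, hlt⟩ v) = 0 := by
    intro v
    have h1 := hxm v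
    have h2 := hzeroK _ (K.starProjection_apply_mem (f' ⟨0, hle 0⟩ v))
    rw [← hPcomm (pow_mem hx _)] at h2
    have h3 := K.isIdempotentElem_starProjection
    have h4 := congrArg (fun A : H →L[ℂ] H => A ((x ^ (k + 1)) (f' ⟨0, hle 0⟩ v))) h3
    rw [mul_apply_eq_comp] at h4
    rw [h4] at h2
    exact (congrArg K.starProjection h1).symm.trans h2
  -- Every copy is carried from the last one by an operator of the commutant, which the projection
  -- also commutes with.
  have hPall : ∀ i v, K.starProjection (f' i v) = 0 := by
    intro i v
    have h1 : f' i v = (f' i ∘L (f' ⟨k + 1, hlt⟩).adjoint) (f' ⟨k + 1, hlt⟩ v) := by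
      rw [ContinuousLinearMap.comp_apply, hf'.adjoint_apply, if_pos rfl]
    rw [h1, hPcomm (hf'.comp_mem_commutant hU hV' _ _), hPlast, map_zero]
  have hle : K' ≤ Kᗮ := by
    rw [← hfK']
    refine Submodule.topologicalClosure_minimal _ (iSup_le ?_) (Submodule.isClosed_orthogonal _)
    rintro i _ ⟨v, rfl⟩
    exact (Submodule.starProjection_apply_eq_zero_iff K).1 (hPall i v)
  exact (Submodule.isOrtho_iff_le.2 hle).symm

/-! ### Disjointness as hyperinvariance; unitary equivalence from polar decomposition. -/

variable {H : Type*} [NormedAddCommGroup H] [InnerProductSpace ℂ H] [CompleteSpace H]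
variable {U : ℤ × ℤ → H →L[ℂ] H}

/-- An intertwiner extended by zero on `Kᗮ` belongs to the commutant, so it maps `K` into `K`; its
values also lie in `Kᗮ`. -/
theorem IsUnitaryRep.disjointOn_of_hyperinvariant (hU : IsUnitaryRep U) {K M : Submodule ℂ H}
    (hcl : IsClosed (K : Set H)) (hK : Hyperinvariant U K) : DisjointOn U K (M ⊓ Kᗮ) := by
  intro J hJ
  have : CompleteSpace K := hcl.completeSpace_coe
  have hinv := hU.invariant_of_hyperinvariant hK
  let B : H →L[ℂ] H := (M ⊓ Kᗮ).subtypeL ∘L J ∘L K.orthogonalProjectionOnto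
  have hBx : ∀ x, B x = (J (K.orthogonalProjectionOnto x) : H) := fun x => rfl
  have hB : B ∈ commutant U := by
    rw [mem_commutant]
    intro z
    ext x
    rw [mul_apply_eq_comp, mul_apply_eq_comp, hBx, hBx,
      ← hJ z _ (hinv z _ (K.orthogonalProjectionOnto x).2)]
    congr 2
    refine Subtype.ext ?_
    exact (starProjection_comm (hinv z) (hU.orthogonal_invariant hinv z) x).symm
  ext x
  have h1 : B x = (J x : H) := by
    rw [hBx, Submodule.orthogonalProjectionOnto_mem_subspace_eq_self]
  have h2 : (J x : H) ∈ K := h1 ▸ hK B hB x x.2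
  have h3 : (J x : H) ∈ Kᗮ := (J x).2.2
  have := Submodule.mem_inf.2 ⟨h2, h3⟩
  rwa [Submodule.inf_orthogonal_eq_bot, Submodule.mem_bot] at this

/-- For `B` in the commutant, the component of `B` orthogonal to `K` restricts to an intertwiner
from `K` to `M ⊓ Kᗮ`, which must vanish. Hyperinvariance of `M` keeps the values in `M`. -/
theorem IsUnitaryRep.hyperinvariant_of_disjointOn (hU : IsUnitaryRep U) {K M : Submodule ℂ H}
    (hcl : IsClosed (K : Set H)) (hinv : Invariant U K) (hKM : K ≤ M) (hM : Hyperinvariant U M)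
    (hd : DisjointOn U K (M ⊓ Kᗮ)) : Hyperinvariant U K := by
  intro B hB x hx
  have : CompleteSpace K := hcl.completeSpace_coe
  let B' : H →L[ℂ] H := B - K.starProjection ∘L B
  have hB' : B' ∈ commutant U := sub_mem hB (mul_mem (hU.starProjection_mem hinv) hB)
  have hmem : ∀ y : K, B' y ∈ M ⊓ Kᗮ := fun y =>
    ⟨sub_mem (hM B hB _ (hKM y.2)) (hKM (K.starProjection_apply_mem _)),
      K.sub_starProjection_mem_orthogonal _⟩
  let J : K →L[ℂ] (M ⊓ Kᗮ : Submodule ℂ H) := (B' ∘L K.subtypeL).codRestrict _ hmem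
  have hJ : J = 0 := hd J fun z y hy => commutant_apply hB' z y
  have h1 : B' x = 0 := congrArg (fun A : K →L[ℂ] (M ⊓ Kᗮ : Submodule ℂ H) => (A ⟨x, hx⟩ : H)) hJ
  have h2 : B x = K.starProjection (B x) := sub_eq_zero.1 h1
  rw [h2]
  exact K.starProjection_apply_mem _

omit [CompleteSpace H] in
theorem IsomorphicOn.refl (K : Submodule ℂ H) : IsomorphicOn U K K :=
  ⟨LinearIsometryEquiv.refl ℂ K, fun _ _ _ => rfl⟩

omit [CompleteSpace H] in
theorem IsomorphicOn.symm {K L : Submodule ℂ H} (hK : Invariant U K) (h : IsomorphicOn U K L) :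
    IsomorphicOn U L K := by
  obtain ⟨Φ, hΦ⟩ := h
  refine ⟨Φ.symm, fun z x hx => ?_⟩
  have h1 := hΦ z (Φ.symm x) (hK z _ (Φ.symm x).2)
  have h2 : Φ ⟨U z (Φ.symm x), hK z _ (Φ.symm x).2⟩ = ⟨U z x, hx⟩ := by
    refine Subtype.ext ?_
    rw [h1, LinearIsometryEquiv.apply_symm_apply]
  rw [← h2, LinearIsometryEquiv.symm_apply_apply]

omit [CompleteSpace H] in
theorem IsomorphicOn.trans {K L M : Submodule ℂ H} (hL : Invariant U L)
    (h : IsomorphicOn U K L) (h' : IsomorphicOn U L M) : IsomorphicOn U K M := by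
  obtain ⟨Φ, hΦ⟩ := h
  obtain ⟨Ψ, hΨ⟩ := h'
  refine ⟨Φ.trans Ψ, fun z x hx => ?_⟩
  rw [LinearIsometryEquiv.trans_apply, LinearIsometryEquiv.trans_apply,
    ← hΨ z (Φ x) (hL z _ (Φ x).2)]
  congr 2
  exact Subtype.ext (hΦ z x hx)

theorem IsUnitaryRep.isCyclicSubspace_of_isomorphicOn (hU : IsUnitaryRep U) {K L : Submodule ℂ H}
    (hK : IsCyclicSubspace U K) (hcl : IsClosed (L : Set H)) (h : IsomorphicOn U K L) :
    IsCyclicSubspace U L := by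
  have hinv := hU.invariant_of_cyclic hK
  obtain ⟨v, hv⟩ := hK.exists_generator hU.map_zero hinv
  obtain ⟨Φ, hΦ⟩ := h
  have hz : ∀ z, (Φ (Z2Spectral.restrictRep U hinv z v) : H) = U z (Φ v) :=
    fun z => hΦ z v (hinv z v v.2)
  refine ⟨Φ v, le_antisymm ?_ ?_⟩
  · refine Submodule.topologicalClosure_minimal _ (Submodule.span_le.2 ?_) hcl
    rintro _ ⟨z, rfl⟩
    simp only [← hz]
    exact (Φ _).2
  · set S := (Submodule.span ℂ (Set.range fun z => U z (Φ v))).topologicalClosure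
    let A : K →L[ℂ] H := L.subtypeL ∘L (Φ.toContinuousLinearEquiv : K →L[ℂ] L)
    have hle : (⊤ : Submodule ℂ K) ≤ S.comap A.toLinearMap := by
      rw [← hv]
      refine Submodule.topologicalClosure_minimal _ (Submodule.span_le.2 ?_)
        ((Submodule.isClosed_topologicalClosure _).preimage A.continuous)
      rintro _ ⟨z, rfl⟩
      exact Submodule.le_topologicalClosure _ (Submodule.subset_span ⟨z, (hz z).symm⟩)
    intro x hx
    have : A (Φ.symm ⟨x, hx⟩) ∈ S := hle Submodule.mem_top
    have hA : A (Φ.symm ⟨x, hx⟩) = x := by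
      change ((Φ (Φ.symm ⟨x, hx⟩) : L) : H) = x
      rw [LinearIsometryEquiv.apply_symm_apply]
    rwa [hA] at this

/-- An injective operator with dense range and its polar part. -/
theorem exists_linearIsometryEquiv_of_injective {E F : Type*} [NormedAddCommGroup E]
    [InnerProductSpace ℂ E] [CompleteSpace E] [NormedAddCommGroup F] [InnerProductSpace ℂ F]
    [CompleteSpace F] (J : E →L[ℂ] F) (hinj : ∀ x, J x = 0 → x = 0) (hd : DenseRange J) :
    ∃ (Φ : E ≃ₗᵢ[ℂ] F) (P : E →L[ℂ] E), DenseRange P ∧ (∀ x, Φ (P x) = J x) ∧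
      ∀ A : E →L[ℂ] E, Commute A (J.adjoint ∘L J) → Commute A P := by
  have hpos : (0 : E →L[ℂ] E) ≤ J.adjoint ∘L J := by
    rw [ContinuousLinearMap.nonneg_iff_isPositive]
    exact ContinuousLinearMap.isPositive_adjoint_comp_self J
  -- `P = |J|` satisfies `‖P x‖ = ‖J x‖`. It is self-adjoint and injective, hence has dense range,
  -- so `P x ↦ J x` extends to an isometry `Φ`, which is onto because `J` has dense range.
  let P := CFC.sqrt (J.adjoint ∘L J)
  have hPP : P * P = J.adjoint ∘L J := CFC.sqrt_mul_sqrt_self _ hpos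
  have hPsa : IsSelfAdjoint P := (CFC.sqrt_nonneg (J.adjoint ∘L J)).isSelfAdjoint
  have hnorm : ∀ x, ‖P x‖ = ‖J x‖ := by
    intro x
    have h1 : inner ℂ (P x) (P x) = inner ℂ (J x) (J x) := by
      rw [← ContinuousLinearMap.adjoint_inner_right, ← ContinuousLinearMap.star_eq_adjoint,
        hPsa.star_eq, ← mul_apply_eq_comp, hPP, ContinuousLinearMap.comp_apply,
        ContinuousLinearMap.adjoint_inner_right]
    rw [inner_self_eq_norm_sq_to_K, inner_self_eq_norm_sq_to_K] at h1
    have h2 : ‖P x‖ ^ 2 = ‖J x‖ ^ 2 := by exact_mod_cast h1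
    exact (sq_eq_sq₀ (norm_nonneg _) (norm_nonneg _)).1 h2
  have hPd : DenseRange P := by
    have : (LinearMap.range P.toLinearMap).topologicalClosure = ⊤ := by
      rw [Submodule.topologicalClosure_eq_top_iff]
      rw [eq_bot_iff]
      intro x hx
      rw [Submodule.mem_bot]
      apply hinj
      rw [← norm_eq_zero, ← hnorm, norm_eq_zero, ← inner_self_eq_zero (𝕜 := ℂ),
        ← ContinuousLinearMap.adjoint_inner_left, ← ContinuousLinearMap.star_eq_adjoint,
        hPsa.star_eq]
      exact (Submodule.mem_orthogonal _ _).1 hx _ ⟨P x, rfl⟩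
    exact (Submodule.dense_iff_topologicalClosure_eq_top).2 this
  let Φ₀ : E →L[ℂ] F := J.toLinearMap.extendOfNorm P.toLinearMap
  have hΦ₀ : ∀ x, Φ₀ (P x) = J x :=
    LinearMap.extendOfNorm_eq hPd ⟨1, fun x => by simp [hnorm]⟩
  have hΦnorm : ∀ x, ‖Φ₀ x‖ = ‖x‖ := fun x =>
    hPd.induction_on (p := fun x => ‖Φ₀ x‖ = ‖x‖) x (isClosed_eq (by fun_prop) (by fun_prop))
      fun y => by rw [hΦ₀, hnorm]
  let Φ₁ : E →ₗᵢ[ℂ] F := ⟨Φ₀.toLinearMap, hΦnorm⟩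
  have hsurj : Function.Surjective Φ₁ := by
    have hcl : IsClosed (Set.range Φ₁) := Φ₁.isometry.isClosedEmbedding.isClosed_range
    have hsub : Set.range J ⊆ Set.range Φ₁ := by
      rintro _ ⟨x, rfl⟩
      exact ⟨P x, hΦ₀ x⟩
    rw [← Set.range_eq_univ, ← hcl.closure_eq]
    exact (hd.mono hsub).closure_eq
  refine ⟨LinearIsometryEquiv.ofSurjective Φ₁ hsurj, P, hPd, hΦ₀, fun A hA => ?_⟩
  exact (hA.symm.cfcₙ_nnreal _).symm

/-- The polar part of the intertwiner is again an intertwiner: `J*J`, and with it `|J|`, commutes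
with the action on `K`. -/
theorem IsUnitaryRep.isomorphicOn_of_injective (hU : IsUnitaryRep U) {K L : Submodule ℂ H}
    (hKc : IsClosed (K : Set H)) (hLc : IsClosed (L : Set H)) (hK : Invariant U K)
    (hL : Invariant U L) {B : H →L[ℂ] H} (hB : B ∈ commutant U) (hKL : ∀ x ∈ K, B x ∈ L)
    (hinj : ∀ x ∈ K, B x = 0 → x = 0)
    (hdense : ∀ y ∈ L, (∀ x ∈ K, inner ℂ (B x) y = 0) → y = 0) : IsomorphicOn U K L := by
  have : CompleteSpace K := hKc.completeSpace_coe
  have : CompleteSpace L := hLc.completeSpace_coe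
  let J : K →L[ℂ] L := B.restrict hKL
  have hJ : ∀ x : K, (J x : H) = B x := fun x => rfl
  have hJd : DenseRange J := by
    have : (LinearMap.range J.toLinearMap).topologicalClosure = ⊤ := by
      rw [Submodule.topologicalClosure_eq_top_iff, eq_bot_iff]
      intro y hy
      refine Subtype.ext (hdense y y.2 fun x hx => ?_)
      exact (Submodule.mem_orthogonal _ _).1 hy _ ⟨⟨x, hx⟩, rfl⟩
    exact (Submodule.dense_iff_topologicalClosure_eq_top).2 this
  obtain ⟨Φ, P, hPd, hΦ, hcomm⟩ := exists_linearIsometryEquiv_of_injective J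
    (fun x hx => Subtype.ext (hinj x x.2 (congrArg Subtype.val hx))) hJd
  have hV := hU.restrictRep hK
  have hW := hU.restrictRep hL
  have hJV : ∀ z x, J (Z2Spectral.restrictRep U hK z x) = Z2Spectral.restrictRep U hL z (J x) :=
    fun z x => Subtype.ext (commutant_apply hB z x)
  have hJJ : ∀ z, Commute (Z2Spectral.restrictRep U hK z) (J.adjoint ∘L J) := by
    intro z
    rw [commute_iff_eq]
    ext1 x
    refine ext_inner_left ℂ fun y => ?_
    rw [mul_apply_eq_comp, mul_apply_eq_comp, ContinuousLinearMap.comp_apply,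
      ContinuousLinearMap.comp_apply, ContinuousLinearMap.adjoint_inner_right, hJV]
    have h1 := hV.inner_apply (-z) y (J.adjoint (J x))
    have h2 := hW.inner_apply (-z) (J y) (J x)
    rw [neg_neg] at h1 h2
    rw [← h1, ContinuousLinearMap.adjoint_inner_right, hJV, h2]
  refine ⟨Φ, fun z x hx => ?_⟩
  have : ∀ x : K, Φ (Z2Spectral.restrictRep U hK z x) = Z2Spectral.restrictRep U hL z (Φ x) := by
    intro x
    refine hPd.induction_on
      (p := fun x => Φ (Z2Spectral.restrictRep U hK z x) = Z2Spectral.restrictRep U hL z (Φ x)) x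
      (isClosed_eq (by fun_prop) (by fun_prop)) fun y => ?_
    have := congrArg (fun A : K →L[ℂ] K => A y) (hcomm _ (hJJ z)).eq
    simp only [mul_apply_eq_comp] at this
    rw [this, hΦ, hΦ, hJV]
  exact congrArg Subtype.val (this x)

/-! ### Projections onto fixed vectors. -/

section FixProj

variable {H : Type*} [NormedAddCommGroup H] [InnerProductSpace ℂ H] [CompleteSpace H]

/-- The vectors fixed by `q`. -/
def fixedSpace (q : H →L[ℂ] H) : Submodule ℂ H :=
  LinearMap.eqLocus q.toLinearMap (1 : H →L[ℂ] H).toLinearMap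

omit [CompleteSpace H] in
theorem mem_fixedSpace {q : H →L[ℂ] H} {x : H} : x ∈ fixedSpace q ↔ q x = x := Iff.rfl

omit [CompleteSpace H] in
theorem isClosed_fixedSpace (q : H →L[ℂ] H) : IsClosed (fixedSpace q : Set H) :=
  isClosed_eq q.continuous continuous_id

instance (q : H →L[ℂ] H) : CompleteSpace (fixedSpace q) :=
  (isClosed_fixedSpace q).completeSpace_coe

/-- The orthogonal projection onto the vectors fixed by `q`. -/
noncomputable def fixProj (q : H →L[ℂ] H) : H →L[ℂ] H := (fixedSpace q).starProjection

theorem fixProj_apply_eq_self {q : H →L[ℂ] H} {x : H} : fixProj q x = x ↔ q x = x :=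
  Submodule.starProjection_eq_self_iff

theorem apply_fixProj (q : H →L[ℂ] H) (x : H) : q (fixProj q x) = fixProj q x :=
  mem_fixedSpace.1 ((fixedSpace q).starProjection_apply_mem x)

theorem star_fixProj (q : H →L[ℂ] H) : star (fixProj q) = fixProj q :=
  (isStarProjection_starProjection (U := fixedSpace q)).isSelfAdjoint

theorem fixProj_fixProj (q : H →L[ℂ] H) (x : H) : fixProj q (fixProj q x) = fixProj q x :=
  fixProj_apply_eq_self.2 (apply_fixProj q x)

/-- An operator commuting with `q` and `star q` commutes with the projection to fixed vectors. -/
theorem fixProj_comm {q B : H →L[ℂ] H} (h1 : ∀ x, B (q x) = q (B x))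
    (h2 : ∀ x, star B (q x) = q (star B x)) (x : H) : fixProj q (B x) = B (fixProj q x) := by
  refine starProjection_comm ?_ ?_ x
  · intro x hx
    rw [mem_fixedSpace] at hx ⊢
    rw [← h1, hx]
  · intro x hx
    rw [Submodule.mem_orthogonal] at hx ⊢
    intro u hu
    rw [← ContinuousLinearMap.adjoint_inner_left, ← ContinuousLinearMap.star_eq_adjoint]
    refine hx _ ?_
    rw [mem_fixedSpace] at hu ⊢
    rw [← h2, hu]

/-- This is the mean ergodic theorem. It presents the projection as a strong limit of polynomials in
`q`, a form that can be computed inside one tensor factor. -/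
theorem tendsto_fixProj {q : H →L[ℂ] H} (hq : ‖q‖ ≤ 1) (x : H) :
    Tendsto (fun N : ℕ => (N : ℂ)⁻¹ • ∑ n ∈ Finset.range N, (q ^ n) x) atTop
      (𝓝 (fixProj q x)) := by
  refine (q.tendsto_birkhoffAverage_orthogonalProjection hq x).congr fun N => ?_
  simp only [birkhoffAverage, birkhoffSum, id]
  congr 1
  refine Finset.sum_congr rfl fun n hn => ?_
  clear hn
  induction n with
  | zero => rfl
  | succ n ih => rw [Function.iterate_succ_apply', pow_succ', mul_apply_eq_comp, ih]

end FixProj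

/-! ### Hilbert space tensor products and operators on them. -/

variable {ι : Type*} [Fintype ι] [DecidableEq ι]
  {E : ι → Type*} [∀ i, NormedAddCommGroup (E i)] [∀ i, InnerProductSpace ℂ (E i)]
  [∀ i, CompleteSpace (E i)]
  {H : Type*} [NormedAddCommGroup H] [InnerProductSpace ℂ H] [CompleteSpace H]

/-- `τ` exhibits `H` as the Hilbert space tensor product of the spaces `E i`. -/
structure IsTensorProduct (τ : MultilinearMap ℂ E H) : Prop where
  inner_map : ∀ f g, inner ℂ (τ f) (τ g) = ∏ i, inner ℂ (f i) (g i)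
  dense : (Submodule.span ℂ (Set.range τ)).topologicalClosure = ⊤

/-- `B` is the tensor product of the operators `b i`. -/
def IsTensor (τ : MultilinearMap ℂ E H) (B : H →L[ℂ] H) (b : ∀ i, E i →L[ℂ] E i) : Prop :=
  ∀ f, B (τ f) = τ fun i => b i (f i)

/-- `B` acts as `b` on the tensor factor `i` and as the identity on the others. -/
def ActsAt (τ : MultilinearMap ℂ E H) (i : ι) (B : H →L[ℂ] H) (b : E i →L[ℂ] E i) : Prop :=
  ∀ f, B (τ f) = τ (Function.update f i (b (f i)))

namespace IsTensorProduct

variable {τ : MultilinearMap ℂ E H} (hτ : IsTensorProduct τ)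
include hτ

omit [DecidableEq ι] [∀ i, CompleteSpace (E i)] [CompleteSpace H] in
theorem norm_map (f : ∀ i, E i) : ‖τ f‖ = ∏ i, ‖f i‖ := by
  have h := hτ.inner_map f f
  simp only [inner_self_eq_norm_sq_to_K] at h
  rw [Finset.prod_pow] at h
  have h2 : ‖τ f‖ ^ 2 = (∏ i, ‖f i‖) ^ 2 := by exact_mod_cast h
  exact (sq_eq_sq₀ (norm_nonneg _) (Finset.prod_nonneg fun _ _ => norm_nonneg _)).1 h2

omit [DecidableEq ι] [∀ i, CompleteSpace (E i)] [CompleteSpace H] in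
theorem continuous : Continuous τ :=
  (τ.mkContinuous 1 fun f => by rw [hτ.norm_map, one_mul]).cont

omit [∀ i, CompleteSpace (E i)] [CompleteSpace H] in
theorem continuous_update (f : ∀ i, E i) (i : ι) :
    Continuous fun v => τ (Function.update f i v) :=
  hτ.continuous.comp (continuous_const.update i continuous_id)

omit [DecidableEq ι] [∀ i, CompleteSpace (E i)] [CompleteSpace H] in
theorem ext {B B' : H →L[ℂ] H} (h : ∀ f, B (τ f) = B' (τ f)) : B = B' := by
  refine ContinuousLinearMap.ext_on ((Submodule.dense_iff_topologicalClosure_eq_top).2 hτ.dense) ?_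
  rintro _ ⟨f, rfl⟩
  exact h f

omit [DecidableEq ι] [∀ i, CompleteSpace (E i)] [CompleteSpace H] in
theorem eq_zero {x : H} (h : ∀ f, inner ℂ (τ f) x = 0) : x = 0 := by
  rw [← Submodule.mem_bot ℂ, ← Submodule.top_orthogonal_eq_bot, ← hτ.dense,
    Submodule.orthogonal_closure, Submodule.mem_orthogonal]
  intro u hu
  induction hu using Submodule.span_induction with
  | zero => simp
  | add x y _ _ hx hy => rw [inner_add_left, hx, hy, add_zero]
  | smul c x _ hx => rw [inner_smul_left, hx, mul_zero]
  | mem x hx => obtain ⟨f, rfl⟩ := hx; exact h f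

omit [DecidableEq ι] [∀ i, CompleteSpace (E i)] [CompleteSpace H] in
theorem isTensor_unique {B B' : H →L[ℂ] H} {b : ∀ i, E i →L[ℂ] E i} (h : IsTensor τ B b)
    (h' : IsTensor τ B' b) : B = B' :=
  hτ.ext fun f => by rw [h, h']

omit [DecidableEq ι] in
theorem isTensor_star {B B' : H →L[ℂ] H} {b : ∀ i, E i →L[ℂ] E i} (h : IsTensor τ B b)
    (h' : IsTensor τ B' fun i => star (b i)) : star B = B' := by
  refine hτ.ext fun f => ?_
  rw [← sub_eq_zero]
  refine hτ.eq_zero fun g => ?_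
  rw [inner_sub_right, ContinuousLinearMap.star_eq_adjoint,
    ContinuousLinearMap.adjoint_inner_right, h, h', hτ.inner_map, hτ.inner_map, sub_eq_zero]
  refine Finset.prod_congr rfl fun i _ => ?_
  beta_reduce
  rw [ContinuousLinearMap.star_eq_adjoint, ContinuousLinearMap.adjoint_inner_right]

omit [∀ i, CompleteSpace (E i)] [CompleteSpace H] [Fintype ι] hτ in
theorem _root_.Z2Spectral.ActsAt.isTensor {i : ι} {B : H →L[ℂ] H} {b : E i →L[ℂ] E i}
    (h : ActsAt τ i B b) : IsTensor τ B (Function.update 1 i b) := by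
  intro f
  rw [h]
  congr 1
  ext j
  by_cases hj : j = i
  · subst hj; simp
  · simp [hj]

omit [∀ i, CompleteSpace (E i)] [CompleteSpace H] in
theorem actsAt_unique {i : ι} {B B' : H →L[ℂ] H} {b : E i →L[ℂ] E i} (h : ActsAt τ i B b)
    (h' : ActsAt τ i B' b) : B = B' :=
  hτ.isTensor_unique h.isTensor h'.isTensor

omit [∀ i, CompleteSpace (E i)] [CompleteSpace H] [Fintype ι] hτ in
theorem _root_.Z2Spectral.ActsAt.one (i : ι) : ActsAt τ i 1 1 := by
  intro f
  simp

omit [∀ i, CompleteSpace (E i)] [CompleteSpace H] [Fintype ι] hτ in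
theorem _root_.Z2Spectral.ActsAt.add {i : ι} {B B' : H →L[ℂ] H} {b b' : E i →L[ℂ] E i}
    (h : ActsAt τ i B b) (h' : ActsAt τ i B' b') : ActsAt τ i (B + B') (b + b') := by
  intro f
  rw [_root_.add_apply, _root_.add_apply, h, h', MultilinearMap.map_update_add]

omit [∀ i, CompleteSpace (E i)] [CompleteSpace H] [Fintype ι] hτ in
theorem _root_.Z2Spectral.ActsAt.sub {i : ι} {B B' : H →L[ℂ] H} {b b' : E i →L[ℂ] E i}
    (h : ActsAt τ i B b) (h' : ActsAt τ i B' b') : ActsAt τ i (B - B') (b - b') := by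
  intro f
  rw [_root_.sub_apply, _root_.sub_apply, h, h', MultilinearMap.map_update_sub]

omit [∀ i, CompleteSpace (E i)] [CompleteSpace H] [Fintype ι] hτ in
theorem _root_.Z2Spectral.ActsAt.smul {i : ι} (c : ℂ) {B : H →L[ℂ] H} {b : E i →L[ℂ] E i}
    (h : ActsAt τ i B b) : ActsAt τ i (c • B) (c • b) := by
  intro f
  rw [_root_.smul_apply, _root_.smul_apply, h, MultilinearMap.map_update_smul]

omit [∀ i, CompleteSpace (E i)] [CompleteSpace H] [Fintype ι] hτ in
theorem _root_.Z2Spectral.ActsAt.mul {i : ι} {B B' : H →L[ℂ] H} {b b' : E i →L[ℂ] E i}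
    (h : ActsAt τ i B b) (h' : ActsAt τ i B' b') : ActsAt τ i (B * B') (b * b') := by
  intro f
  rw [mul_apply_eq_comp, mul_apply_eq_comp, h', h, Function.update_idem, Function.update_self]

omit [∀ i, CompleteSpace (E i)] [CompleteSpace H] [Fintype ι] hτ in
theorem _root_.Z2Spectral.ActsAt.pow {i : ι} {B : H →L[ℂ] H} {b : E i →L[ℂ] E i}
    (h : ActsAt τ i B b) (n : ℕ) : ActsAt τ i (B ^ n) (b ^ n) := by
  induction n with
  | zero => exact ActsAt.one i
  | succ n ih => rw [pow_succ, pow_succ]; exact ih.mul h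

omit [∀ i, CompleteSpace (E i)] [CompleteSpace H] in
theorem actsAt_comm_of_ne {i j : ι} (hij : i ≠ j) {B B' : H →L[ℂ] H} {b : E i →L[ℂ] E i}
    {b' : E j →L[ℂ] E j} (h : ActsAt τ i B b) (h' : ActsAt τ j B' b') : B * B' = B' * B := by
  refine hτ.ext fun f => ?_
  rw [mul_apply_eq_comp, mul_apply_eq_comp, h', h, h, h', Function.update_of_ne hij,
    Function.update_of_ne hij.symm, Function.update_comm hij]

omit [∀ i, CompleteSpace (E i)] [CompleteSpace H] in
theorem actsAt_comm {i : ι} {B B' : H →L[ℂ] H} {b b' : E i →L[ℂ] E i} (h : ActsAt τ i B b)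
    (h' : ActsAt τ i B' b') (hb : b * b' = b' * b) : B * B' = B' * B :=
  hτ.actsAt_unique (h.mul h') (hb ▸ h'.mul h)

theorem actsAt_star {i : ι} {B B' : H →L[ℂ] H} {b : E i →L[ℂ] E i} (h : ActsAt τ i B b)
    (h' : ActsAt τ i B' (star b)) : star B = B' := by
  refine hτ.isTensor_star h.isTensor ?_
  have := h'.isTensor
  convert this using 1
  ext1 j
  by_cases hj : j = i
  · subst hj; simp
  · simp [hj]

/-- The Cesàro averages of `B` act on the factor `i` as those of `b`, and the limit can be taken
inside the slot `i` by continuity. -/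
theorem actsAt_fixProj {i : ι} {B : H →L[ℂ] H} {b : E i →L[ℂ] E i} (h : ActsAt τ i B b)
    (hB : ‖B‖ ≤ 1) (hb : ‖b‖ ≤ 1) : ActsAt τ i (fixProj B) (fixProj b) := by
  intro f
  have h1 := ((hτ.continuous_update f i).tendsto _).comp (tendsto_fixProj hb (f i))
  refine tendsto_nhds_unique (tendsto_fixProj hB (τ f)) (h1.congr fun N => ?_)
  rw [Function.comp_apply, MultilinearMap.map_update_smul, MultilinearMap.map_update_sum]
  exact congrArg _ (Finset.sum_congr rfl fun n _ => ((h.pow n) f).symm)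

omit [∀ i, CompleteSpace (E i)] [CompleteSpace H] hτ in
theorem _root_.Z2Spectral.exists_isTensor {b : ∀ i, E i →L[ℂ] E i}
    (h : ∀ i, ∃ B, ActsAt τ i B (b i)) : ∃ B, IsTensor τ B b := by
  have key : ∀ s : Finset ι, ∃ B, IsTensor τ B fun i => if i ∈ s then b i else 1 := by
    intro s
    induction s using Finset.induction_on with
    | empty => exact ⟨1, fun f => by simp⟩
    | insert i s hi ih =>
      obtain ⟨B, hB⟩ := ih
      obtain ⟨B', hB'⟩ := h i
      refine ⟨B' * B, fun f => ?_⟩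
      rw [mul_apply_eq_comp, hB, hB']
      congr 1
      ext j
      by_cases hj : j = i
      · subst hj; simp [hi]
      · simp [hj]
  obtain ⟨B, hB⟩ := key Finset.univ
  exact ⟨B, by simpa using hB⟩

omit [Fintype ι] [DecidableEq ι] [∀ i, CompleteSpace (E i)] [CompleteSpace H] hτ in
theorem _root_.Z2Spectral.IsTensor.mul {B B' : H →L[ℂ] H} {b b' : ∀ i, E i →L[ℂ] E i}
    (h : IsTensor τ B b) (h' : IsTensor τ B' b') : IsTensor τ (B * B') (b * b') := by
  intro f
  rw [mul_apply_eq_comp, h', h]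
  rfl

-- On elementary tensors the matrix coefficients are finite products of coefficients of the factors.
-- The uniform norm bound extends convergence to the closed span, in one argument at a time.
omit [DecidableEq ι] [∀ i, CompleteSpace (E i)] [CompleteSpace H] in
theorem weakLimit {A : ℕ → H →L[ℂ] H} {B : H →L[ℂ] H} {a : ℕ → ∀ i, E i →L[ℂ] E i}
    {b : ∀ i, E i →L[ℂ] E i} (hA : ∀ n, IsTensor τ (A n) (a n)) (hB : IsTensor τ B b)
    (hnorm : ∀ n, ‖A n‖ ≤ 1) (h : ∀ i, WeakLimit (fun n => a n i) (b i)) : WeakLimit A B := by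
  have hbd : ∀ n x, ‖A n x‖ ≤ ‖x‖ := fun n x => by
    simpa using (A n).le_of_opNorm_le (hnorm n) x
  have hd : ∀ S : Submodule ℂ H, IsClosed (S : Set H) → (∀ f, τ f ∈ S) → ∀ x, x ∈ S := by
    intro S hS hf x
    have : (⊤ : Submodule ℂ H) ≤ S := by
      rw [← hτ.dense]
      refine Submodule.topologicalClosure_minimal _ (Submodule.span_le.2 ?_) hS
      rintro _ ⟨f, rfl⟩
      exact hf f
    exact this Submodule.mem_top
  have step : ∀ f g, Tendsto (fun n => inner ℂ (τ g) (A n (τ f))) atTop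
      (𝓝 (inner ℂ (τ g) (B (τ f)))) := by
    intro f g
    simp only [hA _ f, hB f, hτ.inner_map]
    exact tendsto_finsetProd _ fun i _ => h i (f i) (g i)
  have step2 : ∀ x g, Tendsto (fun n => inner ℂ (τ g) (A n x)) atTop
      (𝓝 (inner ℂ (τ g) (B x))) := by
    intro x g
    let S : Submodule ℂ H :=
      { carrier := {x | Tendsto (fun n => inner ℂ (τ g) (A n x)) atTop (𝓝 (inner ℂ (τ g) (B x)))}
        add_mem' := fun {x y} hx hy => by
          simp only [Set.mem_ofPred_eq, map_add, inner_add_right] at hx hy ⊢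
          exact hx.add hy
        zero_mem' := by simp
        smul_mem' := fun c x hx => by
          simp only [Set.mem_ofPred_eq, map_smul, inner_smul_right] at hx ⊢
          exact hx.const_mul c }
    -- The vectors where convergence holds form a closed subspace, since the functionals are
    -- equicontinuous.
    refine hd S ?_ (fun f => step f g) x
    refine Equicontinuous.isClosed_setOfPred_tendsto (F := fun n x => inner ℂ (τ g) (A n x))
      (f := fun x => inner ℂ (τ g) (B x)) ?_ (by fun_prop)
    refine (LipschitzWith.uniformEquicontinuous _ ‖τ g‖₊ fun n => ?_).equicontinuous
    refine LipschitzWith.of_dist_le_mul fun x y => ?_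
    rw [dist_eq_norm, dist_eq_norm, ← inner_sub_right, ← map_sub]
    exact (norm_inner_le_norm _ _).trans
      (mul_le_mul_of_nonneg_left (hbd n _) (norm_nonneg _))
  intro x y
  let S : Submodule ℂ H :=
    { carrier := {y | Tendsto (fun n => inner ℂ y (A n x)) atTop (𝓝 (inner ℂ y (B x)))}
      add_mem' := fun {y y'} hx hy => by
        simp only [Set.mem_ofPred_eq, inner_add_left] at hx hy ⊢
        exact hx.add hy
      zero_mem' := by simp
      smul_mem' := fun c x hx => by
        simp only [Set.mem_ofPred_eq, inner_smul_left] at hx ⊢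
        exact hx.const_mul _ }
  refine hd S ?_ (fun g => step2 x g) y
  refine Equicontinuous.isClosed_setOfPred_tendsto (F := fun n y => inner ℂ y (A n x))
    (f := fun y => inner ℂ y (B x)) ?_ (by fun_prop)
  refine (LipschitzWith.uniformEquicontinuous _ ‖x‖₊ fun n => ?_).equicontinuous
  refine LipschitzWith.of_dist_le_mul fun y z => ?_
  rw [dist_eq_norm, dist_eq_norm, ← inner_sub_left, mul_comm]
  exact (norm_inner_le_norm _ _).trans
    (mul_le_mul_of_nonneg_left (hbd n _) (norm_nonneg _))

end IsTensorProduct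

end Z2Spectral

/-! ### Koopman operators, and `L²` of a product as a tensor product. -/

namespace L2

open Z2Spectral

section Koop

variable {X : Type*} [MeasurableSpace X] {μ : Measure X}

/-- Composition with a measure preserving map, as an operator on `L²`. -/
noncomputable def koop (g : X → X) (hg : MeasurePreserving g μ μ) : Lp ℂ 2 μ →L[ℂ] Lp ℂ 2 μ :=
  (Lp.compMeasurePreservingₗᵢ ℂ g hg).toContinuousLinearMap

theorem coeFn_koop (g : X → X) (hg : MeasurePreserving g μ μ) (f : Lp ℂ 2 μ) :
    koop g hg f =ᵐ[μ] f ∘ g := Lp.coeFn_compMeasurePreserving f hg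

theorem norm_koop_apply (g : X → X) (hg : MeasurePreserving g μ μ) (f : Lp ℂ 2 μ) :
    ‖koop g hg f‖ = ‖f‖ := Lp.norm_compMeasurePreserving f hg

theorem norm_koop_le (g : X → X) (hg : MeasurePreserving g μ μ) : ‖koop g hg‖ ≤ 1 :=
  ContinuousLinearMap.opNorm_le_bound _ zero_le_one fun f => by rw [norm_koop_apply, one_mul]

theorem koop_mul (g h : X → X) (hg : MeasurePreserving g μ μ) (hh : MeasurePreserving h μ μ) :
    koop g hg * koop h hh = koop (h ∘ g) (hh.comp hg) := by
  ext1 f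
  refine Lp.ext ?_
  rw [mul_apply_eq_comp]
  filter_upwards [coeFn_koop g hg (koop h hh f), coeFn_koop (h ∘ g) (hh.comp hg) f,
    hg.quasiMeasurePreserving.ae (coeFn_koop h hh f)] with x h1 h2 h3
  rw [h1, h2, Function.comp_apply, h3]
  rfl

theorem koop_congr {g h : X → X} (hg : MeasurePreserving g μ μ) (hh : MeasurePreserving h μ μ)
    (hgh : g = h) : koop g hg = koop h hh := by
  cases hgh
  rfl

theorem koop_id : koop (id : X → X) (MeasurePreserving.id μ) = 1 := by
  ext1 f
  refine Lp.ext ?_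
  filter_upwards [coeFn_koop id (MeasurePreserving.id μ) f] with x h1
  rw [h1]
  rfl

theorem inner_koop (g : X → X) (hg : MeasurePreserving g μ μ) (f f' : Lp ℂ 2 μ) :
    inner ℂ (koop g hg f) (koop g hg f') = inner ℂ f f' :=
  (Lp.compMeasurePreservingₗᵢ ℂ g hg).inner_map_map f f'

theorem star_koop {g h : X → X} (hg : MeasurePreserving g μ μ) (hh : MeasurePreserving h μ μ)
    (hhg : h ∘ g = id) : star (koop g hg) = koop h hh := by
  have hinv : koop g hg * koop h hh = 1 := by
    rw [koop_mul, koop_congr _ (MeasurePreserving.id μ) hhg, koop_id]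
  rw [ContinuousLinearMap.star_eq_adjoint, eq_comm, ContinuousLinearMap.eq_adjoint_iff]
  intro x y
  rw [← inner_koop g hg, ← mul_apply_eq_comp, hinv, one_apply_eq_self]

end Koop

section Dense

variable {Ω : Type*} [m : MeasurableSpace Ω] {P : Measure Ω} [IsFiniteMeasure P]

omit [IsFiniteMeasure P] in
theorem inner_eq_setIntegral {v x : Lp ℂ 2 P} {s : Set Ω} (hs : MeasurableSet s)
    (hv : v =ᵐ[P] s.indicator fun _ => (1 : ℂ)) : inner ℂ v x = ∫ ω in s, x ω ∂P := by
  rw [L2.inner_def, ← integral_indicator hs]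
  refine integral_congr_ae ?_
  filter_upwards [hv] with ω hω
  rw [hω]
  by_cases h : ω ∈ s <;> simp [h]

/-- A square integrable function with zero integrals over a generating π-system vanishes. -/
theorem eq_zero_of_isPiSystem {C : Set (Set Ω)} (hC : m = MeasurableSpace.generateFrom C)
    (hpi : IsPiSystem C) {x : Lp ℂ 2 P} (hx : ∀ s ∈ C, ∫ ω in s, x ω ∂P = 0)
    (huniv : ∫ ω, x ω ∂P = 0) : x = 0 := by
  have hint : Integrable x P := (Lp.memLp x).integrable one_le_two
  refine Lp.ext ?_
  refine EventuallyEq.trans ?_ (Lp.coeFn_zero ℂ 2 P).symm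
  refine hint.ae_eq_zero_of_forall_setIntegral_eq_zero fun s hs _ => ?_
  induction s, hs using MeasurableSpace.induction_on_inter hC hpi with
  | empty => simp
  | basic s hs => exact hx s hs
  | compl s hs ih =>
    have := integral_add_compl hs hint
    rw [ih (measure_lt_top _ _), zero_add, huniv] at this
    exact this
  | iUnion f hd hf ih =>
    rw [integral_iUnion hf hd hint.integrableOn]
    simp [ih _ (measure_lt_top _ _)]

end Dense

section Pi

variable {ι : Type*} [Fintype ι] {Y : ι → Type*} [∀ i, MeasurableSpace (Y i)]
  (ν : ∀ i, Measure (Y i)) [∀ i, IsProbabilityMeasure (ν i)]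

theorem memLp_piProd (f : ∀ i, Lp ℂ 2 (ν i)) :
    MemLp (fun y : ∀ i, Y i => ∏ i, f i (y i)) 2 (Measure.pi ν) := by
  have hm : AEStronglyMeasurable (fun y : ∀ i, Y i => ∏ i, f i (y i)) (Measure.pi ν) :=
    Finset.aestronglyMeasurable_fun_prod _ fun i _ =>
      (Lp.aestronglyMeasurable (f i)).comp_quasiMeasurePreserving
        (Measure.quasiMeasurePreserving_eval ν i)
  rw [memLp_two_iff_integrable_sq_norm hm]
  simp only [norm_prod, ← Finset.prod_pow]
  exact Integrable.fintype_prod_dep fun i =>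
    (memLp_two_iff_integrable_sq_norm (Lp.aestronglyMeasurable (f i))).1 (Lp.memLp (f i))

/-- The function `y ↦ ∏ i, f i (y i)` in `L²` of the product. -/
noncomputable def piProd (f : ∀ i, Lp ℂ 2 (ν i)) : Lp ℂ 2 (Measure.pi ν) :=
  (memLp_piProd ν f).toLp _

theorem coeFn_piProd (f : ∀ i, Lp ℂ 2 (ν i)) :
    piProd ν f =ᵐ[Measure.pi ν] fun y => ∏ i, f i (y i) := MemLp.coeFn_toLp _

variable {ν} in
theorem ae_pi_eval {i : ι} {p : Y i → Prop} (h : ∀ᵐ x ∂(ν i), p x) :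
    ∀ᵐ y ∂(Measure.pi ν), p (y i) :=
  (Measure.quasiMeasurePreserving_eval ν i).ae h

/-- The tensor product map `⨂ L²(Y i) → L²(∏ Y i)`. -/
noncomputable def piTensor : MultilinearMap ℂ (fun i => Lp ℂ 2 (ν i)) (Lp ℂ 2 (Measure.pi ν)) where
  toFun := piProd ν
  map_update_add' := by
    intro _ f i u v
    refine Lp.ext ?_
    filter_upwards [coeFn_piProd ν (Function.update f i (u + v)),
      coeFn_piProd ν (Function.update f i u), coeFn_piProd ν (Function.update f i v),
      Lp.coeFn_add (piProd ν (Function.update f i u)) (piProd ν (Function.update f i v)),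
      ae_pi_eval (Lp.coeFn_add u v)] with y h1 h2 h3 h4 h5
    rw [h4, Pi.add_apply, h1, h2, h3, ← Finset.mul_prod_erase _ _ (Finset.mem_univ i),
      ← Finset.mul_prod_erase (Finset.univ) (fun j => (Function.update f i u j : Y j → ℂ) (y j))
        (Finset.mem_univ i),
      ← Finset.mul_prod_erase (Finset.univ) (fun j => (Function.update f i v j : Y j → ℂ) (y j))
        (Finset.mem_univ i)]
    simp only [Function.update_self]
    rw [h5, Pi.add_apply, add_mul]
    congr 2 <;> refine Finset.prod_congr rfl fun j hj => ?_ <;>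
      simp [Function.update_of_ne (Finset.ne_of_mem_erase hj)]
  map_update_smul' := by
    intro _ f i c u
    refine Lp.ext ?_
    filter_upwards [coeFn_piProd ν (Function.update f i (c • u)),
      coeFn_piProd ν (Function.update f i u), Lp.coeFn_smul c (piProd ν (Function.update f i u)),
      ae_pi_eval (Lp.coeFn_smul c u)] with y h1 h2 h4 h5
    rw [h4, Pi.smul_apply, h1, h2, ← Finset.mul_prod_erase _ _ (Finset.mem_univ i),
      ← Finset.mul_prod_erase (Finset.univ) (fun j => (Function.update f i u j : Y j → ℂ) (y j))
        (Finset.mem_univ i)]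
    simp only [Function.update_self]
    rw [h5, Pi.smul_apply, smul_eq_mul, smul_eq_mul, mul_assoc]
    congr 2
    refine Finset.prod_congr rfl fun j hj => ?_
    simp [Function.update_of_ne (Finset.ne_of_mem_erase hj)]

theorem coeFn_piTensor (f : ∀ i, Lp ℂ 2 (ν i)) :
    piTensor ν f =ᵐ[Measure.pi ν] fun y => ∏ i, f i (y i) := coeFn_piProd ν f

theorem piTensor_indicator (s : ∀ i, Set (Y i)) (hs : ∀ i, MeasurableSet (s i)) :
    piTensor ν (fun i => indicatorConstLp 2 (hs i) (measure_ne_top _ _) (1 : ℂ)) =ᵐ[Measure.pi ν]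
      (Set.univ.pi s).indicator fun _ => (1 : ℂ) := by
  have : ∀ᵐ y ∂(Measure.pi ν), ∀ i,
      (indicatorConstLp 2 (hs i) (measure_ne_top (ν i) _) (1 : ℂ) : Y i → ℂ) (y i) =
        (s i).indicator (fun _ => (1 : ℂ)) (y i) :=
    ae_all_iff.2 fun i => ae_pi_eval indicatorConstLp_coeFn
  filter_upwards [coeFn_piTensor ν
    (fun i => indicatorConstLp 2 (hs i) (measure_ne_top (ν i) _) (1 : ℂ)), this] with y h1 h2
  rw [h1]
  simp only [h2]
  by_cases hy : y ∈ Set.univ.pi s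
  · rw [Set.indicator_of_mem hy]
    exact Finset.prod_eq_one fun i _ => Set.indicator_of_mem (hy i (Set.mem_univ i)) _
  · rw [Set.indicator_of_notMem hy]
    obtain ⟨i, hi⟩ : ∃ i, y i ∉ s i := by simpa [Set.mem_pi] using hy
    exact Finset.prod_eq_zero (Finset.mem_univ i) (Set.indicator_of_notMem hi _)

/-- Inner products factor by Fubini. For density, a function orthogonal to all tensors has zero
integral over every box, and boxes form a generating π-system. -/
theorem isTensorProduct_piTensor : IsTensorProduct (piTensor ν) where
  inner_map f g := by
    simp only [L2.inner_def]
    rw [← integral_fintype_prod_eq_prod]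
    refine integral_congr_ae ?_
    filter_upwards [coeFn_piTensor ν f, coeFn_piTensor ν g] with y h1 h2
    rw [h1, h2]
    simp only [RCLike.inner_apply, map_prod, Finset.prod_mul_distrib]
  dense := by
    rw [Submodule.topologicalClosure_eq_top_iff, eq_bot_iff]
    intro x hx
    rw [Submodule.mem_bot]
    rw [Submodule.mem_orthogonal] at hx
    have hbox : ∀ s : ∀ i, Set (Y i), (∀ i, MeasurableSet (s i)) →
        ∫ y in Set.univ.pi s, x y ∂(Measure.pi ν) = 0 := by
      intro s hs
      rw [← inner_eq_setIntegral (MeasurableSet.univ_pi hs) (piTensor_indicator ν s hs)]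
      exact hx _ (Submodule.subset_span ⟨_, rfl⟩)
    refine eq_zero_of_isPiSystem generateFrom_pi.symm isPiSystem_pi ?_ ?_
    · rintro _ ⟨s, hs, rfl⟩
      exact hbox s fun i => hs i (Set.mem_univ i)
    · have := hbox (fun _ => Set.univ) fun _ => MeasurableSet.univ
      rwa [Set.pi_univ, setIntegral_univ] at this

theorem isTensor_koop {g : ∀ i, Y i → Y i} (hg : ∀ i, MeasurePreserving (g i) (ν i) (ν i)) :
    IsTensor (piTensor ν) (koop (fun y i => g i (y i)) (measurePreserving_pi ν ν hg))
      fun i => koop (g i) (hg i) := by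
  intro f
  refine Lp.ext ?_
  have : ∀ᵐ y ∂(Measure.pi ν), ∀ i, (koop (g i) (hg i) (f i) : Y i → ℂ) (y i) = f i (g i (y i)) :=
    ae_all_iff.2 fun i => ae_pi_eval (coeFn_koop (g i) (hg i) (f i))
  filter_upwards [coeFn_koop (fun y i => g i (y i)) (measurePreserving_pi ν ν hg) (piTensor ν f),
    coeFn_piTensor ν fun i => koop (g i) (hg i) (f i), this,
    (measurePreserving_pi ν ν hg).quasiMeasurePreserving.ae (coeFn_piTensor ν f)] with y h1 h2 h3 h4
  rw [h1, h2, Function.comp_apply, h4]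
  simp only [h3]

/-- The operator is the Koopman operator of `g` in coordinate `i` and the identity elsewhere. The
norm bound is what `actsAt_fixProj` requires. -/
theorem exists_actsAt_koop [DecidableEq ι] (i : ι) {g : Y i → Y i}
    (hg : MeasurePreserving g (ν i) (ν i)) :
    ∃ B, ActsAt (piTensor ν) i B (koop g hg) ∧ ‖B‖ ≤ 1 := by
  have h : ∀ j, MeasurePreserving (Function.update (fun j => (id : Y j → Y j)) i g j)
      (ν j) (ν j) := by
    intro j
    by_cases hj : j = i
    · subst hj; simpa using hg
    · simpa [hj] using MeasurePreserving.id (ν j)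
  refine ⟨_, fun f => ?_, norm_koop_le _ (measurePreserving_pi ν ν h)⟩
  rw [isTensor_koop ν h]
  congr 1
  ext1 j
  by_cases hj : j = i
  · subst hj
    rw [Function.update_self]
    exact congrArg (fun A : Lp ℂ 2 (ν j) →L[ℂ] Lp ℂ 2 (ν j) => A (f j))
      (koop_congr (h j) hg (Function.update_self ..))
  · rw [Function.update_of_ne hj]
    have : koop _ (h j) = 1 :=
      (koop_congr (h j) (MeasurePreserving.id _) (Function.update_of_ne hj ..)).trans koop_id
    exact congrArg (fun A : Lp ℂ 2 (ν j) →L[ℂ] Lp ℂ 2 (ν j) => A (f j)) this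

end Pi

section Prod

variable {X : Type*} [MeasurableSpace X] (μ : Measure X) [IsProbabilityMeasure μ]

omit [IsProbabilityMeasure μ] in
theorem memLp_prodMul (f : Fin 2 → Lp ℂ 2 μ) :
    MemLp (fun p : X × X => f 0 p.1 * f 1 p.2) 2 (μ.prod μ) := by
  have hm : AEStronglyMeasurable (fun p : X × X => f 0 p.1 * f 1 p.2) (μ.prod μ) :=
    ((Lp.aestronglyMeasurable (f 0)).comp_fst).mul (Lp.aestronglyMeasurable (f 1)).comp_snd
  rw [memLp_two_iff_integrable_sq_norm hm]
  simp only [norm_mul, mul_pow]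
  have := fun i => (memLp_two_iff_integrable_sq_norm (Lp.aestronglyMeasurable (f i))).1
    (Lp.memLp (f i))
  exact (this 0).mul_prod (this 1)

/-- The function `(x, y) ↦ f 0 x * f 1 y` in `L²` of the square. -/
noncomputable def prodMul (f : Fin 2 → Lp ℂ 2 μ) : Lp ℂ 2 (μ.prod μ) :=
  (memLp_prodMul μ f).toLp _

omit [IsProbabilityMeasure μ] in
theorem coeFn_prodMul (f : Fin 2 → Lp ℂ 2 μ) :
    prodMul μ f =ᵐ[μ.prod μ] fun p => f 0 p.1 * f 1 p.2 := MemLp.coeFn_toLp _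

omit [IsProbabilityMeasure μ] in
variable {μ} in
theorem ae_prod_fst {p : X → Prop} (h : ∀ᵐ x ∂μ, p x) : ∀ᵐ y ∂(μ.prod μ), p y.1 :=
  Measure.quasiMeasurePreserving_fst.ae h

omit [IsProbabilityMeasure μ] in
variable {μ} in
theorem ae_prod_snd {p : X → Prop} (h : ∀ᵐ x ∂μ, p x) : ∀ᵐ y ∂(μ.prod μ), p y.2 :=
  Measure.quasiMeasurePreserving_snd.ae h

/-- The tensor product map `L²(X) ⊗ L²(X) → L²(X × X)`. -/
noncomputable def prodTensor :
    MultilinearMap ℂ (fun _ : Fin 2 => Lp ℂ 2 μ) (Lp ℂ 2 (μ.prod μ)) where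
  toFun := prodMul μ
  map_update_add' := by
    intro dec f i u v
    -- The field quantifies over all decidability instances; fixing the canonical one lets
    -- `Function.update` on `Fin 2` be computed.
    obtain rfl : dec = instDecidableEqFin 2 := Subsingleton.elim _ _
    refine Lp.ext ?_
    filter_upwards [coeFn_prodMul μ (Function.update f i (u + v)),
      coeFn_prodMul μ (Function.update f i u), coeFn_prodMul μ (Function.update f i v),
      Lp.coeFn_add (prodMul μ (Function.update f i u)) (prodMul μ (Function.update f i v)),
      ae_prod_fst (Lp.coeFn_add u v), ae_prod_snd (Lp.coeFn_add u v)] with y h1 h2 h3 h4 h5 h6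
    rw [h4, Pi.add_apply, h1, h2, h3]
    fin_cases i
    · simp only [Fin.zero_eta, Function.update_self, ne_eq, one_ne_zero, not_false_eq_true,
        Function.update_of_ne, h5, Pi.add_apply, add_mul]
    · simp only [Fin.mk_one, Function.update_self, ne_eq, zero_ne_one, not_false_eq_true,
        Function.update_of_ne, h6, Pi.add_apply, mul_add]
  map_update_smul' := by
    intro dec f i c u
    obtain rfl : dec = instDecidableEqFin 2 := Subsingleton.elim _ _
    refine Lp.ext ?_
    filter_upwards [coeFn_prodMul μ (Function.update f i (c • u)),
      coeFn_prodMul μ (Function.update f i u), Lp.coeFn_smul c (prodMul μ (Function.update f i u)),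
      ae_prod_fst (Lp.coeFn_smul c u), ae_prod_snd (Lp.coeFn_smul c u)] with y h1 h2 h4 h5 h6
    rw [h4, Pi.smul_apply, h1, h2]
    fin_cases i
    · simp only [Fin.zero_eta, Function.update_self, ne_eq, one_ne_zero, not_false_eq_true,
        Function.update_of_ne, h5, Pi.smul_apply, smul_eq_mul, mul_assoc]
    · simp only [Fin.mk_one, Function.update_self, ne_eq, zero_ne_one, not_false_eq_true,
        Function.update_of_ne, h6, Pi.smul_apply, smul_eq_mul, mul_left_comm]

omit [IsProbabilityMeasure μ] in
theorem coeFn_prodTensor (f : Fin 2 → Lp ℂ 2 μ) :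
    prodTensor μ f =ᵐ[μ.prod μ] fun p => f 0 p.1 * f 1 p.2 := coeFn_prodMul μ f

theorem prodTensor_indicator {s t : Set X} (hs : MeasurableSet s) (ht : MeasurableSet t) :
    prodTensor μ ![indicatorConstLp 2 hs (measure_ne_top _ _) (1 : ℂ),
      indicatorConstLp 2 ht (measure_ne_top _ _) (1 : ℂ)] =ᵐ[μ.prod μ]
      (s ×ˢ t).indicator fun _ => (1 : ℂ) := by
  filter_upwards [coeFn_prodTensor μ ![indicatorConstLp 2 hs (measure_ne_top _ _) (1 : ℂ),
      indicatorConstLp 2 ht (measure_ne_top _ _) (1 : ℂ)],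
    ae_prod_fst (indicatorConstLp_coeFn (p := 2) (hs := hs) (hμs := measure_ne_top μ s) (c := (1 : ℂ))),
    ae_prod_snd (indicatorConstLp_coeFn (p := 2) (hs := ht) (hμs := measure_ne_top μ t) (c := (1 : ℂ)))]
    with y h1 h2 h3
  rw [h1]
  simp only [Matrix.cons_val_zero, Matrix.cons_val_one, h2, h3]
  by_cases ha : y.1 ∈ s <;> by_cases hb : y.2 ∈ t <;> simp [ha, hb]

theorem eq_zero_of_indicator {x : Lp ℂ 2 (μ.prod μ)}
    (h : ∀ (s t : Set X) (hs : MeasurableSet s) (ht : MeasurableSet t),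
      inner ℂ (prodTensor μ ![indicatorConstLp 2 hs (measure_ne_top _ _) (1 : ℂ),
        indicatorConstLp 2 ht (measure_ne_top _ _) (1 : ℂ)]) x = 0) : x = 0 := by
  have hbox : ∀ s t : Set X, MeasurableSet s → MeasurableSet t →
      ∫ y in s ×ˢ t, x y ∂(μ.prod μ) = 0 := by
    intro s t hs ht
    rw [← inner_eq_setIntegral (hs.prod ht) (prodTensor_indicator μ hs ht)]
    exact h s t hs ht
  refine eq_zero_of_isPiSystem generateFrom_prod.symm isPiSystem_prod ?_ ?_
  · rintro _ ⟨s, hs, t, ht, rfl⟩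
    exact hbox s t hs ht
  · have := hbox Set.univ Set.univ MeasurableSet.univ MeasurableSet.univ
    rwa [Set.univ_prod_univ, setIntegral_univ] at this

theorem isTensorProduct_prodTensor : IsTensorProduct (prodTensor μ) where
  inner_map f g := by
    simp only [L2.inner_def]
    rw [Fin.prod_univ_two, ← integral_prod_mul]
    refine integral_congr_ae ?_
    filter_upwards [coeFn_prodTensor μ f, coeFn_prodTensor μ g] with y h1 h2
    rw [h1, h2]
    simp only [RCLike.inner_apply, map_mul]
    ring
  dense := by
    rw [Submodule.topologicalClosure_eq_top_iff, eq_bot_iff]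
    intro x hx
    rw [Submodule.mem_orthogonal] at hx
    exact eq_zero_of_indicator μ fun s t hs ht => hx _ (Submodule.subset_span ⟨_, rfl⟩)

theorem isTensor_koop_prodMap {g h : X → X} (hg : MeasurePreserving g μ μ)
    (hh : MeasurePreserving h μ μ) :
    IsTensor (prodTensor μ) (koop (Prod.map g h) (hg.prod hh)) ![koop g hg, koop h hh] := by
  intro f
  refine Lp.ext ?_
  filter_upwards [coeFn_koop _ (hg.prod hh) (prodTensor μ f),
    coeFn_prodTensor μ fun i => (![koop g hg, koop h hh] : Fin 2 → _) i (f i),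
    ae_prod_fst (coeFn_koop g hg (f 0)), ae_prod_snd (coeFn_koop h hh (f 1)),
    (hg.prod hh).quasiMeasurePreserving.ae (coeFn_prodTensor μ f)] with y h1 h2 h3 h4 h5
  rw [h1, h2, Function.comp_apply, h5]
  simp [h3, h4]

theorem actsAt_koop_fst {g : X → X} (hg : MeasurePreserving g μ μ) :
    ActsAt (prodTensor μ) 0 (koop (Prod.map g id) (hg.prod (MeasurePreserving.id μ)))
      (koop g hg) := by
  intro f
  rw [isTensor_koop_prodMap μ hg (MeasurePreserving.id μ)]
  congr 1
  ext1 i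
  fin_cases i <;> simp [koop_id]

theorem actsAt_koop_snd {g : X → X} (hg : MeasurePreserving g μ μ) :
    ActsAt (prodTensor μ) 1 (koop (Prod.map id g) ((MeasurePreserving.id μ).prod hg))
      (koop g hg) := by
  intro f
  rw [isTensor_koop_prodMap μ (MeasurePreserving.id μ) hg]
  congr 1
  ext1 i
  fin_cases i <;> simp [koop_id]

end Prod

end L2

/-! ### Fixed vectors of tensor products, constants, and ergodicity of `g × g⁻¹`. -/

namespace Z2Spectral

section Abstract

variable {ι : Type*} [Fintype ι] [DecidableEq ι]
  {E : ι → Type*} [∀ i, NormedAddCommGroup (E i)] [∀ i, InnerProductSpace ℂ (E i)]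
  {H : Type*} [NormedAddCommGroup H] [InnerProductSpace ℂ H] 

omit [Fintype ι] [DecidableEq ι] in
theorem IsTensor.pow {τ : MultilinearMap ℂ E H} {B : H →L[ℂ] H} {b : ∀ i, E i →L[ℂ] E i}
    (h : IsTensor τ B b) (n : ℕ) : IsTensor τ (B ^ n) (b ^ n) := by
  induction n with
  | zero => intro f; simp
  | succ n ih => rw [pow_succ, pow_succ]; exact ih.mul h

/-- A fixed vector of a factor gives a fixed vector of the tensor product. -/
theorem IsTensorProduct.fixedSpace_eq {τ : MultilinearMap ℂ E H} (hτ : IsTensorProduct τ)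
    {B : H →L[ℂ] H} {b : ∀ i, E i →L[ℂ] E i} (hB : IsTensor τ B b) {e : ∀ i, E i}
    (he : ∀ i, ‖e i‖ = 1) (hbe : ∀ i, b i (e i) = e i) (hfix : fixedSpace B = ℂ ∙ τ e) (i : ι) :
    fixedSpace (b i) = ℂ ∙ e i := by
  refine le_antisymm ?_ ?_
  · intro v hv
    rw [mem_fixedSpace] at hv
    -- Putting the part of `v` orthogonal to `e i` in slot `i` of `e` gives a `B`-fixed vector
    -- orthogonal to `τ e`, hence zero.
    set v₀ := v - inner ℂ (e i) v • e i with hv₀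
    have hfixed : τ (Function.update e i v₀) ∈ fixedSpace B := by
      rw [mem_fixedSpace, hB]
      congr 1
      ext1 j
      by_cases hj : j = i
      · subst hj; simp [hv₀, hv, hbe]
      · simp [hj, hbe]
    rw [hfix, Submodule.mem_span_singleton] at hfixed
    obtain ⟨c, hc⟩ := hfixed
    have hinner : inner ℂ (τ e) (τ (Function.update e i v₀)) = 0 := by
      rw [hτ.inner_map]
      refine Finset.prod_eq_zero (Finset.mem_univ i) ?_
      rw [Function.update_self, hv₀, inner_sub_right, inner_smul_right,
        inner_self_eq_norm_sq_to_K, he]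
      simp
    have hc0 : c = 0 := by
      rw [← hc, inner_smul_right, inner_self_eq_norm_sq_to_K, hτ.norm_map] at hinner
      simpa [he] using hinner
    rw [hc0, zero_smul] at hc
    have hn := hτ.norm_map (Function.update e i v₀)
    rw [← hc, norm_zero, ← Finset.mul_prod_erase _ _ (Finset.mem_univ i), Function.update_self,
      Finset.prod_eq_one (fun j hj => by
        rw [Function.update_of_ne (Finset.ne_of_mem_erase hj), he]), mul_one] at hn
    have : v₀ = 0 := norm_eq_zero.1 hn.symm
    rw [Submodule.mem_span_singleton]
    exact ⟨_, (sub_eq_zero.1 this).symm⟩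
  · rw [Submodule.span_singleton_le_iff_mem]
    exact hbe i

end Abstract

end Z2Spectral

namespace L2

open Z2Spectral

section Const

variable {X : Type*} [MeasurableSpace X] (μ : Measure X) [IsProbabilityMeasure μ]

/-- The constant function one in `L²`. -/
noncomputable def one : Lp ℂ 2 μ := Lp.const 2 μ (1 : ℂ)

theorem coeFn_one : one μ =ᵐ[μ] fun _ => (1 : ℂ) := Lp.coeFn_const 2 μ 1

theorem norm_one : ‖one μ‖ = 1 := by
  rw [one, Lp.norm_const']
  · simp
  · simp
  · simp

theorem constants_eq : constants μ = ℂ ∙ one μ := rfl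

theorem koop_one {g : X → X} (hg : MeasurePreserving g μ μ) : koop g hg (one μ) = one μ := by
  refine Lp.ext ?_
  filter_upwards [coeFn_koop g hg (one μ), coeFn_one μ,
    hg.quasiMeasurePreserving.ae (coeFn_one μ)] with x h1 h2 h3
  rw [h1, h2, Function.comp_apply, h3]

theorem Theta_apply (v : Lp ℂ 2 μ) : Theta μ v = inner ℂ (one μ) v • one μ :=
  Submodule.starProjection_unit_singleton ℂ (norm_one μ) v

theorem fixProj_eq_Theta {B : Lp ℂ 2 μ →L[ℂ] Lp ℂ 2 μ} (h : fixedSpace B = constants μ) :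
    fixProj B = Theta μ := by
  unfold fixProj Theta
  congr

theorem star_Theta : star (Theta μ) = Theta μ :=
  (isStarProjection_starProjection (U := constants μ)).isSelfAdjoint

theorem Theta_mul_Theta : Theta μ * Theta μ = Theta μ :=
  (constants μ).isIdempotentElem_starProjection

theorem koop_mul_Theta {g : X → X} (hg : MeasurePreserving g μ μ) :
    koop g hg * Theta μ = Theta μ := by
  ext1 v
  rw [mul_apply_eq_comp, Theta_apply, map_smul, koop_one]

theorem Theta_mul_koop {g : X → X} (hg : MeasurePreserving g μ μ) :
    Theta μ * koop g hg = Theta μ := by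
  ext1 v
  rw [mul_apply_eq_comp, Theta_apply, Theta_apply]
  conv_lhs => rw [← koop_one μ hg, inner_koop, koop_one]

theorem fixedSpace_koop_of_ergodic {g : X → X} (hg : Ergodic g μ) :
    fixedSpace (koop g hg.toMeasurePreserving) = constants μ := by
  refine le_antisymm ?_ ?_
  · intro f hf
    have h1 : f ∘ g =ᵐ[μ] f := by
      have := coeFn_koop g hg.toMeasurePreserving f
      rw [mem_fixedSpace.1 hf] at this
      exact this.symm
    obtain ⟨c, hc⟩ := hg.ae_eq_const_of_ae_eq_comp_ae (Lp.aestronglyMeasurable f) h1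
    rw [constants_eq, Submodule.mem_span_singleton]
    refine ⟨c, Lp.ext ?_⟩
    filter_upwards [hc, Lp.coeFn_smul c (one μ), coeFn_one μ] with x h1 h2 h3
    rw [h1, h2, Pi.smul_apply, h3]
    simp
  · rw [constants_eq, Submodule.span_singleton_le_iff_mem]
    exact koop_one μ hg.toMeasurePreserving

theorem prodTensor_one : prodTensor μ (fun _ => one μ) = one (μ.prod μ) := by
  refine Lp.ext ?_
  filter_upwards [coeFn_prodTensor μ (fun _ => one μ), coeFn_one (μ.prod μ),
    ae_prod_fst (coeFn_one μ), ae_prod_snd (coeFn_one μ)] with x h1 h2 h3 h4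
  rw [h1, h2, h3, h4, one_mul]

theorem piTensor_one {ι : Type*} [Fintype ι] {Y : ι → Type*} [∀ i, MeasurableSpace (Y i)]
    (ν : ∀ i, Measure (Y i)) [∀ i, IsProbabilityMeasure (ν i)] :
    piTensor ν (fun i => one (ν i)) = one (Measure.pi ν) := by
  refine Lp.ext ?_
  have : ∀ᵐ y ∂(Measure.pi ν), ∀ i, (one (ν i) : Y i → ℂ) (y i) = 1 :=
    ae_all_iff.2 fun i => ae_pi_eval (coeFn_one (ν i))
  filter_upwards [coeFn_piTensor ν (fun i => one (ν i)), coeFn_one (Measure.pi ν), this]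
    with y h1 h2 h3
  rw [h1, h2]
  exact Finset.prod_eq_one fun i _ => h3 i

end Const

section Real

variable {X : Type*} [MeasurableSpace X] {μ : Measure X} [IsProbabilityMeasure μ]

/-- The function `f` is real valued. -/
def IsReal (f : Lp ℂ 2 μ) : Prop := ∀ᵐ x ∂μ, (starRingEnd ℂ) (f x) = f x

omit [IsProbabilityMeasure μ] in
theorem IsReal.inner_comm {f g : Lp ℂ 2 μ} (hf : IsReal f) (hg : IsReal g) :
    inner ℂ f g = inner ℂ g f := by
  rw [L2.inner_def, L2.inner_def]
  refine integral_congr_ae ?_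
  filter_upwards [hf, hg] with x h1 h2
  rw [RCLike.inner_apply, RCLike.inner_apply, h1, h2, mul_comm]

omit [IsProbabilityMeasure μ] in
theorem IsReal.koop {f : Lp ℂ 2 μ} (hf : IsReal f) {g : X → X} (hg : MeasurePreserving g μ μ) :
    IsReal (koop g hg f) := by
  filter_upwards [coeFn_koop g hg f, hg.quasiMeasurePreserving.ae hf] with x h1 h2
  rw [h1]
  exact h2

omit [IsProbabilityMeasure μ] in
theorem IsReal.koop_pow {f : Lp ℂ 2 μ} (hf : IsReal f) {g : X → X} (hg : MeasurePreserving g μ μ)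
    (n : ℕ) : IsReal ((L2.koop g hg ^ n) f) := by
  induction n with
  | zero => exact hf
  | succ n ih => rw [pow_succ', mul_apply_eq_comp]; exact ih.koop hg

theorem isReal_one : IsReal (one μ) := by
  filter_upwards [coeFn_one μ] with x h1
  rw [h1, map_one]

theorem isReal_indicator {s : Set X} (hs : MeasurableSet s) :
    IsReal (indicatorConstLp 2 hs (measure_ne_top μ s) (1 : ℂ)) := by
  filter_upwards [indicatorConstLp_coeFn (p := 2) (hs := hs) (hμs := measure_ne_top μ s)
    (c := (1 : ℂ))] with x h1
  rw [h1]
  by_cases hx : x ∈ s <;> simp [hx]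

theorem IsReal.sub_Theta {f : Lp ℂ 2 μ} (hf : IsReal f) : IsReal (f - Theta μ f) := by
  rw [Theta_apply]
  have hc : (starRingEnd ℂ) (inner ℂ (one μ) f) = inner ℂ (one μ) f := by
    rw [inner_conj_symm, hf.inner_comm isReal_one]
  filter_upwards [Lp.coeFn_sub f (inner ℂ (one μ) f • one μ),
    Lp.coeFn_smul (inner ℂ (one μ) f) (one μ), hf, isReal_one (μ := μ)] with x h1 h2 h3 h4
  rw [h1, Pi.sub_apply, h2, Pi.smul_apply, smul_eq_mul, map_sub, map_mul, h3, h4, hc]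

end Real

section WeakMixing

variable {X : Type*} [MeasurableSpace X] {μ : Measure X} [IsProbabilityMeasure μ]

/-- If `g × g` is ergodic, so is `g × g⁻¹`. -/
theorem fixedSpace_koop_prodMap_inv {g g' : X → X} (hg : MeasurePreserving g μ μ)
    (hg' : MeasurePreserving g' μ μ) (h2 : g' ∘ g = id)
    (hfix : fixedSpace (koop (Prod.map g g) (hg.prod hg)) = constants (μ.prod μ)) :
    fixedSpace (koop (Prod.map g g') (hg.prod hg')) = constants (μ.prod μ) := by
  set P := koop (Prod.map g g) (hg.prod hg) with hP
  set W := koop (Prod.map g g') (hg.prod hg') with hW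
  have hτ := isTensorProduct_prodTensor μ
  have hPt := isTensor_koop_prodMap μ hg hg
  have hWt := isTensor_koop_prodMap μ hg hg'
  have hstar : star (koop g hg) = koop g' hg' := star_koop hg hg' h2
  -- For real `h` the autocorrelations at times `n` and `-n` agree, so `f ⊗ h` has the same
  -- autocorrelations under `g × g` and `g × g⁻¹`.
  have hterm : ∀ (f h : Lp ℂ 2 μ), IsReal h → ∀ n : ℕ,
      inner ℂ (prodTensor μ ![f, h]) ((P ^ n) (prodTensor μ ![f, h])) =
        inner ℂ (prodTensor μ ![f, h]) ((W ^ n) (prodTensor μ ![f, h])) := by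
    intro f h hh n
    rw [hPt.pow n, hWt.pow n, hτ.inner_map, hτ.inner_map, Fin.prod_univ_two, Fin.prod_univ_two]
    congr 1
    change inner ℂ h ((koop g hg ^ n) h) = inner ℂ h ((koop g' hg' ^ n) h)
    rw [← hstar, ← star_pow, ContinuousLinearMap.star_eq_adjoint,
      ContinuousLinearMap.adjoint_inner_right]
    exact hh.inner_comm (hh.koop_pow hg n)
  -- Averaging the autocorrelations gives `⟪x, fixProj W x⟫ = ⟪x, Θ x⟫`, which is zero for `x = f ⊗
  -- h` of mean zero, while the left side is `‖fixProj W x‖²`.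
  have hproj : ∀ (f h : Lp ℂ 2 μ), IsReal h →
      inner ℂ (one μ) f * inner ℂ (one μ) h = 0 → fixProj W (prodTensor μ ![f, h]) = 0 := by
    intro f h hh h0
    set x := prodTensor μ ![f, h] with hx
    have hlim : ∀ A : Lp ℂ 2 (μ.prod μ) →L[ℂ] Lp ℂ 2 (μ.prod μ), ‖A‖ ≤ 1 →
        Tendsto (fun N : ℕ => (N : ℂ)⁻¹ * ∑ n ∈ Finset.range N, inner ℂ x ((A ^ n) x)) atTop
          (𝓝 (inner ℂ x (fixProj A x))) := by
      intro A hA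
      have := (tendsto_const_nhds (x := x)).inner (𝕜 := ℂ) (tendsto_fixProj hA x)
      refine this.congr fun N => ?_
      rw [inner_smul_right, inner_sum]
    have he : inner ℂ x (fixProj P x) = inner ℂ x (fixProj W x) := by
      refine tendsto_nhds_unique (hlim P (norm_koop_le _ _)) ((hlim W (norm_koop_le _ _)).congr
        fun N => ?_)
      simp only [hx, hterm f h hh]
    rw [fixProj_eq_Theta _ hfix, Theta_apply, ← prodTensor_one, hx, hτ.inner_map,
      Fin.prod_univ_two] at he
    simp only [Matrix.cons_val_zero, Matrix.cons_val_one] at he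
    rw [h0, zero_smul, inner_zero_right, ← hx, ← fixProj_fixProj, ← star_fixProj,
      ContinuousLinearMap.star_eq_adjoint, ContinuousLinearMap.adjoint_inner_right,
      ← ContinuousLinearMap.star_eq_adjoint, star_fixProj] at he
    exact inner_self_eq_zero.1 he.symm
  have horth : ∀ (F : Lp ℂ 2 (μ.prod μ)) (f h : Lp ℂ 2 μ), W F = F → IsReal h →
      inner ℂ (one μ) f * inner ℂ (one μ) h = 0 → inner ℂ (prodTensor μ ![f, h]) F = 0 := by
    intro F f h hF hh h0
    rw [← fixProj_apply_eq_self.2 hF, ← ContinuousLinearMap.adjoint_inner_left,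
      ← ContinuousLinearMap.star_eq_adjoint, star_fixProj, hproj f h hh h0, inner_zero_left]
  have hTheta0 : ∀ f : Lp ℂ 2 μ, inner ℂ (one μ) (f - Theta μ f) = 0 := by
    intro f
    rw [Theta_apply, inner_sub_right, inner_smul_right, inner_self_eq_norm_sq_to_K, norm_one]
    simp
  refine le_antisymm ?_ ?_
  · intro F hF
    rw [mem_fixedSpace] at hF
    suffices h : F - Theta (μ.prod μ) F = 0 by
      rw [sub_eq_zero.1 h]
      exact (constants (μ.prod μ)).starProjection_apply_mem F
    have hF' : W (F - Theta (μ.prod μ) F) = F - Theta (μ.prod μ) F := by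
      rw [map_sub, hF, ← mul_apply_eq_comp, koop_mul_Theta]
    have hF0 : inner ℂ (one (μ.prod μ)) (F - Theta (μ.prod μ) F) = 0 := by
      rw [Theta_apply, inner_sub_right, inner_smul_right, inner_self_eq_norm_sq_to_K, norm_one]
      simp
    set F₀ := F - Theta (μ.prod μ) F
    refine eq_zero_of_indicator μ fun s t hs ht => ?_
    set f := indicatorConstLp 2 hs (measure_ne_top μ s) (1 : ℂ)
    set h := indicatorConstLp 2 ht (measure_ne_top μ t) (1 : ℂ)
    have hh : IsReal h := isReal_indicator ht
    -- The indicator of a box splits into two tensors of mean zero with real second factor, covered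
    -- by `horth`, and a constant.
    have e1 : prodTensor μ ![f, h] = prodTensor μ ![f - Theta μ f, h] +
        inner ℂ (one μ) f • prodTensor μ ![one μ, h - Theta μ h] +
        (inner ℂ (one μ) f * inner ℂ (one μ) h) • one (μ.prod μ) := by
      have u0 : ∀ a b c : Lp ℂ 2 μ, Function.update ![a, b] 0 c = ![c, b] := by
        intro a b c; ext1 i; fin_cases i <;> simp
      have u1 : ∀ a b c : Lp ℂ 2 μ, Function.update ![a, b] 1 c = ![a, c] := by
        intro a b c; ext1 i; fin_cases i <;> simp
      have s0 := (prodTensor μ).map_update_sub ![f, h] 0 f (Theta μ f)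
      have s1 := (prodTensor μ).map_update_sub ![one μ, h] 1 h (Theta μ h)
      have m0 := (prodTensor μ).map_update_smul ![one μ, h] 0 (inner ℂ (one μ) f) (one μ)
      have m1 := (prodTensor μ).map_update_smul ![one μ, h] 1 (inner ℂ (one μ) h) (one μ)
      simp only [u0, u1] at s0 s1 m0 m1
      have hone : prodTensor μ ![one μ, one μ] = one (μ.prod μ) := by
        rw [← prodTensor_one]
        congr 1
        ext1 i; fin_cases i <;> rfl
      rw [s0, s1, Theta_apply, Theta_apply, m0, m1, hone, smul_sub, smul_smul]
      abel
    rw [e1, inner_add_left, inner_add_left, inner_smul_left, inner_smul_left, hF0,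
      horth F₀ _ _ hF' hh (by rw [hTheta0, zero_mul]),
      horth F₀ _ _ hF' hh.sub_Theta (by rw [hTheta0, mul_zero])]
    simp
  · rw [constants_eq, Submodule.span_singleton_le_iff_mem]
    exact koop_one _ _

end WeakMixing

end L2

/-! ### Operators on the square of an action and the dilations `Θ + r(1 - Θ)`. -/

namespace Z2Action

open Z2Spectral L2

variable {X : Type*} [MeasurableSpace X] {μ : Measure X}

theorem map_zero (T : Z2Action X μ) (x : X) : T.map 0 x = x := by
  have h := T.map_add 0 0 x
  rw [add_zero] at h
  exact (T.map 0).injective h.symm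

theorem map_neg_comp (T : Z2Action X μ) (z : ℤ × ℤ) : T.map (-z) ∘ T.map z = id := by
  ext1 x
  rw [Function.comp_apply, ← T.map_add, neg_add_cancel, T.map_zero, id]

theorem map_comp_neg (T : Z2Action X μ) (z : ℤ × ℤ) : T.map z ∘ T.map (-z) = id := by
  ext1 x
  rw [Function.comp_apply, ← T.map_add, add_neg_cancel, T.map_zero, id]

theorem map_comm (T : Z2Action X μ) (z w : ℤ × ℤ) (x : X) :
    T.map z (T.map w x) = T.map w (T.map z x) := by
  rw [← T.map_add, ← T.map_add, add_comm]

theorem koopman_eq (T : Z2Action X μ) (z : ℤ × ℤ) :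
    T.koopman z = koop (T.map z) (T.measurePreserving z) := rfl

theorem isUnitaryRep (T : Z2Action X μ) : IsUnitaryRep T.koopman where
  map_zero := by
    rw [koopman_eq, ← koop_id]
    exact koop_congr _ _ (funext T.map_zero)
  map_add z w := by
    rw [koopman_eq, koopman_eq, koopman_eq, koop_mul]
    refine koop_congr _ _ (funext fun x => ?_)
    rw [add_comm]
    exact T.map_add w z x
  star_eq z := star_koop _ _ (T.map_neg_comp z)

theorem norm_koopman_le (T : Z2Action X μ) (z : ℤ × ℤ) : ‖T.koopman z‖ ≤ 1 := norm_koop_le _ _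

section Square

variable [IsProbabilityMeasure μ] (T : Z2Action X μ)

theorem isTensor_square (z : ℤ × ℤ) :
    IsTensor (prodTensor μ) (T.square.koopman z) fun _ => T.koopman z := by
  intro f
  refine (isTensor_koop_prodMap μ (T.measurePreserving z) (T.measurePreserving z) f).trans ?_
  congr 1
  ext1 i
  fin_cases i <;> rfl

/-- The operator of the map `T^z × id`. -/
noncomputable def koopFst (z : ℤ × ℤ) : Lp ℂ 2 (μ.prod μ) →L[ℂ] Lp ℂ 2 (μ.prod μ) :=
  koop (Prod.map (T.map z) id) ((T.measurePreserving z).prod (MeasurePreserving.id μ))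

/-- The operator of the map `id × T^z`. -/
noncomputable def koopSnd (z : ℤ × ℤ) : Lp ℂ 2 (μ.prod μ) →L[ℂ] Lp ℂ 2 (μ.prod μ) :=
  koop (Prod.map id (T.map z)) ((MeasurePreserving.id μ).prod (T.measurePreserving z))

variable (μ) in
/-- The operator exchanging the two coordinates. -/
noncomputable def koopSwap : Lp ℂ 2 (μ.prod μ) →L[ℂ] Lp ℂ 2 (μ.prod μ) :=
  koop Prod.swap Measure.measurePreserving_swap

theorem koopFst_mul_square (z w : ℤ × ℤ) :
    T.koopFst z * T.square.koopman w = T.square.koopman w * T.koopFst z := by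
  rw [koopman_eq, koopFst, koop_mul, koop_mul]
  exact koop_congr _ _ (funext fun p => Prod.ext (T.map_comm _ _ _) rfl)

theorem koopSnd_mul_square (z w : ℤ × ℤ) :
    T.koopSnd z * T.square.koopman w = T.square.koopman w * T.koopSnd z := by
  rw [koopman_eq, koopSnd, koop_mul, koop_mul]
  exact koop_congr _ _ (funext fun p => Prod.ext rfl (T.map_comm _ _ _))

theorem koopFst_mul_koopSnd (z w : ℤ × ℤ) :
    T.koopFst z * T.koopSnd w = koop (Prod.map (T.map z) (T.map w))
      ((T.measurePreserving z).prod (T.measurePreserving w)) := by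
  rw [koopSnd, koopFst, koop_mul]
  exact koop_congr _ _ rfl

theorem koopSnd_mul_koopFst (z w : ℤ × ℤ) :
    T.koopSnd w * T.koopFst z = koop (Prod.map (T.map z) (T.map w))
      ((T.measurePreserving z).prod (T.measurePreserving w)) := by
  rw [koopSnd, koopFst, koop_mul]
  exact koop_congr _ _ rfl

theorem koopSwap_mul_koopSwap : koopSwap μ * koopSwap μ = 1 := by
  rw [koopSwap, koop_mul, ← koop_id]
  exact koop_congr _ _ Prod.swap_swap_eq

theorem star_koopSwap : star (koopSwap μ) = koopSwap μ :=
  star_koop _ _ Prod.swap_swap_eq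

theorem koopSwap_mul_square (z : ℤ × ℤ) :
    koopSwap μ * T.square.koopman z = T.square.koopman z * koopSwap μ := by
  rw [koopman_eq, koopSwap, koop_mul, koop_mul]
  exact koop_congr _ _ rfl

theorem koopSwap_mul_koopFst (z : ℤ × ℤ) :
    koopSwap μ * T.koopFst z = T.koopSnd z * koopSwap μ := by
  rw [koopFst, koopSnd, koopSwap, koop_mul, koop_mul]
  exact koop_congr _ _ rfl

theorem koopSwap_mul_koopSnd (z : ℤ × ℤ) :
    koopSwap μ * T.koopSnd z = T.koopFst z * koopSwap μ := by
  rw [koopFst, koopSnd, koopSwap, koop_mul, koop_mul]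
  exact koop_congr _ _ rfl

theorem star_koopFst (z : ℤ × ℤ) : star (T.koopFst z) = T.koopFst (-z) := by
  refine star_koop _ _ ?_
  rw [Prod.map_comp_map, map_neg_comp, Function.comp_id, Prod.map_id]

theorem star_koopSnd (z : ℤ × ℤ) : star (T.koopSnd z) = T.koopSnd (-z) := by
  refine star_koop _ _ ?_
  rw [Prod.map_comp_map, map_neg_comp, Function.comp_id, Prod.map_id]

theorem actsAt_koopFst (z : ℤ × ℤ) : ActsAt (prodTensor μ) 0 (T.koopFst z) (T.koopman z) :=
  actsAt_koop_fst μ (T.measurePreserving z)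

theorem actsAt_koopSnd (z : ℤ × ℤ) : ActsAt (prodTensor μ) 1 (T.koopSnd z) (T.koopman z) :=
  actsAt_koop_snd μ (T.measurePreserving z)

theorem Theta_mul_koopman (z : ℤ × ℤ) : Theta μ * T.koopman z = Theta μ :=
  Theta_mul_koop μ (T.measurePreserving z)

theorem koopman_mul_Theta (z : ℤ × ℤ) : T.koopman z * Theta μ = Theta μ :=
  koop_mul_Theta μ (T.measurePreserving z)

/-- `t + r (1 - t)`. -/
noncomputable def dilate {H : Type*} [NormedAddCommGroup H] [InnerProductSpace ℂ H] (r : ℝ)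
    (t : H →L[ℂ] H) : H →L[ℂ] H := t + (r : ℂ) • (1 - t)

theorem dilate_mul_dilate {H : Type*} [NormedAddCommGroup H] [InnerProductSpace ℂ H] (r s : ℝ)
    {t : H →L[ℂ] H} (ht : t * t = t) : dilate r t * dilate s t = dilate (r * s) t := by
  have h1 : t * (1 - t) = 0 := by rw [mul_sub, mul_one, ht, sub_self]
  have h2 : (1 - t) * t = 0 := by rw [sub_mul, one_mul, ht, sub_self]
  have h3 : (1 - t) * (1 - t) = 1 - t := by rw [mul_sub, h2, mul_one, sub_zero]
  simp only [dilate, mul_add, add_mul, smul_mul_assoc, mul_smul_comm, ht, h1, h2, h3, smul_zero,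
    add_zero, zero_add, smul_smul, Complex.ofReal_mul]
  rw [mul_comm (s : ℂ)]

theorem dilate_one {H : Type*} [NormedAddCommGroup H] [InnerProductSpace ℂ H]
    (t : H →L[ℂ] H) : dilate 1 t = 1 := by
  simp [dilate]

theorem star_dilate {H : Type*} [NormedAddCommGroup H] [InnerProductSpace ℂ H] [CompleteSpace H]
    (r : ℝ) {t : H →L[ℂ] H} (ht : star t = t) : star (dilate r t) = dilate r t := by
  simp [dilate, ht]

/-- The tensor square of `Θ + r (1 - Θ)`. -/
noncomputable def dilateSquare (r : ℝ) : Lp ℂ 2 (μ.prod μ) →L[ℂ] Lp ℂ 2 (μ.prod μ) :=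
  dilate r (fixProj (T.koopFst (1, 0))) * dilate r (fixProj (T.koopSnd (1, 0)))

variable {T} (hT : fixedSpace (T.koopman (1, 0)) = constants μ)
include hT

/-- When `T^(1,0)` fixes only constants, the projection onto the fixed vectors of `T^(1,0) × id`
acts as `Θ` on the first coordinate, and likewise for the second. This is why `dilateSquare` is
built from `fixProj`. -/
theorem isTensor_dilateSquare (r : ℝ) :
    IsTensor (prodTensor μ) (T.dilateSquare r) fun _ => dilate r (Theta μ) := by
  have hτ := isTensorProduct_prodTensor μ
  have h0 := hτ.actsAt_fixProj (T.actsAt_koopFst (1, 0)) (norm_koop_le _ _)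
    (T.norm_koopman_le _)
  have h1 := hτ.actsAt_fixProj (T.actsAt_koopSnd (1, 0)) (norm_koop_le _ _)
    (T.norm_koopman_le _)
  rw [fixProj_eq_Theta μ hT] at h0 h1
  have h0' := h0.add (((ActsAt.one 0).sub h0).smul (r : ℂ))
  have h1' := h1.add (((ActsAt.one 1).sub h1).smul (r : ℂ))
  intro f
  rw [dilateSquare, mul_apply_eq_comp, dilate, dilate, h1', h0']
  congr 1
  ext1 i
  fin_cases i <;> simp [dilate]

theorem star_dilateSquare (r : ℝ) : star (T.dilateSquare r) = T.dilateSquare r :=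
  (isTensorProduct_prodTensor μ).isTensor_star (isTensor_dilateSquare hT r) (by
    simpa only [star_dilate r (star_Theta μ)] using isTensor_dilateSquare hT r)

theorem dilateSquare_mul (r s : ℝ) :
    T.dilateSquare r * T.dilateSquare s = T.dilateSquare (r * s) := by
  refine (isTensorProduct_prodTensor μ).isTensor_unique
    ((isTensor_dilateSquare hT r).mul (isTensor_dilateSquare hT s)) ?_
  have : ((fun _ => dilate r (Theta μ)) * fun _ => dilate s (Theta μ) :
      Fin 2 → Lp ℂ 2 μ →L[ℂ] Lp ℂ 2 μ) = fun _ => dilate (r * s) (Theta μ) :=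
    funext fun _ => dilate_mul_dilate r s (Theta_mul_Theta μ)
  rw [this]
  exact isTensor_dilateSquare hT _

omit hT in
theorem dilateSquare_one : T.dilateSquare 1 = 1 := by
  rw [dilateSquare, dilate_one, dilate_one, one_mul]

theorem dilateSquare_comm_square (r : ℝ) (z : ℤ × ℤ) :
    T.dilateSquare r * T.square.koopman z = T.square.koopman z * T.dilateSquare r := by
  refine (isTensorProduct_prodTensor μ).isTensor_unique
    ((isTensor_dilateSquare hT r).mul (T.isTensor_square z)) ?_
  have : ((fun _ => dilate r (Theta μ)) * fun _ => T.koopman z :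
      Fin 2 → Lp ℂ 2 μ →L[ℂ] Lp ℂ 2 μ) = (fun _ => T.koopman z) * fun _ => dilate r (Theta μ) := by
    funext _
    change dilate r (Theta μ) * T.koopman z = T.koopman z * dilate r (Theta μ)
    simp only [dilate, add_mul, mul_add, smul_mul_assoc, mul_smul_comm, sub_mul, mul_sub,
      Theta_mul_koopman, koopman_mul_Theta, one_mul, mul_one]
  rw [this]
  exact (T.isTensor_square z).mul (isTensor_dilateSquare hT r)

/-- Since `ΘT = Θ`, the given limit factors as `(Θ + a(1 - Θ))T`. Its tensor square is written with
`√a` twice so that the positive factor appears as the square of a self-adjoint operator. -/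
theorem weakLimit_square {w : ℕ → ℤ × ℤ} {a : ℝ} (ha : 0 < a) {z : ℤ × ℤ}
    (h : WeakLimit (fun n => T.koopman (w n))
      ((a : ℂ) • T.koopman z + (1 - (a : ℂ)) • Theta μ)) :
    WeakLimit (fun n => T.square.koopman (w n))
      (T.dilateSquare √a * T.dilateSquare √a * T.square.koopman z) := by
  rw [dilateSquare_mul hT, Real.mul_self_sqrt ha.le]
  refine (isTensorProduct_prodTensor μ).weakLimit (fun n => T.isTensor_square (w n))
    ((isTensor_dilateSquare hT a).mul (T.isTensor_square z)) (fun n => norm_koopman_le _ _)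
    fun i => ?_
  have : ((fun _ => dilate a (Theta μ)) * fun _ => T.koopman z :
      Fin 2 → Lp ℂ 2 μ →L[ℂ] Lp ℂ 2 μ) i = (a : ℂ) • T.koopman z + (1 - (a : ℂ)) • Theta μ := by
    change dilate a (Theta μ) * T.koopman z = _
    simp only [dilate, add_mul, smul_mul_assoc, sub_mul, Theta_mul_koopman, one_mul, smul_sub,
      sub_smul, one_smul]
    abel
  rw [this]
  exact h

end Square

section Pi

variable {ι : Type*} [Fintype ι] {Y : ι → Type*} [∀ i, MeasurableSpace (Y i)]
  {ν : ∀ i, Measure (Y i)} [∀ i, IsProbabilityMeasure (ν i)] (S : ∀ i, Z2Action (Y i) (ν i))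

theorem isTensor_pi (z : ℤ × ℤ) :
    IsTensor (piTensor ν) ((Z2Action.pi S).koopman z) fun i => (S i).koopman z :=
  isTensor_koop ν fun i => (S i).measurePreserving z

theorem fixedSpace_koopman_of_ergodic_pi {z : ℤ × ℤ}
    (h : Ergodic ((Z2Action.pi S).map z) (Measure.pi ν)) (i : ι) :
    fixedSpace ((S i).koopman z) = constants (ν i) := by
  classical
  refine (isTensorProduct_piTensor ν).fixedSpace_eq (isTensor_pi S z) (e := fun i => one (ν i))
    (fun i => norm_one _) (fun i => koop_one _ _) ?_ i
  rw [piTensor_one]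
  exact fixedSpace_koop_of_ergodic _ h

theorem fixedSpace_koopman_of_square {X : Type*} [MeasurableSpace X] {μ : Measure X}
    [IsProbabilityMeasure μ] {T : Z2Action X μ} {z : ℤ × ℤ}
    (h : fixedSpace (T.square.koopman z) = constants (μ.prod μ)) :
    fixedSpace (T.koopman z) = constants μ := by
  refine (isTensorProduct_prodTensor μ).fixedSpace_eq (T.isTensor_square z)
    (e := fun i => one μ) (fun i => norm_one _) (fun i => koop_one _ _) ?_ 0
  rw [prodTensor_one]
  exact h

end Pi

end Z2Action

/-! ### Weak limits and the bicommutant. -/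

namespace Z2Spectral

variable {ι : Type*} [Fintype ι] [DecidableEq ι]
  {E : ι → Type*} [∀ i, NormedAddCommGroup (E i)] [∀ i, InnerProductSpace ℂ (E i)]
  [∀ i, CompleteSpace (E i)]
  {H : Type*} [NormedAddCommGroup H] [InnerProductSpace ℂ H] [CompleteSpace H]

theorem WeakLimit.commute {A : ℕ → H →L[ℂ] H} {G B : H →L[ℂ] H}
    (h : WeakLimit A G) (hB : ∀ n, A n * B = B * A n) : G * B = B * G := by
  ext1 x
  refine ext_inner_left ℂ fun y => ?_
  have h1 := h (B x) y
  have h2 := h x (star B y)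
  rw [ContinuousLinearMap.star_eq_adjoint, ContinuousLinearMap.adjoint_inner_left] at h2
  refine tendsto_nhds_unique h1 (h2.congr fun n => ?_)
  rw [ContinuousLinearMap.adjoint_inner_left, ← mul_apply_eq_comp, ← hB, mul_apply_eq_comp]

/-- Weak limits `S² R` of the action, with `S` positive and invertible, put the unitary factor
`R` into the bicommutant of the action. -/
theorem IsTensorProduct.commute_of_weakLimit {τ : MultilinearMap ℂ E H} (hτ : IsTensorProduct τ)
    {U : ℤ × ℤ → H →L[ℂ] H} (hU : IsUnitaryRep U) {Q : ∀ i, ℤ × ℤ → E i →L[ℂ] E i}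
    (hQ : ∀ i, IsUnitaryRep (Q i)) (hUQ : ∀ z, IsTensor τ (U z) fun i => Q i z)
    {w : ℕ → ℤ × ℤ} {s s' : ∀ j, E j →L[ℂ] E j} (hs : ∀ j, ∃ S, ActsAt τ j S (s j))
    (hs' : ∀ j, ∃ S, ActsAt τ j S (s' j)) (hstar : ∀ j, star (s j) = s j)
    (hinv : ∀ j, s' j * s j = 1) {z : ι → ℤ × ℤ}
    (hcomm : ∀ j, s j * Q j (z j) = Q j (z j) * s j)
    (hlim : ∀ j, WeakLimit (fun n => Q j (w n)) (s j * s j * Q j (z j)))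
    (hnorm : ∀ n, ‖U (w n)‖ ≤ 1)
    {R R' : H →L[ℂ] H} (hR : IsTensor τ R fun j => Q j (z j))
    (hR' : IsTensor τ R' fun j => Q j (-z j)) {B : H →L[ℂ] H} (hB : B ∈ commutant U) :
    B * R = R * B := by
  obtain ⟨S, hS⟩ := exists_isTensor hs
  obtain ⟨S', hS'⟩ := exists_isTensor hs'
  have hSsa : star S = S := hτ.isTensor_star hS (by simpa only [hstar] using hS)
  have hinv' : S' * S = 1 := by
    refine hτ.isTensor_unique (hS'.mul hS) fun f => ?_
    simp [hinv]
  have hSR : S * R = R * S := by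
    refine hτ.isTensor_unique (hS.mul hR) ?_
    have : (s * fun j => Q j (z j)) = (fun j => Q j (z j)) * s := funext hcomm
    rw [this]
    exact hR.mul hS
  have hRR : star R * R = 1 := by
    rw [hτ.isTensor_star hR (by simpa only [(hQ _).star_eq] using hR')]
    refine hτ.isTensor_unique (hR'.mul hR) fun f => ?_
    have : ∀ j, Q j (-z j) * Q j (z j) = 1 := fun j => by
      rw [← (hQ j).map_add, neg_add_cancel, (hQ j).map_zero]
    simp [this]
  have hG : WeakLimit (fun n => U (w n)) (S * S * R) := by
    refine hτ.weakLimit (fun n => hUQ (w n)) ((hS.mul hS).mul hR) hnorm fun j => hlim j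
  have hGB : ∀ {B}, B ∈ commutant U → S * S * R * B = B * (S * S * R) := fun {B} hB =>
    hG.commute fun n => mem_commutant.1 hB _
  -- The commutant is closed under adjoints, so the adjoint of the limit commutes with `B` too.
  have hGB' : star (S * S * R) * B = B * star (S * S * R) := by
    have := congrArg star (hGB (hU.star_mem hB))
    rw [star_mul (S * S * R), star_mul (star B), star_star] at this
    exact this.symm
  have h4 : star (S * S * R) * (S * S * R) = (S * S) * (S * S) := by
    have e1 : S * S * R = R * (S * S) := by rw [mul_assoc, hSR, ← mul_assoc, hSR, mul_assoc]
    rw [e1, star_mul, star_mul, hSsa, mul_assoc, ← mul_assoc (star R), hRR, one_mul]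
  have h5 : Commute ((S * S) * (S * S)) B := by
    rw [commute_iff_eq, ← h4, mul_assoc, hGB hB, ← mul_assoc, hGB', mul_assoc]
  -- `S²` is the positive square root of `S⁴`, so the functional calculus transfers commutation with
  -- `B`. The invertible `S²` is then cancelled from `S²R`.
  have h6 : Commute (S * S) B := by
    have hpos : 0 ≤ S * S := by
      have := star_mul_self_nonneg S
      rwa [hSsa] at this
    have := h5.cfcₙ_nnreal NNReal.sqrt
    rwa [show cfcₙ NNReal.sqrt ((S * S) * (S * S)) = S * S from CFC.sqrt_mul_self _ hpos] at this
  have h7 : S * S * (B * R) = S * S * (R * B) := by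
    rw [← mul_assoc, h6.eq, mul_assoc, ← hGB hB, mul_assoc]
  have h8 : S' * (S' * (S * S)) = 1 := by
    rw [← mul_assoc S' S S, hinv', one_mul, hinv']
  calc B * R = S' * (S' * (S * S)) * (B * R) := by rw [h8, one_mul]
    _ = S' * (S' * (S * S * (B * R))) := by simp only [mul_assoc]
    _ = S' * (S' * (S * S * (R * B))) := by rw [h7]
    _ = S' * (S' * (S * S)) * (R * B) := by simp only [mul_assoc]
    _ = R * B := by rw [h8, one_mul]

/-! ### Square systems: sectors and their parity cells. -/

variable {ι : Type*} [Fintype ι] [DecidableEq ι]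
  {E : ι → Type*} [∀ i, NormedAddCommGroup (E i)] [∀ i, InnerProductSpace ℂ (E i)]
  [∀ i, CompleteSpace (E i)]
  {H : Type*} [NormedAddCommGroup H] [InnerProductSpace ℂ H] [CompleteSpace H]

/-- A tensor product `U` of representations `Q i` fixing unit vectors `e i`, with symmetries
`σ i` of the factors, such that the factor actions `R i` lie in the bicommutant of `U`.
The operators `Th i`, `S i`, `D i` act on the factor `i` as the projection to `e i`, as `σ i`
and as an operator anticommuting with `σ i` whose kernel is spanned by `e i`. -/
structure IsSquareSystem (τ : MultilinearMap ℂ E H) (Q : ∀ i, ℤ × ℤ → E i →L[ℂ] E i)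
    (e : ∀ i, E i) (σ : ∀ i, E i →L[ℂ] E i) (U : ℤ × ℤ → H →L[ℂ] H)
    (R : ι → ℤ × ℤ → H →L[ℂ] H) (Th S D : ι → H →L[ℂ] H) : Prop where
  tensor : IsTensorProduct τ
  repU : IsUnitaryRep U
  isTensor : ∀ z, IsTensor τ (U z) fun i => Q i z
  norm_e : ∀ i, ‖e i‖ = 1
  map_e : ∀ i z, Q i z (e i) = e i
  actsAt_R : ∀ i z, ActsAt τ i (R i z) (Q i z)
  commute_R : ∀ B ∈ commutant U, ∀ i z x, B (R i z x) = R i z (B x)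
  actsAt_Th : ∀ i, ActsAt τ i (Th i) (ℂ ∙ e i).starProjection
  Th_eq : ∀ i, Th i = fixProj (R i (1, 0))
  actsAt_S : ∀ i, ActsAt τ i (S i) (σ i)
  sigma_sigma : ∀ i, σ i * σ i = 1
  star_sigma : ∀ i, star (σ i) = σ i
  sigma_e : ∀ i, σ i (e i) = e i
  sigma_comm : ∀ i z, σ i * Q i z = Q i z * σ i
  actsAt_D : ∀ i, ∃ d, ActsAt τ i (D i) d ∧ (∀ z, d * Q i z = Q i z * d) ∧ σ i * d = -(d * σ i)
  D_eq_zero : ∀ i x, D i x = 0 ↔ Th i x = x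
  star_D_eq_zero : ∀ i x, star (D i) x = 0 ↔ Th i x = x

namespace IsSquareSystem

variable {τ : MultilinearMap ℂ E H} {Q : ∀ i, ℤ × ℤ → E i →L[ℂ] E i}
    {e : ∀ i, E i} {σ : ∀ i, E i →L[ℂ] E i} {U : ℤ × ℤ → H →L[ℂ] H}
    {R : ι → ℤ × ℤ → H →L[ℂ] H} {Th S D : ι → H →L[ℂ] H}
    (h : IsSquareSystem τ Q e σ U R Th S D)
include h

theorem mem_commutant_of_actsAt {i : ι} {B : H →L[ℂ] H} {b : E i →L[ℂ] E i} (hB : ActsAt τ i B b)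
    (hb : ∀ z, b * Q i z = Q i z * b) : B ∈ commutant U := by
  rw [mem_commutant]
  intro z
  refine h.tensor.ext fun f => ?_
  rw [mul_apply_eq_comp, mul_apply_eq_comp, hB, h.isTensor, h.isTensor, hB]
  congr 1
  ext1 j
  by_cases hj : j = i
  · subst hj
    rw [Function.update_self, Function.update_self, ← mul_apply_eq_comp, ← hb,
      mul_apply_eq_comp]
  · rw [Function.update_of_ne hj, Function.update_of_ne hj]

theorem proj_apply (i : ι) (v : E i) : (ℂ ∙ e i).starProjection v = inner ℂ (e i) v • e i :=
  Submodule.starProjection_unit_singleton ℂ (h.norm_e i) v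

theorem S_mem (i : ι) : S i ∈ commutant U :=
  h.mem_commutant_of_actsAt (h.actsAt_S i) (h.sigma_comm i)

theorem D_mem (i : ι) : D i ∈ commutant U := by
  obtain ⟨d, hd, hdQ, -⟩ := h.actsAt_D i
  exact h.mem_commutant_of_actsAt hd hdQ

/-- `Th i` projects onto the fixed vectors of an operator in the bicommutant. This is what makes the
sectors hyperinvariant. -/
theorem commute_Th {B : H →L[ℂ] H} (hB : B ∈ commutant U) (i : ι) (x : H) :
    Th i (B x) = B (Th i x) := by
  rw [h.Th_eq]
  exact fixProj_comm (fun x => h.commute_R B hB i _ x)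
    (fun x => h.commute_R _ (h.repU.star_mem hB) i _ x) x

theorem star_Th (i : ι) : star (Th i) = Th i := by
  rw [h.Th_eq, star_fixProj]

theorem inner_Th (i : ι) (x y : H) : inner ℂ (Th i x) y = inner ℂ x (Th i y) := by
  rw [← ContinuousLinearMap.adjoint_inner_right, ← ContinuousLinearMap.star_eq_adjoint, h.star_Th]

theorem Th_Th (i : ι) (x : H) : Th i (Th i x) = Th i x := by
  rw [h.Th_eq, fixProj_fixProj]

theorem Th_mem (i : ι) : Th i ∈ commutant U := by
  rw [mem_commutant]
  intro z
  ext x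
  exact (h.commute_Th (h.repU.map_mem z) i x).symm

theorem S_S (i : ι) (x : H) : S i (S i x) = x := by
  have : S i * S i = 1 := h.tensor.actsAt_unique ((h.actsAt_S i).mul (h.actsAt_S i))
    (h.sigma_sigma i ▸ ActsAt.one i)
  exact congrArg (fun A : H →L[ℂ] H => A x) this

theorem star_S (i : ι) : star (S i) = S i :=
  h.tensor.actsAt_star (h.actsAt_S i) ((h.star_sigma i).symm ▸ h.actsAt_S i)

theorem inner_S (i : ι) (x y : H) : inner ℂ (S i x) y = inner ℂ x (S i y) := by
  rw [← ContinuousLinearMap.adjoint_inner_right, ← ContinuousLinearMap.star_eq_adjoint, h.star_S]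

theorem S_comm_S (i j : ι) (x : H) : S i (S j x) = S j (S i x) := by
  by_cases hij : i = j
  · rw [hij]
  · exact congrArg (fun A : H →L[ℂ] H => A x)
      (h.tensor.actsAt_comm_of_ne hij (h.actsAt_S i) (h.actsAt_S j))

theorem S_comm_D {i j : ι} (hij : i ≠ j) (x : H) : S i (D j x) = D j (S i x) := by
  obtain ⟨d, hd, -⟩ := h.actsAt_D j
  exact congrArg (fun A : H →L[ℂ] H => A x)
      (h.tensor.actsAt_comm_of_ne hij (h.actsAt_S i) hd)

theorem S_D (i : ι) (x : H) : S i (D i x) = -D i (S i x) := by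
  obtain ⟨d, hd, -, hσ⟩ := h.actsAt_D i
  have h1 : S i * D i = -(D i * S i) := by
    refine h.tensor.ext fun f => ?_
    have e1 := ((h.actsAt_S i).mul hd) f
    have e2 := (hd.mul (h.actsAt_S i)) f
    rw [_root_.neg_apply, e1, e2, hσ, _root_.neg_apply, MultilinearMap.map_update_neg]
  exact congrArg (fun A : H →L[ℂ] H => A x) h1

/-- The vectors constant exactly along the factors outside `A`. -/
def sector (_ : IsSquareSystem τ Q e σ U R Th S D) (A : Finset ι) : Submodule ℂ H where
  carrier := {x | ∀ i, if i ∈ A then Th i x = 0 else Th i x = x}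
  zero_mem' i := by split_ifs <;> simp
  add_mem' {x y} hx hy i := by
    have h1 := hx i
    have h2 := hy i
    split_ifs at h1 h2 ⊢
    · rw [map_add, h1, h2, add_zero]
    · rw [map_add, h1, h2]
  smul_mem' c x hx i := by
    have h1 := hx i
    split_ifs at h1 ⊢
    · rw [map_smul, h1, smul_zero]
    · rw [map_smul, h1]

/-- The part of a sector where `S i = -1` for `i ∈ s` and `S i = 1` for `i ∈ A \ s`. -/
def cell (A s : Finset ι) : Submodule ℂ H where
  carrier := {x | x ∈ h.sector A ∧ ∀ i ∈ A, S i x = if i ∈ s then -x else x}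
  zero_mem' := ⟨zero_mem _, fun i _ => by split_ifs <;> simp⟩
  add_mem' {x y} hx hy := ⟨add_mem hx.1 hy.1, fun i hi => by
    have h1 := hx.2 i hi
    have h2 := hy.2 i hi
    rw [map_add, h1, h2]
    split_ifs <;> [rw [neg_add]; rfl]⟩
  smul_mem' c x hx := ⟨Submodule.smul_mem _ c hx.1, fun i hi => by
    have h1 := hx.2 i hi
    rw [map_smul, h1]
    split_ifs <;> [rw [smul_neg]; rfl]⟩

theorem mem_sector {A : Finset ι} {x : H} :
    x ∈ h.sector A ↔ ∀ i, if i ∈ A then Th i x = 0 else Th i x = x := Iff.rfl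

theorem isClosed_sector (A : Finset ι) : IsClosed (h.sector A : Set H) := by
  have : (h.sector A : Set H) = ⋂ i, {x | if i ∈ A then Th i x = 0 else Th i x = x} := by
    ext x
    simp only [Set.mem_iInter]
    exact Iff.rfl
  rw [this]
  refine isClosed_iInter fun i => ?_
  split_ifs
  · exact isClosed_eq (Th i).continuous continuous_const
  · exact isClosed_eq (Th i).continuous continuous_id

theorem isClosed_cell (A s : Finset ι) : IsClosed (h.cell A s : Set H) := by
  have : (h.cell A s : Set H) = (h.sector A : Set H) ∩
      ⋂ i, ⋂ (_ : i ∈ A), {x | S i x = if i ∈ s then -x else x} := by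
    ext x
    simp only [Set.mem_inter_iff, Set.mem_iInter]
    exact Iff.rfl
  rw [this]
  refine (h.isClosed_sector A).inter (isClosed_iInter fun i => isClosed_iInter fun _ => ?_)
  split_ifs
  · exact isClosed_eq (S i).continuous continuous_neg
  · exact isClosed_eq (S i).continuous continuous_id

theorem sector_hyperinvariant (A : Finset ι) : Hyperinvariant U (h.sector A) := by
  intro B hB x hx
  rw [mem_sector] at hx ⊢
  intro i
  have h1 := hx i
  split_ifs at h1 ⊢
  · rw [h.commute_Th hB, h1, map_zero]
  · rw [h.commute_Th hB, h1]

theorem cell_invariant (A s : Finset ι) : Invariant U (h.cell A s) := by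
  intro z x hx
  refine ⟨h.sector_hyperinvariant A _ (h.repU.map_mem z) x hx.1, fun i hi => ?_⟩
  rw [commutant_apply (h.S_mem i), hx.2 i hi]
  split_ifs <;> simp

theorem cell_orthogonal {A s s' : Finset ι} (hs : s ⊆ A) (hs' : s' ⊆ A) (hne : s ≠ s') :
    h.cell A s ⟂ h.cell A s' := by
  rw [Submodule.isOrtho_iff_inner_eq]
  intro x hx y hy
  obtain ⟨i, hi⟩ : ∃ i, ¬(i ∈ s ↔ i ∈ s') := by
    by_contra hcon
    push Not at hcon
    exact hne (Finset.ext hcon)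
  have hiA : i ∈ A := by
    by_contra hA
    exact hi ⟨fun h' => (hA (hs h')).elim, fun h' => (hA (hs' h')).elim⟩
  have h1 := h.inner_S i x y
  rw [hx.2 i hiA, hy.2 i hiA] at h1
  by_cases h2 : i ∈ s <;> by_cases h3 : i ∈ s'
  · exact (hi ⟨fun _ => h3, fun _ => h2⟩).elim
  · rw [if_pos h2, if_neg h3, inner_neg_left] at h1
    exact self_eq_neg.1 h1.symm
  · rw [if_neg h2, if_pos h3, inner_neg_right] at h1
    exact self_eq_neg.1 h1
  · exact (hi ⟨fun h' => (h2 h').elim, fun h' => (h3 h').elim⟩).elim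

/-- Here `t` is the set of factors where the parity of `x` is still undetermined. One of them is
removed by splitting `x` into its even and odd parts under `S j`, which keeps the parities already
known. -/
theorem mem_iSup_cell {A : Finset ι} (t : Finset ι) : t ⊆ A → ∀ s ⊆ A, ∀ x ∈ h.sector A,
    (∀ i ∈ A \ t, S i x = if i ∈ s then -x else x) →
    x ∈ ⨆ s : A.powerset, h.cell A s := by
  induction t using Finset.induction_on with
  | empty =>
    intro _ s hs x hx hS
    rw [Finset.sdiff_empty] at hS
    exact Submodule.mem_iSup_of_mem ⟨s, Finset.mem_powerset.2 hs⟩ ⟨hx, hS⟩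
  | insert j t hj ih =>
    intro ht s hs x hx hS
    have hjA : j ∈ A := ht (Finset.mem_insert_self j t)
    have htA : t ⊆ A := fun i hi => ht (Finset.mem_insert_of_mem hi)
    have hSx : S j x ∈ h.sector A := h.sector_hyperinvariant A _ (h.S_mem j) x hx
    have hsplit : x = (2⁻¹ : ℂ) • (x + S j x) + (2⁻¹ : ℂ) • (x - S j x) := by
      rw [← smul_add, add_add_sub_cancel, ← two_smul ℂ x, smul_smul]
      norm_num
    have hother : ∀ i ∈ A \ t, i ≠ j → S i x = if i ∈ s then -x else x := by
      intro i hi hij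
      refine hS i ?_
      rw [Finset.mem_sdiff] at hi ⊢
      exact ⟨hi.1, fun h' => (Finset.mem_insert.1 h').elim hij hi.2⟩
    rw [hsplit]
    refine add_mem (Submodule.smul_mem _ _ ?_) (Submodule.smul_mem _ _ ?_)
    · refine ih htA (s.erase j) ((Finset.erase_subset _ _).trans hs) _ (add_mem hx hSx) ?_
      intro i hi
      by_cases hij : i = j
      · subst hij
        rw [if_neg (Finset.notMem_erase i s), map_add, h.S_S, add_comm]
      · rw [map_add, h.S_comm_S, hother i hi hij]
        simp only [Finset.mem_erase, ne_eq, hij, not_false_eq_true, true_and]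
        split_ifs
        · rw [map_neg, neg_add]
        · rfl
    · refine ih htA (insert j s) (Finset.insert_subset hjA hs) _ (sub_mem hx hSx) ?_
      intro i hi
      by_cases hij : i = j
      · subst hij
        rw [if_pos (Finset.mem_insert_self i s), map_sub, h.S_S, neg_sub]
      · rw [map_sub, h.S_comm_S, hother i hi hij]
        simp only [Finset.mem_insert, hij, false_or]
        split_ifs
        · rw [map_neg]; abel
        · rfl

theorem iSup_cell (A : Finset ι) : ⨆ s : A.powerset, h.cell A s = h.sector A := by
  refine le_antisymm (iSup_le fun s x hx => hx.1) fun x hx => ?_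
  exact h.mem_iSup_cell A subset_rfl ∅ (Finset.empty_subset A) x hx (by simp)

/-- `D j` reverses the parity at `j` and keeps the others, and so does its adjoint. Both kill only
vectors fixed by `Th j`, and the sector contains none but zero because `j ∈ A`; hence `D j` is
injective with dense range between the two cells. -/
theorem isomorphicOn_insert {A s : Finset ι} {j : ι} (hjA : j ∈ A) (hj : j ∉ s) :
    IsomorphicOn U (h.cell A s) (h.cell A (insert j s)) := by
  have key : ∀ (B : H →L[ℂ] H), B ∈ commutant U → (∀ i, i ≠ j → ∀ x, S i (B x) = B (S i x)) →
      (∀ x, S j (B x) = -B (S j x)) → ∀ s s' : Finset ι, (j ∈ s' ↔ j ∉ s) →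
      (∀ i, i ≠ j → (i ∈ s' ↔ i ∈ s)) → ∀ x ∈ h.cell A s, B x ∈ h.cell A s' := by
    intro B hB h1 h2 s s' hs1 hs2 x hx
    refine ⟨h.sector_hyperinvariant A B hB x hx.1, fun i hi => ?_⟩
    by_cases hij : i = j
    · subst hij
      rw [h2, hx.2 i hi]
      by_cases hs : i ∈ s
      · rw [if_pos hs, if_neg (fun h' => hs1.1 h' hs), map_neg, neg_neg]
      · rw [if_neg hs, if_pos (hs1.2 hs)]
    · rw [h1 i hij, hx.2 i hi]
      by_cases hs : i ∈ s
      · rw [if_pos hs, if_pos ((hs2 i hij).2 hs), map_neg]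
      · rw [if_neg hs, if_neg (fun h' => hs ((hs2 i hij).1 h'))]
  have hD := key (D j) (h.D_mem j) (fun i hij => h.S_comm_D hij) (h.S_D j)
  have hsD : ∀ s s' : Finset ι, (j ∈ s' ↔ j ∉ s) →
      (∀ i, i ≠ j → (i ∈ s' ↔ i ∈ s)) → ∀ x ∈ h.cell A s, star (D j) x ∈ h.cell A s' := by
    refine key (star (D j)) (h.repU.star_mem (h.D_mem j)) ?_ ?_
    · intro i hij x
      have : S i * D j = D j * S i := by ext1 x; exact h.S_comm_D hij x
      have := congrArg star this
      rw [star_mul, star_mul, h.star_S] at this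
      exact congrArg (fun A : H →L[ℂ] H => A x) this.symm
    · intro x
      have : S j * D j = -(D j * S j) := by ext1 x; exact h.S_D j x
      have := congrArg star this
      rw [star_neg, star_mul, star_mul, h.star_S] at this
      exact congrArg (fun A : H →L[ℂ] H => A x) (neg_eq_iff_eq_neg.1 this.symm)
  have hins : ∀ i, i ≠ j → (i ∈ insert j s ↔ i ∈ s) := fun i hij => by
    simp [Finset.mem_insert, hij]
  have hzero : ∀ s, ∀ x ∈ h.cell A s, Th j x = x → x = 0 := by
    intro s x hx h1
    have := h.mem_sector.1 hx.1 j
    rw [if_pos hjA] at this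
    rw [← h1, this]
  refine h.repU.isomorphicOn_of_injective (h.isClosed_cell A s) (h.isClosed_cell A _)
    (h.cell_invariant A s) (h.cell_invariant A _) (h.D_mem j)
    (hD s (insert j s) (by simp [hj]) hins) ?_ ?_
  · intro x hx h0
    exact hzero s x hx ((h.D_eq_zero j x).1 h0)
  · intro y hy h0
    refine hzero _ y hy ((h.star_D_eq_zero j y).1 ?_)
    have hmem := hsD (insert j s) s (by simp [hj]) (fun i hij => (hins i hij).symm) y hy
    rw [← inner_self_eq_zero (𝕜 := ℂ)]
    conv_lhs => rw [ContinuousLinearMap.star_eq_adjoint, ContinuousLinearMap.adjoint_inner_right]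
    exact h0 _ hmem

theorem isomorphicOn_empty {A : Finset ι} (s : Finset ι) : s ⊆ A →
    IsomorphicOn U (h.cell A ∅) (h.cell A s) := by
  induction s using Finset.induction_on with
  | empty => exact fun _ => IsomorphicOn.refl _
  | insert j s hj ih =>
    intro hs
    rw [Finset.insert_subset_iff] at hs
    exact (ih hs.2).trans (h.cell_invariant A s) (h.isomorphicOn_insert hs.1 hj)

end IsSquareSystem

/-! ### Homogeneity of the sectors and the multiplicities of a square system. -/

variable {ι : Type*} [Fintype ι] [DecidableEq ι]
  {E : ι → Type*} [∀ i, NormedAddCommGroup (E i)] [∀ i, InnerProductSpace ℂ (E i)]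
  [∀ i, CompleteSpace (E i)]
  {H : Type*} [NormedAddCommGroup H] [InnerProductSpace ℂ H] [CompleteSpace H]

namespace IsSquareSystem

variable {τ : MultilinearMap ℂ E H} {Q : ∀ i, ℤ × ℤ → E i →L[ℂ] E i}
    {e : ∀ i, E i} {σ : ∀ i, E i →L[ℂ] E i} {U : ℤ × ℤ → H →L[ℂ] H}
    {R : ι → ℤ × ℤ → H →L[ℂ] H} {Th S D : ι → H →L[ℂ] H}
    (h : IsSquareSystem τ Q e σ U R Th S D)
include h

theorem closure_span_eq_cell {A : Finset ι} {g : ∀ i, E i} (hQ : ∀ i, IsUnitaryRep (Q i))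
    (hg : ∀ i ∈ A, (Submodule.span ℂ (Set.range fun z => Q i z (g i))).topologicalClosure =
      fixedSpace (σ i) ⊓ (ℂ ∙ e i)ᗮ) (hge : ∀ i ∉ A, g i = e i) :
    (Submodule.span ℂ (Set.range fun z => U z (τ g))).topologicalClosure = h.cell A ∅ := by
  set C := (Submodule.span ℂ (Set.range fun z => U z (τ g))).topologicalClosure with hC
  have hCcl : IsClosed (C : Set H) := Submodule.isClosed_topologicalClosure _
  have : CompleteSpace C := hCcl.completeSpace_coe
  have hCinv : Invariant U C := h.repU.invariant_of_cyclic ⟨τ g, rfl⟩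
  -- The projection onto `C` is in the commutant, so it commutes with `R i z`: the cyclic space of
  -- the joint action is invariant under each factor separately.
  have hCR : ∀ i z, ∀ x ∈ C, R i z x ∈ C := by
    intro i z x hx
    have h1 := h.commute_R _ (h.repU.starProjection_mem hCinv) i z x
    rw [Submodule.starProjection_eq_self_iff.2 hx] at h1
    rw [← h1]
    exact C.starProjection_apply_mem _
  have hgmem : ∀ i ∈ A, g i ∈ fixedSpace (σ i) ⊓ (ℂ ∙ e i)ᗮ := by
    intro i hi
    rw [← hg i hi]
    exact Submodule.le_topologicalClosure _ (Submodule.subset_span ⟨0, by simp [(hQ i).map_zero]⟩)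
  have hee : ∀ i, inner ℂ (e i) (e i) = (1 : ℂ) := fun i => by
    rw [inner_self_eq_norm_sq_to_K, h.norm_e]; simp
  have hle : C ≤ h.cell A ∅ := by
    refine Submodule.topologicalClosure_minimal _ (Submodule.span_le.2 ?_) (h.isClosed_cell A ∅)
    rintro _ ⟨z, rfl⟩
    refine h.cell_invariant A ∅ z _ ⟨fun i => ?_, fun i hi => ?_⟩
    · split_ifs with hi
      · rw [h.actsAt_Th, h.proj_apply,
          Submodule.mem_orthogonal_singleton_iff_inner_right.1 (hgmem i hi).2, zero_smul,
          MultilinearMap.map_update_zero]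
      · rw [h.actsAt_Th, h.proj_apply, hge i hi, hee, one_smul, ← hge i hi,
          Function.update_eq_self]
    · rw [h.actsAt_S, mem_fixedSpace.1 (hgmem i hi).1, Function.update_eq_self]
      simp
  refine le_antisymm hle ?_
  let target : ∀ i, Submodule ℂ (E i) := fun i =>
    if i ∈ A then fixedSpace (σ i) ⊓ (ℂ ∙ e i)ᗮ else ℂ ∙ e i
  have htarget : ∀ i, target i ≤
      (Submodule.span ℂ (Set.range fun z => Q i z (g i))).topologicalClosure := by
    intro i
    simp only [target]
    split_ifs with hi
    · rw [hg i hi]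
    · rw [Submodule.span_singleton_le_iff_mem]
      exact Submodule.le_topologicalClosure _
        (Submodule.subset_span ⟨0, by simp [hge i hi, h.map_e]⟩)
  -- Slots are freed one at a time: applying `R j z` moves `g j` through its orbit with the other
  -- slots held fixed, and `C` is closed.
  have hmemC : ∀ t : Finset ι, ∀ f, (∀ i ∈ t, f i ∈ target i) → (∀ i ∉ t, f i = g i) →
      τ f ∈ C := by
    intro t
    induction t using Finset.induction_on with
    | empty =>
      intro f _ hf
      rw [show f = g from funext fun i => hf i (Finset.notMem_empty i)]
      exact Submodule.le_topologicalClosure _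
        (Submodule.subset_span ⟨0, by simp [h.repU.map_zero]⟩)
    | insert j t hj ih =>
      intro f hf1 hf2
      have hbase : τ (Function.update f j (g j)) ∈ C := by
        refine ih _ (fun i hi => ?_) fun i hi => ?_
        · have hij : i ≠ j := fun h' => hj (h' ▸ hi)
          rw [Function.update_of_ne hij]
          exact hf1 i (Finset.mem_insert_of_mem hi)
        · by_cases hij : i = j
          · subst hij; rw [Function.update_self]
          · rw [Function.update_of_ne hij]
            exact hf2 i fun h' => (Finset.mem_insert.1 h').elim hij hi
      have hsub : (Submodule.span ℂ (Set.range fun z => Q j z (g j))).topologicalClosure ≤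
          C.comap (τ.toLinearMap f j) := by
        refine Submodule.topologicalClosure_minimal _ (Submodule.span_le.2 ?_)
          (hCcl.preimage (h.tensor.continuous_update f j))
        rintro _ ⟨z, rfl⟩
        have := hCR j z _ hbase
        rw [h.actsAt_R, Function.update_idem, Function.update_self] at this
        exact this
      have := hsub (htarget j (hf1 j (Finset.mem_insert_self j t)))
      rw [Submodule.mem_comap, MultilinearMap.toLinearMap_apply, Function.update_eq_self] at this
      exact this
  -- `p i` maps the factor into its target, and the operators `P i` are invisible when paired with a
  -- vector of the cell. So a vector of the cell orthogonal to `C` is orthogonal to every `τ f`.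
  let p : ∀ i, E i →L[ℂ] E i := fun i => if i ∈ A then
    (1 - (ℂ ∙ e i).starProjection) * ((2⁻¹ : ℂ) • (1 + σ i)) else (ℂ ∙ e i).starProjection
  let P : ι → H →L[ℂ] H := fun i => if i ∈ A then (1 - Th i) * ((2⁻¹ : ℂ) • (1 + S i)) else Th i
  have hPp : ∀ i, ActsAt τ i (P i) (p i) := by
    intro i
    simp only [P, p]
    split_ifs
    · exact ((ActsAt.one i).sub (h.actsAt_Th i)).mul
        (((ActsAt.one i).add (h.actsAt_S i)).smul _)
    · exact h.actsAt_Th i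
  have hp : ∀ i v, p i v ∈ target i := by
    intro i v
    simp only [p, target]
    split_ifs
    · simp only [mul_apply_eq_comp, _root_.sub_apply, one_apply_eq_self, _root_.smul_apply,
        _root_.add_apply, h.proj_apply]
      have hσσ : σ i (σ i v) = v := congrArg (fun a : E i →L[ℂ] E i => a v) (h.sigma_sigma i)
      refine Submodule.mem_inf.2 ⟨?_, ?_⟩
      · rw [mem_fixedSpace, map_sub, map_smul, map_smul, map_add, hσσ, h.sigma_e,
          add_comm (σ i v)]
      · rw [Submodule.mem_orthogonal_singleton_iff_inner_right, inner_sub_right,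
          inner_smul_right (r := inner ℂ (e i) _), hee, mul_one, sub_self]
    · exact Submodule.starProjection_apply_mem _ _
  have hinner : ∀ x ∈ h.cell A ∅, ∀ i y, inner ℂ x (P i y) = inner ℂ x y := by
    intro x hx i y
    have h1 := h.mem_sector.1 hx.1 i
    simp only [P]
    split_ifs at h1 ⊢ with hi
    · have h2 := hx.2 i hi
      rw [if_neg (Finset.notMem_empty i)] at h2
      rw [mul_apply_eq_comp, _root_.sub_apply, one_apply_eq_self, inner_sub_right, ← h.inner_Th,
        h1, inner_zero_left, sub_zero, _root_.smul_apply, _root_.add_apply, one_apply_eq_self,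
        inner_smul_right, inner_add_right, ← h.inner_S, h2]
      ring
    · rw [← h.inner_Th, h1]
  have hpart : ∀ x ∈ h.cell A ∅, ∀ (f : ∀ i, E i) (t : Finset ι),
      inner ℂ x (τ fun i => if i ∈ t then p i (f i) else f i) = inner ℂ x (τ f) := by
    intro x hx f t
    induction t using Finset.induction_on with
    | empty => simp
    | insert j t hj ih =>
      rw [← ih, ← hinner x hx j (τ fun i => if i ∈ t then p i (f i) else f i), hPp]
      congr 2
      ext1 i
      by_cases hij : i = j
      · subst hij; simp [hj]
      · simp [hij]
  intro x hx
  have hy1 : x - C.starProjection x ∈ h.cell A ∅ :=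
    sub_mem hx (hle (C.starProjection_apply_mem x))
  have hy2 : x - C.starProjection x ∈ Cᗮ := C.sub_starProjection_mem_orthogonal x
  have hy : x - C.starProjection x = 0 := by
    refine h.tensor.eq_zero fun f => ?_
    rw [inner_eq_zero_symm, ← hpart _ hy1 f Finset.univ, inner_eq_zero_symm]
    refine (Submodule.mem_orthogonal _ _).1 hy2 _ (hmemC Finset.univ _ (fun i hi => ?_) ?_)
    · rw [if_pos hi]
      exact hp i _
    · intro i hi
      exact (hi (Finset.mem_univ i)).elim
  rw [sub_eq_zero.1 hy]
  exact C.starProjection_apply_mem x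

/-- With `A = ∅` there are no parities, and the generator of the only cell is the fixed vector `τ
e`, whose orbit is a point. -/
theorem sector_empty (hQ : ∀ i, IsUnitaryRep (Q i)) : h.sector ∅ = ℂ ∙ τ e := by
  have h1 : h.sector ∅ = h.cell ∅ ∅ :=
    le_antisymm (fun x hx => ⟨hx, by simp⟩) fun x hx => hx.1
  have h2 : ∀ z, U z (τ e) = τ e := fun z => by
    rw [h.isTensor]
    congr 1
    ext1 i
    rw [h.map_e]
  rw [h1, ← h.closure_span_eq_cell (g := e) hQ (by simp) (by simp)]
  simp only [h2, Set.range_const]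
  exact (Submodule.closed_of_finiteDimensional _).submodule_topologicalClosure_eq

theorem homogeneousOn_sector (hQ : ∀ i, IsUnitaryRep (Q i))
    (hcyc : ∀ i, IsCyclicSubspace (Q i) (fixedSpace (σ i) ⊓ (ℂ ∙ e i)ᗮ)) (A : Finset ι) :
    HomogeneousOn U (h.sector A) ((2 ^ A.card : ℕ) : ℕ∞) := by
  choose g hg using hcyc
  have hempty : IsCyclicSubspace U (h.cell A ∅) :=
    ⟨_, h.closure_span_eq_cell (g := fun i => if i ∈ A then g i else e i) hQ
      (fun i hi => by simpa [hi] using hg i) (fun i hi => if_neg hi)⟩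
  let ε : {i : ℕ // (i : ℕ∞) < ((2 ^ A.card : ℕ) : ℕ∞)} ≃ A.powerset :=
    ((Equiv.subtypeEquivRight fun i => by rw [Nat.cast_lt]).trans
      Fin.equivSubtype.symm).trans
      (A.powerset.equivFinOfCardEq (Finset.card_powerset A)).symm
  have hsub : ∀ s : A.powerset, (s : Finset ι) ⊆ A := fun s => Finset.mem_powerset.1 s.2
  refine ⟨fun i => h.cell A (ε i), fun i => ?_, fun i j hij => ?_, fun i j => ?_, ?_⟩
  · exact h.repU.isCyclicSubspace_of_isomorphicOn hempty (h.isClosed_cell A _)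
      (h.isomorphicOn_empty _ (hsub _))
  · refine h.cell_orthogonal (hsub _) (hsub _) fun heq => hij (ε.injective (Subtype.ext heq))
  · exact ((h.isomorphicOn_empty _ (hsub (ε i))).symm (h.cell_invariant A ∅)).trans
      (h.cell_invariant A ∅) (h.isomorphicOn_empty _ (hsub (ε j)))
  · rw [ε.iSup_comp (g := fun s : A.powerset => h.cell A s), h.iSup_cell]
    exact (h.isClosed_sector A).submodule_topologicalClosure_eq

/-- Factor by factor, either `Th j x = 0` already, or `x` is replaced by the nonzero `Th j x`, which
stays in `K` and keeps the earlier conditions since the projections commute. -/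
theorem exists_mem_sector {K : Submodule ℂ H} (hK : Hyperinvariant U K) (hne : K ≠ ⊥) :
    ∃ A : Finset ι, ∃ x ∈ K, x ∈ h.sector A ∧ x ≠ 0 := by
  have key : ∀ t : Finset ι, ∃ A : Finset ι, ∃ x ∈ K, x ≠ 0 ∧
      ∀ i ∈ t, if i ∈ A then Th i x = 0 else Th i x = x := by
    intro t
    induction t using Finset.induction_on with
    | empty =>
      obtain ⟨x, hx, h0⟩ := K.ne_bot_iff.1 hne
      exact ⟨∅, x, hx, h0, by simp⟩
    | insert j t hj ih =>
      obtain ⟨A, x, hx, h0, hA⟩ := ih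
      have hmem : ∀ i ∈ t, i ≠ j := fun i hi h' => hj (h' ▸ hi)
      by_cases hT : Th j x = 0
      · refine ⟨insert j A, x, hx, h0, fun i hi => ?_⟩
        rcases Finset.mem_insert.1 hi with rfl | hi
        · rw [if_pos (Finset.mem_insert_self i A), hT]
        · simpa [Finset.mem_insert, hmem i hi] using hA i hi
      · refine ⟨A.erase j, Th j x, hK _ (h.Th_mem j) x hx, hT, fun i hi => ?_⟩
        rcases Finset.mem_insert.1 hi with rfl | hi
        · rw [if_neg (Finset.notMem_erase i A), h.Th_Th]
        · have h1 := hA i hi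
          simp only [Finset.mem_erase, ne_eq, hmem i hi, not_false_eq_true, true_and]
          rw [h.commute_Th (h.Th_mem j)]
          split_ifs at h1 ⊢
          · rw [h1, map_zero]
          · rw [h1]
  obtain ⟨A, x, hx, h0, hA⟩ := key Finset.univ
  exact ⟨A, x, hx, fun i => hA i (Finset.mem_univ i), h0⟩

theorem sector_ne_bot (hne : ∀ i, ∃ v : E i, v ≠ 0 ∧ inner ℂ (e i) v = 0) (A : Finset ι) :
    h.sector A ≠ ⊥ := by
  choose v hv0 hv using hne
  let f : ∀ i, E i := fun i => if i ∈ A then v i else e i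
  have hf : ∀ i, f i = if i ∈ A then v i else e i := fun i => rfl
  rw [Submodule.ne_bot_iff]
  refine ⟨τ f, fun i => ?_, ?_⟩
  · split_ifs with hi
    · rw [h.actsAt_Th, h.proj_apply, hf, if_pos hi, hv, zero_smul, MultilinearMap.map_update_zero]
    · have : (ℂ ∙ e i).starProjection (f i) = f i := by
        rw [hf, if_neg hi, h.proj_apply, inner_self_eq_norm_sq_to_K, h.norm_e]
        simp
      rw [h.actsAt_Th, this, Function.update_eq_self]
  · rw [← norm_ne_zero_iff, h.tensor.norm_map, Finset.prod_ne_zero_iff]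
    intro i _
    rw [norm_ne_zero_iff, hf]
    split_ifs
    · exact hv0 i
    · rw [← norm_ne_zero_iff, h.norm_e]
      exact one_ne_zero

theorem multiplicities_eq (hQ : ∀ i, IsUnitaryRep (Q i))
    (hcyc : ∀ i, IsCyclicSubspace (Q i) (fixedSpace (σ i) ⊓ (ℂ ∙ e i)ᗮ))
    (hne : ∀ i, ∃ v : E i, v ≠ 0 ∧ inner ℂ (e i) v = 0) :
    multiplicities U (ℂ ∙ τ e)ᗮ = (fun j : ℕ => (2 : ℕ∞) ^ j) '' Set.Icc 1 (Fintype.card ι) := by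
  have hMhyp : Hyperinvariant U (ℂ ∙ τ e)ᗮ := by
    rw [← h.sector_empty hQ]
    exact h.repU.orthogonal_hyperinvariant (h.sector_hyperinvariant ∅)
  have hpow : ∀ A : Finset ι, ((2 ^ A.card : ℕ) : ℕ∞) = (2 : ℕ∞) ^ A.card := fun A => by
    push_cast; rfl
  ext n
  constructor
  · rintro ⟨K, hKM, hK0, hdis, hhom⟩
    have hn0 : n ≠ 0 := by
      rintro rfl
      obtain ⟨C, -, -, -, hC⟩ := hhom
      have : IsEmpty {i : ℕ // (i : ℕ∞) < 0} := ⟨fun i => not_lt_bot i.2⟩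
      rw [iSup_of_empty] at hC
      apply hK0
      rw [← hC, isClosed_singleton.submodule_topologicalClosure_eq (s := (⊥ : Submodule ℂ H))]
    obtain ⟨hKcl, hKinv⟩ : IsClosed (K : Set H) ∧ Invariant U K := by
      obtain ⟨C, hC, -, -, rfl⟩ := hhom
      refine ⟨Submodule.isClosed_topologicalClosure _, fun z => ?_⟩
      refine map_topologicalClosure_le (Submodule.isClosed_topologicalClosure _) fun x hx => ?_
      have hle : (⨆ i, C i) ≤ (⨆ i, C i).topologicalClosure.comap (U z).toLinearMap :=
        iSup_le fun i y hy => Submodule.le_topologicalClosure _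
          (Submodule.mem_iSup_of_mem i (h.repU.invariant_of_cyclic (hC i) z y hy))
      exact hle hx
    have hKhyp := h.repU.hyperinvariant_of_disjointOn hKcl hKinv hKM hMhyp hdis
    obtain ⟨A, x, hxK, hxA, hx0⟩ := h.exists_mem_sector hKhyp hK0
    -- The sector `∅` is the line of constants, to which `K` is orthogonal.
    have hA : A.Nonempty := by
      rw [Finset.nonempty_iff_ne_empty]
      rintro rfl
      rw [h.sector_empty hQ] at hxA
      exact hx0 (inner_self_eq_zero.1 ((Submodule.mem_orthogonal _ _).1 (hKM hxK) x hxA))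
    have hAhom := h.homogeneousOn_sector hQ hcyc A
    have hAn0 : ((2 ^ A.card : ℕ) : ℕ∞) ≠ 0 := by simp
    refine ⟨A.card, ⟨hA.card_pos, Finset.card_le_univ A⟩, ?_⟩
    change (2 : ℕ∞) ^ A.card = n
    rw [← hpow]
    -- Different multiplicities would make `K` and the sector orthogonal, although both contain `x ≠
    -- 0`. The space of smaller multiplicity has to be hyperinvariant, and both are; `n = ⊤` falls
    -- under the last case.
    rcases lt_trichotomy n ((2 ^ A.card : ℕ) : ℕ∞) with hlt | heq | hlt
    · have := hhom.orthogonal_of_lt h.repU hAhom hn0 hlt hKhyp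
      exact (hx0 (inner_self_eq_zero.1 (this.inner_eq hxK hxA))).elim
    · exact heq.symm
    · have := hAhom.orthogonal_of_lt h.repU hhom hAn0 hlt (h.sector_hyperinvariant A)
      exact (hx0 (inner_self_eq_zero.1 (this.inner_eq hxA hxK))).elim
  · rintro ⟨j, ⟨hj1, hj2⟩, rfl⟩
    obtain ⟨A, -, hA⟩ := Finset.exists_subset_card_eq (s := (Finset.univ : Finset ι)) (n := j)
      (by rwa [Finset.card_univ])
    refine ⟨h.sector A, ?_, h.sector_ne_bot hne A,
      h.repU.disjointOn_of_hyperinvariant (h.isClosed_sector A) (h.sector_hyperinvariant A), ?_⟩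
    · intro x hx
      obtain ⟨i, hi⟩ : A.Nonempty := Finset.card_pos.1 (by omega)
      have h1 := h.mem_sector.1 hx i
      rw [if_pos hi] at h1
      have h2 : τ e ∈ h.sector ∅ := by
        rw [h.sector_empty hQ]
        exact Submodule.mem_span_singleton_self _
      have h3 := h.mem_sector.1 h2 i
      rw [if_neg (Finset.notMem_empty i)] at h3
      rw [Submodule.mem_orthogonal_singleton_iff_inner_right, ← h3, h.inner_Th, h1,
        inner_zero_right]
    · have := h.homogeneousOn_sector hQ hcyc A
      rwa [hpow, hA] at this

end IsSquareSystem

end Z2Spectral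

/-! ### Application to the measure-preserving actions. -/

namespace L2

/-- On a non-atomic space there are nonzero square integrable functions of mean zero. -/
theorem exists_ne_zero_inner_one {X : Type*} [MeasurableSpace X] [StandardBorelSpace X]
    (μ : Measure X) [IsProbabilityMeasure μ] [NullSingletonClass μ] :
    ∃ f : Lp ℂ 2 μ, f ≠ 0 ∧ inner ℂ (one μ) f = 0 := by
  by_contra! hcon
  have : Nonempty X := nonempty_of_isProbabilityMeasure μ
  -- If `L²` contains only constants, every measurable set is null or conull; countable separation
  -- then concentrates the measure at one point.
  have hzero : ∀ s, MeasurableSet s → (∀ᵐ x ∂μ, x ∈ s) ∨ ∀ᵐ x ∂μ, x ∉ s := by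
    intro s hs
    set f := indicatorConstLp 2 hs (measure_ne_top μ s) (1 : ℂ)
    have h0 : f - Theta μ f = 0 := by
      by_contra hne
      refine hcon _ hne ?_
      rw [Theta_apply, inner_sub_right, inner_smul_right, inner_self_eq_norm_sq_to_K, norm_one]
      simp
    have h1 : f = inner ℂ (one μ) f • one μ := by rw [← Theta_apply, ← sub_eq_zero, h0]
    have h2 : ∀ᵐ x ∂μ, s.indicator (fun _ => (1 : ℂ)) x = inner ℂ (one μ) f := by
      filter_upwards [Lp.coeFn_smul (inner ℂ (one μ) f) (one μ), coeFn_one μ,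
        indicatorConstLp_coeFn (p := 2) (hs := hs) (hμs := measure_ne_top μ s) (c := (1 : ℂ))]
        with x e1 e2 e3
      rw [← e3]
      change f x = _
      conv_lhs => rw [h1]
      rw [e1, Pi.smul_apply, e2, smul_eq_mul, mul_one]
    by_cases hc : inner ℂ (one μ) f = 1
    · left
      filter_upwards [h2] with x hx
      by_contra hxs
      rw [Set.indicator_of_notMem hxs, hc] at hx
      exact zero_ne_one hx
    · right
      filter_upwards [h2] with x hx hxs
      rw [Set.indicator_of_mem hxs] at hx
      exact hc hx.symm
  obtain ⟨a, ha⟩ := exists_eventuallyEq_const_of_forall_separating (l := ae μ) (f := id)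
    MeasurableSet hzero
  have h1 : ∀ᵐ x ∂μ, x ∉ ({a} : Set X) := measure_eq_zero_iff_ae_notMem.1 (measure_singleton a)
  obtain ⟨x, hx1, hx2⟩ := (ha.and h1).exists
  exact hx2 hx1

end L2

open Z2Spectral L2

namespace Z2Action

variable {ι : Type*} [Fintype ι] [DecidableEq ι] {X : ι → Type*} [∀ i, MeasurableSpace (X i)]
  {μ : ∀ i, Measure (X i)} [∀ i, IsProbabilityMeasure (μ i)] (T : ∀ i, Z2Action (X i) (μ i))

theorem commute_factor_of_weakLimit
    (hT : ∀ i, fixedSpace ((T i).koopman (1, 0)) = constants (μ i))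
    {R : ι → ℤ × ℤ → Lp ℂ 2 (Measure.pi fun i => (μ i).prod (μ i)) →L[ℂ]
      Lp ℂ 2 (Measure.pi fun i => (μ i).prod (μ i))}
    (hR : ∀ i z, ActsAt (piTensor fun i => (μ i).prod (μ i)) i (R i z) ((T i).square.koopman z))
    {i : ι} {z : ℤ × ℤ} {w : ℕ → ℤ × ℤ} {a : ι → ℝ} (ha : ∀ j, 0 < a j)
    (hi : WeakLimit (fun n => (T i).koopman (w n))
        ((a i : ℂ) • (T i).koopman z + (1 - (a i : ℂ)) • Theta (μ i)))
    (hj : ∀ j, j ≠ i → WeakLimit (fun n => (T j).koopman (w n))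
        ((a j : ℂ) • ContinuousLinearMap.id ℂ (Lp ℂ 2 (μ j)) +
          (1 - (a j : ℂ)) • Theta (μ j)))
    {B : Lp ℂ 2 (Measure.pi fun i => (μ i).prod (μ i)) →L[ℂ]
      Lp ℂ 2 (Measure.pi fun i => (μ i).prod (μ i))}
    (hB : B ∈ commutant (Z2Action.pi fun i => (T i).square).koopman) :
    B * R i z = R i z * B := by
  have hτ := isTensorProduct_piTensor fun i => (μ i).prod (μ i)
  have hampl : ∀ (r : ℝ) j, ∃ S, ActsAt (piTensor fun i => (μ i).prod (μ i)) j S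
      ((T j).dilateSquare r) := by
    intro r j
    obtain ⟨F, hF, hFn⟩ := exists_actsAt_koop (fun i => (μ i).prod (μ i)) j
      (((T j).measurePreserving (1, 0)).prod (MeasurePreserving.id (μ j)))
    obtain ⟨G, hG, hGn⟩ := exists_actsAt_koop (fun i => (μ i).prod (μ i)) j
      ((MeasurePreserving.id (μ j)).prod ((T j).measurePreserving (1, 0)))
    have hF' := hτ.actsAt_fixProj hF hFn (norm_koop_le _ _)
    have hG' := hτ.actsAt_fixProj hG hGn (norm_koop_le _ _)
    exact ⟨_, (hF'.add (((ActsAt.one j).sub hF').smul (r : ℂ))).mul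
      (hG'.add (((ActsAt.one j).sub hG').smul (r : ℂ)))⟩
  -- The factor action is a tensor of the squares with exponent `0` off `i`, matching the limits `aI
  -- + (1 - a)Θ` there.
  have hRt : ∀ z, IsTensor (piTensor fun i => (μ i).prod (μ i)) (R i z)
      fun j => (T j).square.koopman (if j = i then z else 0) := by
    intro z f
    rw [hR]
    congr 1
    ext1 j
    beta_reduce
    by_cases hji : j = i
    · subst hji
      rw [Function.update_self, if_pos rfl]
    · rw [Function.update_of_ne hji, if_neg hji, (T j).square.isUnitaryRep.map_zero]
      rfl
  refine hτ.commute_of_weakLimit (Z2Action.isUnitaryRep _) (fun j => (T j).square.isUnitaryRep)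
    (fun z => isTensor_pi _ z) (w := w) (s := fun j => (T j).dilateSquare √(a j))
    (s' := fun j => (T j).dilateSquare (√(a j))⁻¹) (fun j => hampl _ j) (fun j => hampl _ j)
    (fun j => star_dilateSquare (hT j) _) ?_ (z := fun j => if j = i then z else 0)
    (fun j => dilateSquare_comm_square (hT j) _ _) ?_ (fun n => norm_koopman_le _ _) (hRt z) ?_ hB
    (R' := R i (-z))
  · intro j
    rw [dilateSquare_mul (hT j), inv_mul_cancel₀ (Real.sqrt_ne_zero'.2 (ha j)), dilateSquare_one]
  · intro j
    refine weakLimit_square (hT j) (ha j) ?_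
    by_cases hji : j = i
    · subst hji
      rw [if_pos rfl]
      exact hi
    · rw [if_neg hji, (T j).isUnitaryRep.map_zero]
      exact hj j hji
  · have := hRt (-z)
    convert this using 3 with j
    split_ifs <;> simp

theorem isSquareSystem
    (hQ : ∀ i, fixedSpace ((T i).square.koopman (1, 0)) = constants ((μ i).prod (μ i)))
    {R A B : ∀ _ : ι, ℤ × ℤ → Lp ℂ 2 (Measure.pi fun i => (μ i).prod (μ i)) →L[ℂ]
      Lp ℂ 2 (Measure.pi fun i => (μ i).prod (μ i))}
    {S : ι → Lp ℂ 2 (Measure.pi fun i => (μ i).prod (μ i)) →L[ℂ]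
      Lp ℂ 2 (Measure.pi fun i => (μ i).prod (μ i))}
    (hR : ∀ i z, ActsAt (piTensor fun i => (μ i).prod (μ i)) i (R i z) ((T i).square.koopman z))
    (hRn : ∀ i z, ‖R i z‖ ≤ 1)
    (hA : ∀ i z, ActsAt (piTensor fun i => (μ i).prod (μ i)) i (A i z) ((T i).koopFst z))
    (hAn : ∀ i z, ‖A i z‖ ≤ 1)
    (hB : ∀ i z, ActsAt (piTensor fun i => (μ i).prod (μ i)) i (B i z) ((T i).koopSnd z))
    (hBn : ∀ i z, ‖B i z‖ ≤ 1)
    (hS : ∀ i, ActsAt (piTensor fun i => (μ i).prod (μ i)) i (S i) (koopSwap (μ i)))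
    (hcomm : ∀ C ∈ commutant (Z2Action.pi fun i => (T i).square).koopman, ∀ i,
      C * R i (1, 0) = R i (1, 0) * C ∧ C * R i (0, 1) = R i (0, 1) * C) :
    IsSquareSystem (piTensor fun i => (μ i).prod (μ i)) (fun i => (T i).square.koopman)
      (fun i => one ((μ i).prod (μ i))) (fun i => koopSwap (μ i))
      (Z2Action.pi fun i => (T i).square).koopman R (fun i => fixProj (R i (1, 0))) S
      (fun i => A i (1, 0) - B i (1, 0)) := by
  have hτ := isTensorProduct_piTensor fun i => (μ i).prod (μ i)
  have hU := (Z2Action.pi fun i => (T i).square).isUnitaryRep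
  have hRadd : ∀ i z w, R i (z + w) = R i z * R i w := fun i z w =>
    hτ.actsAt_unique (hR i (z + w)) ((T i).square.isUnitaryRep.map_add z w ▸ (hR i z).mul (hR i w))
  have hRzero : ∀ i, R i 0 = 1 := fun i =>
    hτ.actsAt_unique (hR i 0) ((T i).square.isUnitaryRep.map_zero ▸ ActsAt.one i)
  have hRstar : ∀ i z, star (R i z) = R i (-z) := fun i z =>
    hτ.actsAt_star (hR i z) ((T i).square.isUnitaryRep.star_eq z ▸ hR i (-z))
  have hcommute : ∀ C ∈ commutant (Z2Action.pi fun i => (T i).square).koopman, ∀ i z,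
      C * R i z = R i z * C := by
    intro C hC i z
    -- The exponents whose operator on factor `i` is in the bicommutant form a subgroup, so the two
    -- generators suffice.
    let G : AddSubgroup (ℤ × ℤ) :=
      { carrier := {z | ∀ C ∈ commutant (Z2Action.pi fun i => (T i).square).koopman,
          C * R i z = R i z * C}
        zero_mem' := fun C _ => by rw [hRzero, one_mul, mul_one]
        add_mem' := fun {z w} hz hw C hC => by
          rw [hRadd, ← mul_assoc, hz C hC, mul_assoc, hw C hC, mul_assoc]
        neg_mem' := fun {z} hz C hC => by
          have := congrArg star (hz _ (hU.star_mem hC))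
          rw [star_mul (star C), star_mul (R i z), star_star, hRstar] at this
          exact this.symm }
    have h1 : ((1, 0) : ℤ × ℤ) ∈ G := fun C hC => (hcomm C hC i).1
    have h2 : ((0, 1) : ℤ × ℤ) ∈ G := fun C hC => (hcomm C hC i).2
    have h3 : z ∈ G := by
      have : z = z.1 • ((1, 0) : ℤ × ℤ) + z.2 • ((0, 1) : ℤ × ℤ) := by ext <;> simp
      rw [this]
      exact add_mem (zsmul_mem h1 _) (zsmul_mem h2 _)
    exact h3 C hC
  have hTh : ∀ i, ActsAt (piTensor fun i => (μ i).prod (μ i)) i (fixProj (R i (1, 0)))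
      (Theta ((μ i).prod (μ i))) := fun i =>
    fixProj_eq_Theta _ (hQ i) ▸ hτ.actsAt_fixProj (hR i (1, 0)) (hRn i _) (norm_koopman_le _ _)
  have hBB : ∀ i z, B i z * B i (-z) = 1 := by
    intro i z
    refine hτ.actsAt_unique ((hB i z).mul (hB i (-z))) ?_
    have : (T i).koopSnd z * (T i).koopSnd (-z) = 1 := by
      rw [koopSnd, koopSnd, koop_mul, ← koop_id]
      refine koop_congr _ _ ?_
      rw [Prod.map_comp_map, map_neg_comp, Function.comp_id, Prod.map_id]
    rw [this]
    exact ActsAt.one i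
  have hAA : ∀ i z, A i z * A i (-z) = 1 := by
    intro i z
    refine hτ.actsAt_unique ((hA i z).mul (hA i (-z))) ?_
    have : (T i).koopFst z * (T i).koopFst (-z) = 1 := by
      rw [koopFst, koopFst, koop_mul, ← koop_id]
      refine koop_congr _ _ ?_
      rw [Prod.map_comp_map, map_neg_comp, Function.comp_id, Prod.map_id]
    rw [this]
    exact ActsAt.one i
  have hAB : ∀ i z w, A i z * B i w = B i w * A i z := fun i z w =>
    hτ.actsAt_comm (hA i z) (hB i w) (by rw [koopFst_mul_koopSnd, koopSnd_mul_koopFst])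
  -- `A x = B x` means that `x` is fixed by `B⁻¹A`, the operator of `T × T⁻¹` on factor `i`. By
  -- ergodicity of `T × T⁻¹` its fixed vectors are those of `T × T`; this gives the kernels of `D i`
  -- and of its adjoint.
  have hfix : ∀ i, fixProj (B i (-(1, 0)) * A i (1, 0)) = fixProj (R i (1, 0)) := by
    intro i
    have hW : fixedSpace ((T i).koopSnd (-(1, 0)) * (T i).koopFst (1, 0)) =
        constants ((μ i).prod (μ i)) := by
      rw [koopSnd_mul_koopFst]
      exact fixedSpace_koop_prodMap_inv ((T i).measurePreserving (1, 0))
        ((T i).measurePreserving (-(1, 0))) (map_neg_comp _ _) (hQ i)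
    refine hτ.actsAt_unique (hτ.actsAt_fixProj ((hB i _).mul (hA i _)) ?_ ?_)
      (fixProj_eq_Theta _ hW ▸ hTh i)
    · exact (norm_mul_le _ _).trans (mul_le_one₀ (hBn _ _) (norm_nonneg _) (hAn _ _))
    · rw [koopSnd_mul_koopFst]
      exact norm_koop_le _ _
  have happ : ∀ {P Q : Lp ℂ 2 (Measure.pi fun i => (μ i).prod (μ i)) →L[ℂ]
      Lp ℂ 2 (Measure.pi fun i => (μ i).prod (μ i))}, P = Q → ∀ x, P x = Q x :=
    fun h x => by rw [h]
  exact
  { tensor := hτ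
    repU := hU
    isTensor := fun z => isTensor_pi _ z
    norm_e := fun i => norm_one _
    map_e := fun i z => koop_one _ _
    actsAt_R := hR
    commute_R := fun C hC i z => happ (hcommute C hC i z)
    actsAt_Th := hTh
    Th_eq := fun i => rfl
    actsAt_S := hS
    sigma_sigma := fun i => koopSwap_mul_koopSwap
    star_sigma := fun i => star_koopSwap
    sigma_e := fun i => koop_one _ _
    sigma_comm := fun i z => koopSwap_mul_square _ _
    actsAt_D := fun i => ⟨_, (hA i (1, 0)).sub (hB i (1, 0)),
      fun z => by
        rw [sub_mul, mul_sub]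
        congr 1
        · exact koopFst_mul_square _ _ _
        · exact koopSnd_mul_square _ _ _,
      by rw [mul_sub, koopSwap_mul_koopFst, koopSwap_mul_koopSnd, sub_mul, neg_sub]⟩
    D_eq_zero := fun i x => by
      rw [← hfix, fixProj_apply_eq_self, _root_.sub_apply, sub_eq_zero, mul_apply_eq_comp]
      constructor
      · intro hx
        have := happ (hBB i (-(1, 0))) x
        rw [neg_neg, mul_apply_eq_comp] at this
        rw [hx, this, one_apply_eq_self]
      · intro hx
        have := happ (hBB i (1, 0)) (A i (1, 0) x)
        rw [mul_apply_eq_comp, hx, one_apply_eq_self] at this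
        exact this.symm
    star_D_eq_zero := fun i x => by
      have hAs : star (A i (1, 0)) = A i (-(1, 0)) :=
        hτ.actsAt_star (hA i _) (star_koopFst (T i) _ ▸ hA i _)
      have hBs : star (B i (1, 0)) = B i (-(1, 0)) :=
        hτ.actsAt_star (hB i _) (star_koopSnd (T i) _ ▸ hB i _)
      rw [← hfix, fixProj_apply_eq_self, ← hAB, star_sub, hAs, hBs, _root_.sub_apply, sub_eq_zero,
        mul_apply_eq_comp]
      constructor
      · intro hx
        have := happ (hAA i (1, 0)) x
        rw [mul_apply_eq_comp] at this
        rw [← hx, this, one_apply_eq_self]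
      · intro hx
        have := happ (hAA i (-(1, 0))) (B i (-(1, 0)) x)
        rw [neg_neg, mul_apply_eq_comp, hx, one_apply_eq_self] at this
        exact this }

end Z2Action

theorem mainTheorem3 (k : ℕ) (X : Fin k → Type*)
    [∀ i, MeasurableSpace (X i)] [∀ i, StandardBorelSpace (X i)]
    (μ : ∀ i, Measure (X i)) [∀ i, IsProbabilityMeasure (μ i)] [∀ i, NullSingletonClass (μ i)]
    (T : ∀ i, Z2Action (X i) (μ i))
    (herg : (Z2Action.pi fun i => (T i).square).TotallyErgodic)
    (hsimple : ∀ i, (T i).SymmetricSquareSimple)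
    (hw : ∀ i, ∃ (w : ℕ → ℤ × ℤ) (a : Fin k → ℝ), (∀ j, 0 < a j) ∧
      Z2Spectral.WeakLimit (fun n => (T i).koopman (w n))
        ((a i : ℂ) • (T i).koopman (1, 0) + (1 - (a i : ℂ)) • L2.Theta (μ i)) ∧
      ∀ j, j ≠ i → Z2Spectral.WeakLimit (fun n => (T j).koopman (w n))
        ((a j : ℂ) • ContinuousLinearMap.id ℂ (Lp ℂ 2 (μ j)) +
          (1 - (a j : ℂ)) • L2.Theta (μ j)))
    (hu : ∀ i, ∃ (u : ℕ → ℤ × ℤ) (b : Fin k → ℝ), (∀ j, 0 < b j) ∧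
      Z2Spectral.WeakLimit (fun n => (T i).koopman (u n))
        ((b i : ℂ) • (T i).koopman (0, 1) + (1 - (b i : ℂ)) • L2.Theta (μ i)) ∧
      ∀ j, j ≠ i → Z2Spectral.WeakLimit (fun n => (T j).koopman (u n))
        ((b j : ℂ) • ContinuousLinearMap.id ℂ (Lp ℂ 2 (μ j)) +
          (1 - (b j : ℂ)) • L2.Theta (μ j))) :
    (Z2Action.pi fun i => (T i).square).spectralMultiplicities =
      (fun j : ℕ => (2 : ℕ∞) ^ j) '' Set.Icc 1 k := by
  have hQ : ∀ i, fixedSpace ((T i).square.koopman (1, 0)) = constants ((μ i).prod (μ i)) :=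
    Z2Action.fixedSpace_koopman_of_ergodic_pi (fun i => (T i).square) (herg (1, 0) (by simp))
  have hT := fun i => Z2Action.fixedSpace_koopman_of_square (hQ i)
  -- `R`, `A`, `B`, `S` are the operators of `T × T`, `T × id`, `id × T` and the flip, placed on
  -- factor `i`.
  choose R hR hRn using fun i z => exists_actsAt_koop (fun i => (μ i).prod (μ i)) i
    ((T i).square.measurePreserving z)
  choose A hA hAn using fun i z => exists_actsAt_koop (fun i => (μ i).prod (μ i)) i
    (((T i).measurePreserving z).prod (MeasurePreserving.id (μ i)))
  choose B hB hBn using fun i z => exists_actsAt_koop (fun i => (μ i).prod (μ i)) i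
    ((MeasurePreserving.id (μ i)).prod ((T i).measurePreserving z))
  choose S hS hSn using fun i => exists_actsAt_koop (fun i => (μ i).prod (μ i)) i
    (Measure.measurePreserving_swap (μ := μ i) (ν := μ i))
  have hsys := Z2Action.isSquareSystem T hQ hR hRn hA hAn hB hBn hS fun C hC i => by
    obtain ⟨w, a, ha, hi, hj⟩ := hw i
    obtain ⟨u, b, hb, hi', hj'⟩ := hu i
    exact ⟨Z2Action.commute_factor_of_weakLimit T hT hR ha hi hj hC,
      Z2Action.commute_factor_of_weakLimit T hT hR hb hi' hj' hC⟩
  -- The simple spectrum hypothesis is the required cyclicity by definition, as symmetric functions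
  -- are the fixed vectors of the flip. The vector `f ⊗ 1` with `f` of mean zero makes every sector
  -- nonzero.
  have hmain := hsys.multiplicities_eq (fun i => (T i).square.isUnitaryRep)
    (fun i => hsimple i) fun i => by
      obtain ⟨f, hf, hf0⟩ := exists_ne_zero_inner_one (μ i)
      have hτ := isTensorProduct_prodTensor (μ i)
      refine ⟨prodTensor (μ i) ![f, one (μ i)], ?_, ?_⟩
      · rw [← norm_ne_zero_iff, hτ.norm_map, Fin.prod_univ_two]
        change ‖f‖ * ‖one (μ i)‖ ≠ 0
        rw [L2.norm_one, mul_one]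
        exact norm_ne_zero_iff.2 hf
      · rw [← prodTensor_one, hτ.inner_map, Fin.prod_univ_two]
        simp [hf0]
  rw [Fintype.card_fin, piTensor_one] at hmain
  exact hmain
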